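/- **Setting.** A state on $\mathbb C^d$ is a positive semidefinite $d\times d$ matrix of trace one. Let $\rho$ be a full-rank state and let $\mathcal D$ be a compact convex set of full-rank states with $\rho\notin\mathcal D$ and with non-empty interior relative to the affine space $\mathsf A_d$ of Hermitian matrices of trace one. Let $\mathcal X$ be a finite outcome set with $|\mathcal X|\ge d$, and let $\mathcal M_{\mathcal X}$ be the set of POVMs $m=(m(x))_{x\in\mathcal X}$ on $\mathbb C^d$. Put $P_{\rho,m}(x)=\operatorname{tr}[m(x)\rho]$, let $D(\cdot\|\cdot)$ be the classical relative entropy, and set $$D_{\mathcal M}(\rho\|\sigma)=\sup_{\mathcal Y\text{ finite}}\ \sup_{m\in\mathcal M_{\mathcal Y}}D(P_{\rho,m}\|P_{\sigma,m}),\quad D_{\mathcal M}(\rho\|\mathcal D)=\inf_{\sigma\in\mathcal D}D_{\mathcal M}(\rho\|\sigma),\quad D_{\mathcal M}(\mathcal D\|\rho)=\inf_{\sigma\in\mathcal D}D_{\mathcal M}(\sigma\|\rho).$$ **Tests.** A sequential test chooses in each round $k$ a POVM $M_k$ from a conditional law given the past record $(M_j,X_j)_{j<k}$, measures a fresh copy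 of the unknown state, observes the outcome $X_k$ (with probability $\operatorname{tr}[M_k(x)\rho^\star]$ for $X_k=x$ under the state $\rho^\star$), and takes a decision $d_k\in\{0,1,*\}$ depending on $(M_j,X_j)_{j\le k}$. It stops at $T=\inf\{k\ge1:d_k\in\{0,1\}\}$. For a sequence of tests, $\mathbb P_{n,\rho^\star}$ is the law of the record of the $n$-th test under the state $\rho^\star$, $\alpha_n^\star=\mathbb P_{n,\rho}(T_n<\infty,\,d_{T_n}=1)$ and $\beta_n^\star=\sup_{\sigma\in\mathcal D}\mathbb P_{n,\sigma}(T_n<\infty,\,d_{T_n}=0)$. The sequence *achieves* $(R_0,R_1)$ if $$\liminf_{n\to\infty}\tfrac1n\log\tfrac1{\alpha_n^\star}\ge R_0,\qquad \liminf_{n\to\infty}\tfrac1n\log\tfrac1{\beta_n^\star}\ge R_1,\qquad \limsup_{n\to\infty}\Bigl(\max\bigl\{\mathbb E_{n,\rho}[T_n],\ \sup_{\sigma\in\mathcal D}\mathbb E_{n,\sigma}[T_n]\bigr\}-n\Bigr)\le0 .$$ **Mixture-SQPRT.** Let $\Pi$ be the uniform probability measure on $\mathcal D$ (normalised Lebesgue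 measure of $\mathsf A_d$ restricted to $\mathcal D$). Put $S_k(\sigma)=\sum_{j=1}^k\log\frac{\operatorname{tr}[M_j(X_j)\rho]}{\operatorname{tr}[M_j(X_j)\sigma]}$ (rounds with $M_j(X_j)=0$, which have probability zero, contribute $0$), $\widetilde L_k=\int_{\mathcal D}e^{-S_k(\sigma)}\,\Pi(d\sigma)$, $\widetilde S_k=-\log\widetilde L_k$, and let $\tilde\sigma_k=\int_{\mathcal D}\sigma\,\widetilde L_k^{-1}e^{-S_k(\sigma)}\,\Pi(d\sigma)$ be the posterior barycentre. Fix measurable maps $m_0^*,m_1^*$ into $\mathcal M_{\mathcal X}$ such that for every $\sigma\in\mathcal D$, $m_0^*(\sigma)$ maximises $m\mapsto D(P_{\rho,m}\|P_{\sigma,m})$ and $m_1^*(\sigma)$ maximises $m\mapsto D(P_{\sigma,m}\|P_{\rho,m})$ over $\mathcal M_{\mathcal X}$. The mixture-SQPRT with parameters $(A,B)$ uses $M_k=m_0^*(\tilde\sigma_{k-1})$ if $\widetilde S_{k-1}\ge0$ and $M_k=m_1^*(\tilde\sigma_{k-1})$ if $\widetilde S_{k-1}<0$, and decides $d_k=0$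 if $\widetilde S_k\ge B$, $d_k=1$ if $\widetilde S_k\le-A$, and $d_k=*$ otherwise. **Proposition.** Let $I=\bigl(0,\min\{D_{\mathcal M}(\rho\|\mathcal D),D_{\mathcal M}(\mathcal D\|\rho)\}\bigr)$. 1. For every $\tau\in I$, the mixture-SQPRTs with parameters $A_n=n\,(D_{\mathcal M}(\mathcal D\|\rho)-\tau)$ and $B_n=n\,(D_{\mathcal M}(\rho\|\mathcal D)-\tau)$ achieve $\bigl(D_{\mathcal M}(\mathcal D\|\rho)-\tau,\ D_{\mathcal M}(\rho\|\mathcal D)-\tau\bigr)$. 2. There is a sequence $\tau_n\in I$ with $\tau_n\to0$ such that the mixture-SQPRTs with parameters $A_n=n\,(D_{\mathcal M}(\mathcal D\|\rho)-\tau_n)$ and $B_n=n\,(D_{\mathcal M}(\rho\|\mathcal D)-\tau_n)$ achieve $\bigl(D_{\mathcal M}(\mathcal D\|\rho),\ D_{\mathcal M}(\rho\|\mathcal D)\bigr)$. -/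

import Mathlib

open MeasureTheory ProbabilityTheory Filter Topology
open scoped ENNReal ComplexOrder

noncomputable section

namespace SequentialQHT

/-- Complex `d × d` matrices. -/
abbrev CMat (d : ℕ) : Type := Matrix (Fin d) (Fin d) ℂ

instance (d : ℕ) : MeasurableSpace (CMat d) :=
  inferInstanceAs (MeasurableSpace (Fin d → Fin d → ℂ))

instance (d : ℕ) : BorelSpace (CMat d) :=
  inferInstanceAs (BorelSpace (Fin d → Fin d → ℂ))

/-! ### States, measurements, Born's rule, measured relative entropy -/

/-- Quantum states on `ℂ^d`: positive semidefinite matrices of trace one. -/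
abbrev State (d : ℕ) : Type := {ρ : CMat d // ρ.PosSemidef ∧ ρ.trace = 1}

/-- The affine space of Hermitian matrices of trace one. -/
def affineStates (d : ℕ) : Set (CMat d) := {A | A.IsHermitian ∧ A.trace = 1}

/-- Positive operator valued measures on `ℂ^d` with outcomes in the finite set `X`, with the
topology and Borel structure induced from `X → CMat d`. -/
abbrev POVM (d : ℕ) (X : Type*) [Fintype X] : Type _ :=
  {m : X → CMat d // (∀ x, (m x).PosSemidef) ∧ ∑ x, m x = 1}

/-- Born's rule: the (real) number `tr[m(x) ρ]`. -/
def bornProb {d : ℕ} {X : Type*} [Fintype X] (m : POVM d X) (x : X) (ρ : CMat d) : ℝ :=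
  (Matrix.trace (m.1 x * ρ)).re

/-- The distribution `P_{ρ,m}` of the outcome when `ρ` is measured with `m`. -/
def bornMeasure {d : ℕ} {X : Type*} [Fintype X] [MeasurableSpace X]
    (ρ : CMat d) (m : POVM d X) : Measure X :=
  ∑ x, ENNReal.ofReal (bornProb m x ρ) • Measure.dirac x

/-- The classical relative entropy `D(P_{ρ,m} ‖ P_{σ,m})`. -/
def outcomeRelEntropy {d : ℕ} {X : Type*} [Fintype X] [MeasurableSpace X]
    (ρ σ : CMat d) (m : POVM d X) : ℝ≥0∞ :=
  InformationTheory.klDiv (bornMeasure ρ m) (bornMeasure σ m)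

/-- The measured relative entropy `D_M(ρ ‖ σ)`: supremum over all finite outcome sets and all
POVMs on them. -/
def measuredRelEntropy {d : ℕ} (ρ σ : CMat d) : ℝ≥0∞ :=
  ⨆ k : ℕ, ⨆ m : POVM d (Fin k), outcomeRelEntropy ρ σ m

/-- `D_M(ρ ‖ 𝒟)`, the infimum of `D_M(ρ ‖ σ)` over `σ ∈ 𝒟`. -/
def measuredRelEntropyToSet {d : ℕ} (ρ : CMat d) (D : Set (CMat d)) : ℝ≥0∞ :=
  ⨅ σ ∈ D, measuredRelEntropy ρ σ

/-- `D_M(𝒟 ‖ ρ)`, the infimum of `D_M(σ ‖ ρ)` over `σ ∈ 𝒟`. -/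
def measuredRelEntropyFromSet {d : ℕ} (D : Set (CMat d)) (ρ : CMat d) : ℝ≥0∞ :=
  ⨅ σ ∈ D, measuredRelEntropy σ ρ

/-! ### The uniform prior -/

/-- The real vector space of traceless Hermitian matrices. -/
def tracelessHermitian (d : ℕ) : Submodule ℝ (CMat d) where
  carrier := {H | H.IsHermitian ∧ H.trace = 0}
  add_mem' := by
    rintro A B ⟨hA, hA'⟩ ⟨hB, hB'⟩
    exact ⟨hA.add hB, by rw [Matrix.trace_add, hA', hB', add_zero]⟩
  zero_mem' := ⟨Matrix.isHermitian_zero, Matrix.trace_zero _ _⟩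
  smul_mem' := by
    rintro c A ⟨hA, hA'⟩
    refine ⟨?_, by rw [Matrix.trace_smul, hA', smul_zero]⟩
    rw [Matrix.IsHermitian, Matrix.conjTranspose_smul, hA.eq, star_trivial]

theorem isClosed_tracelessHermitian (d : ℕ) :
    IsClosed (tracelessHermitian d : Set (CMat d)) := by
  have h : (tracelessHermitian d : Set (CMat d)) =
      {H : CMat d | H.conjTranspose = H} ∩ {H : CMat d | H.trace = 0} := rfl
  rw [h]
  exact (isClosed_eq (by fun_prop) continuous_id).inter
    (isClosed_eq (by fun_prop) continuous_const)

instance (d : ℕ) : LocallyCompactSpace (CMat d) :=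
  inferInstanceAs (LocallyCompactSpace (Fin d → Fin d → ℂ))

instance (d : ℕ) : LocallyCompactSpace (tracelessHermitian d) :=
  (isClosed_tracelessHermitian d).isClosedEmbedding_subtypeVal.locallyCompactSpace

/-- Lebesgue measure on the affine space of Hermitian matrices of trace one, as a measure on all
matrices: the image of a translation invariant (Haar) measure on the traceless Hermitian matrices
under `H ↦ I/d + H`. The Haar measure is unique up to a positive factor, which is irrelevant
below because only normalised restrictions are used. -/
def volAffine (d : ℕ) : Measure (CMat d) :=
  Measure.map (fun H : tracelessHermitian d => (d : ℂ)⁻¹ • (1 : CMat d) + (H : CMat d))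
    Measure.addHaar

/-- The uniform prior on `D`: normalised restriction to `D` of Lebesgue measure on the affine
space of Hermitian matrices of trace one. -/
def uniformPrior {d : ℕ} (D : Set (CMat d)) : Measure (CMat d) := (volAffine d)[|D]

/-! ### Sequential quantum hypothesis tests -/

/-- The possible values `0`, `1`, `*` of a decision rule. -/
inductive Decision : Type
  | null
  | alternative
  | continue

/-- The first `k` pairs (POVM, outcome) of an infinite record; `ω i` is the pair of round
`i + 1`. -/
def hist {Y : Type*} (k : ℕ) (ω : ℕ → Y) : Fin k → Y := fun i => ω i

/-- A sequential quantum hypothesis test with outcome set `X`. `strategy k` is the conditional law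
of the POVM of round `k + 1` given the record of the first `k` rounds, and `decide k` is the
decision after `k` rounds (only used for `k ≥ 1`). -/
structure SQHT (d : ℕ) (X : Type*) [Fintype X] [MeasurableSpace X] where
  strategy : ∀ k : ℕ, Kernel (Fin k → POVM d X × X) (POVM d X)
  isMarkovKernel_strategy : ∀ k, IsMarkovKernel (strategy k)
  decide : ∀ k : ℕ, (Fin k → POVM d X × X) → Decision
  measurableSet_decide : ∀ k δ, MeasurableSet {h | decide k h = δ}

section Measurability

variable {d : ℕ} {X : Type*} [Fintype X] [MeasurableSpace X] [DiscreteMeasurableSpace X]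

theorem measurable_re_trace_mul :
    Measurable fun p : CMat d × CMat d => (Matrix.trace (p.1 * p.2)).re := by
  have hc : Continuous fun p : (Fin d → Fin d → ℂ) × (Fin d → Fin d → ℂ) =>
      (∑ i, ∑ j, p.1 i j * p.2 j i).re := by fun_prop
  exact hc.measurable

theorem measurable_effect : Measurable fun p : POVM d X × X => p.1.1 p.2 := by
  refine measurable_from_prod_countable_left fun x => ?_
  exact (measurable_pi_apply x).comp measurable_subtype_coe

theorem measurable_effect_prod :
    Measurable fun q : (POVM d X × X) × CMat d => (q.1.1.1 q.1.2, q.2) :=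
  (measurable_effect.comp measurable_fst).prodMk measurable_snd

theorem measurable_bornProb :
    Measurable fun q : (POVM d X × X) × CMat d => bornProb q.1.1 q.1.2 q.2 := by
  have h := (measurable_re_trace_mul (d := d)).comp (measurable_effect_prod (d := d) (X := X))
  exact h

theorem measurable_bornMeasure (ρ : CMat d) :
    Measurable fun m : POVM d X => bornMeasure ρ m := by
  refine Measure.measurable_of_measurable_coe _ fun s _ => ?_
  simp only [bornMeasure, Measure.coe_finsetSum, Finset.sum_apply, Measure.smul_apply,
    smul_eq_mul]
  refine Finset.measurable_sum _ fun x _ => Measurable.mul_const ?_ _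
  exact (measurable_bornProb.comp
    ((measurable_id.prodMk measurable_const).prodMk measurable_const)).ennreal_ofReal

end Measurability

section Positivity

open scoped MatrixOrder

theorem bornProb_nonneg {d : ℕ} {X : Type*} [Fintype X] (m : POVM d X) (x : X) (ρ : State d) :
    0 ≤ bornProb m x ρ.1 := by
  obtain ⟨B, hB⟩ : ∃ B : CMat d, m.1 x = B.conjTranspose * B :=
    CStarAlgebra.nonneg_iff_eq_star_mul_self.mp (m.2.1 x).nonneg
  have h := (ρ.2.1.mul_mul_conjTranspose_same B).trace_nonneg
  have e : Matrix.trace (m.1 x * ρ.1) = Matrix.trace (B * ρ.1 * B.conjTranspose) := by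
    rw [hB, Matrix.mul_assoc, Matrix.trace_mul_comm]
  rw [bornProb, e]
  exact (Complex.le_def.mp h).1

end Positivity

theorem sum_bornProb {d : ℕ} {X : Type*} [Fintype X] (m : POVM d X) (ρ : State d) :
    ∑ x, bornProb m x ρ.1 = 1 := by
  simp only [bornProb]
  rw [← Complex.re_sum, ← Matrix.trace_sum, ← Finset.sum_mul, m.2.2, one_mul, ρ.2.2,
    Complex.one_re]

instance {d : ℕ} {X : Type*} [Fintype X] [MeasurableSpace X] (m : POVM d X) (ρ : State d) :
    IsProbabilityMeasure (bornMeasure ρ.1 m) := by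
  constructor
  simp only [bornMeasure, Measure.coe_finsetSum, Finset.sum_apply, Measure.smul_apply,
    smul_eq_mul, measure_univ, mul_one]
  rw [← ENNReal.ofReal_sum_of_nonneg fun x _ => bornProb_nonneg m x ρ, sum_bornProb,
    ENNReal.ofReal_one]

/-- Measuring the state `ρ`: the Markov kernel `m ↦ P_{ρ,m}`. -/
def bornKernel {d : ℕ} {X : Type*} [Fintype X] [MeasurableSpace X] [DiscreteMeasurableSpace X]
    (ρ : State d) : Kernel (POVM d X) X where
  toFun m := bornMeasure ρ.1 m
  measurable' := measurable_bornMeasure ρ.1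

instance {d : ℕ} {X : Type*} [Fintype X] [MeasurableSpace X] [DiscreteMeasurableSpace X]
    (ρ : State d) : IsMarkovKernel (bornKernel (X := X) ρ) :=
  ⟨fun m => inferInstanceAs (IsProbabilityMeasure (bornMeasure ρ.1 m))⟩

namespace SQHT

variable {d : ℕ} {X : Type*} [Fintype X] [MeasurableSpace X] [DiscreteMeasurableSpace X]

instance (S : SQHT d X) (k : ℕ) : IsMarkovKernel (S.strategy k) := S.isMarkovKernel_strategy k

/-- Conditional law of the pair (POVM, outcome) of round `k + 1` given the record of the first `k`
rounds, when the unknown state is `ρ`. -/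
def step (S : SQHT d X) (ρ : State d) (k : ℕ) :
    Kernel (Fin k → POVM d X × X) (POVM d X × X) :=
  (S.strategy k).compProd (Kernel.prodMkLeft _ (bornKernel ρ))

instance (S : SQHT d X) (ρ : State d) (k : ℕ) : IsMarkovKernel (S.step ρ k) := by
  unfold step; infer_instance

/-- `step` for the `(k + 2)`-nd round, with the record of the first `k + 1` rounds indexed by
`{0, …, k}`. -/
def stepIic (S : SQHT d X) (ρ : State d) (k : ℕ) :
    Kernel (∀ _ : Finset.Iic k, POVM d X × X) (POVM d X × X) :=
  (S.step ρ (k + 1)).comap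
    (fun h i => h ⟨i, Finset.mem_Iic.mpr (Nat.lt_succ_iff.mp i.isLt)⟩)
    (measurable_pi_lambda _ fun _ => measurable_pi_apply _)

instance (S : SQHT d X) (ρ : State d) (k : ℕ) : IsMarkovKernel (S.stepIic ρ k) := by
  unfold stepIic; infer_instance

/-- The law of the infinite record of (POVM, outcome) pairs when the unknown state is `ρ`. -/
def law (S : SQHT d X) (ρ : State d) : Measure (ℕ → POVM d X × X) :=
  Kernel.trajMeasure (X := fun _ => POVM d X × X) (S.step ρ 0 Fin.elim0) (S.stepIic ρ)

/-- The stopping time `inf {k ≥ 1 : d_k ∈ {0, 1}}`, equal to `⊤` if the test never stops. -/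
def stoppingTime (S : SQHT d X) (ω : ℕ → POVM d X × X) : ℕ∞ :=
  ⨅ k ∈ {k : ℕ | 1 ≤ k ∧ S.decide k (hist k ω) ≠ Decision.continue}, (k : ℕ∞)

/-- The probability, under the state `ρ`, that the test stops with decision `δ`. -/
def probDecide (S : SQHT d X) (ρ : State d) (δ : Decision) : ℝ≥0∞ :=
  S.law ρ {ω | ∃ k : ℕ, S.stoppingTime ω = k ∧ S.decide k (hist k ω) = δ}

/-- The expected number of samples under the state `ρ`. -/
def expectedTime (S : SQHT d X) (ρ : State d) : ℝ≥0∞ :=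
  ∫⁻ ω, (S.stoppingTime ω : ℝ≥0∞) ∂(S.law ρ)

/-- The Type-I error. -/
def typeI (S : SQHT d X) (ρ : State d) : ℝ≥0∞ := S.probDecide ρ Decision.alternative

/-- The worst-case Type-II error. -/
def typeII (S : SQHT d X) (D : Set (CMat d)) : ℝ≥0∞ :=
  ⨆ σ : State d, ⨆ _ : σ.1 ∈ D, S.probDecide σ Decision.null

/-- The larger of the expected sample size under `ρ` and the worst expected sample size
over `D`. -/
def worstExpectedTime (S : SQHT d X) (ρ : State d) (D : Set (CMat d)) : ℝ≥0∞ :=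
  max (S.expectedTime ρ) (⨆ σ : State d, ⨆ _ : σ.1 ∈ D, S.expectedTime σ)

end SQHT

/-- The sequence of tests `S` achieves the exponents `R₀` (Type I) and `R₁` (worst-case Type II)
under the asymptotic expected sample size constraint. `ENNReal.log` is the natural logarithm with
`log 0 = ⊥` and `log ⊤ = ⊤`. -/
structure Achieves {d : ℕ} {X : Type*} [Fintype X] [MeasurableSpace X] [DiscreteMeasurableSpace X]
    (S : ℕ → SQHT d X) (ρ : State d) (D : Set (CMat d)) (R₀ R₁ : EReal) : Prop where
  typeI_exponent :
    R₀ ≤ liminf (fun n : ℕ => ((1 / (n : ℝ) : ℝ) : EReal) * ENNReal.log (1 / (S n).typeI ρ)) atTop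
  typeII_exponent :
    R₁ ≤ liminf (fun n : ℕ => ((1 / (n : ℝ) : ℝ) : EReal) * ENNReal.log (1 / (S n).typeII D)) atTop
  expectation :
    limsup (fun n : ℕ => ((S n).worstExpectedTime ρ D : EReal) - ((n : ℝ) : EReal)) atTop ≤ 0

/-! ### The mixture-SQPRT -/

section Mixture

variable {d : ℕ} {X : Type*} [Fintype X] [MeasurableSpace X] [DiscreteMeasurableSpace X]

/-- The pointwise log-likelihood ratio `S_k(σ)`. An outcome whose effect is the zero matrix
contributes `log (0 / 0) = 0`. -/
def pointwiseLLR {k : ℕ} (ρ : CMat d) (h : Fin k → POVM d X × X) (σ : CMat d) : ℝ :=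
  ∑ i, Real.log (bornProb (h i).1 (h i).2 ρ / bornProb (h i).1 (h i).2 σ)

/-- The mixture likelihood ratio `∫ exp (-S_k(σ)) Π(dσ)`, with the uniform prior `Π` on `D`. -/
def mixtureLR {k : ℕ} (ρ : CMat d) (D : Set (CMat d)) (h : Fin k → POVM d X × X) : ℝ :=
  ∫ σ, Real.exp (-pointwiseLLR ρ h σ) ∂(uniformPrior D)

/-- The mixture log-likelihood ratio. -/
def mixtureLLR {k : ℕ} (ρ : CMat d) (D : Set (CMat d)) (h : Fin k → POVM d X × X) : ℝ :=
  -Real.log (mixtureLR ρ D h)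

/-- The posterior on `D` given the record `h`. -/
def posterior {k : ℕ} (ρ : CMat d) (D : Set (CMat d)) (h : Fin k → POVM d X × X) :
    Measure (CMat d) :=
  (uniformPrior D).withDensity fun σ =>
    ENNReal.ofReal (Real.exp (-pointwiseLLR ρ h σ) / mixtureLR ρ D h)

/-- The posterior barycentre, the (entrywise) integral of `σ` against the posterior. -/
def barycentre {k : ℕ} (ρ : CMat d) (D : Set (CMat d)) (h : Fin k → POVM d X × X) : CMat d :=
  Matrix.of fun i j => ∫ σ, σ i j ∂(posterior ρ D h)

theorem measurable_pointwiseLLR {k : ℕ} (ρ : CMat d) :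
    Measurable fun p : (Fin k → POVM d X × X) × CMat d => pointwiseLLR ρ p.1 p.2 := by
  unfold pointwiseLLR
  refine Finset.measurable_sum _ fun i _ => ?_
  have hi : Measurable fun p : (Fin k → POVM d X × X) × CMat d => p.1 i :=
    (measurable_pi_apply i).comp measurable_fst
  have h₁ := (measurable_bornProb (d := d) (X := X)).comp (hi.prodMk (measurable_const (a := ρ)))
  have h₂ := (measurable_bornProb (d := d) (X := X)).comp (hi.prodMk measurable_snd)
  have h₃ := Real.measurable_log.comp (h₁.div h₂)
  exact h₃

instance (D : Set (CMat d)) : IsFiniteMeasure (uniformPrior D) := by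
  unfold uniformPrior; infer_instance

theorem measurable_mixtureLR {k : ℕ} (ρ : CMat d) (D : Set (CMat d)) :
    Measurable fun h : Fin k → POVM d X × X => mixtureLR ρ D h :=
  (((measurable_pointwiseLLR ρ).neg.exp.stronglyMeasurable).integral_prod_right
    (ν := uniformPrior D)).measurable

theorem measurable_mixtureLLR {k : ℕ} (ρ : CMat d) (D : Set (CMat d)) :
    Measurable fun h : Fin k → POVM d X × X => mixtureLLR ρ D h :=
  (Real.measurable_log.comp (measurable_mixtureLR ρ D)).neg

theorem measurable_barycentre {k : ℕ} (ρ : CMat d) (D : Set (CMat d)) :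
    Measurable fun h : Fin k → POVM d X × X => barycentre ρ D h := by
  refine measurable_pi_lambda _ fun i => measurable_pi_lambda _ fun j => ?_
  have hm : Measurable fun p : (Fin k → POVM d X × X) × CMat d =>
      ENNReal.ofReal (Real.exp (-pointwiseLLR ρ p.1 p.2) / mixtureLR ρ D p.1) :=
    ((measurable_pointwiseLLR ρ).neg.exp.div
      ((measurable_mixtureLR ρ D).comp measurable_fst)).ennreal_ofReal
  have he : Measurable fun σ : CMat d => σ i j :=
    (measurable_pi_apply j).comp (measurable_pi_apply (X := fun _ : Fin d => Fin d → ℂ) i)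
  have e : (fun h : Fin k → POVM d X × X => barycentre ρ D h i j) = fun h =>
      ∫ σ, (ENNReal.ofReal (Real.exp (-pointwiseLLR ρ h σ) / mixtureLR ρ D h)).toReal • σ i j
        ∂(uniformPrior D) := by
    funext h
    exact integral_withDensity_eq_integral_toReal_smul (hm.comp measurable_prodMk_left)
      (ae_of_all _ fun _ => ENNReal.ofReal_lt_top) _
  rw [e]
  exact ((hm.ennreal_toReal.smul (he.comp measurable_snd)).stronglyMeasurable.integral_prod_right
    (ν := uniformPrior D)).measurable

/-- The POVM of the next round: `m₀` at the posterior barycentre while the mixture log-likelihood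
ratio is nonnegative, `m₁` otherwise. -/
def nextPOVM {k : ℕ} (ρ : CMat d) (D : Set (CMat d)) (m₀ m₁ : CMat d → POVM d X)
    (h : Fin k → POVM d X × X) : POVM d X :=
  open Classical in
  if 0 ≤ mixtureLLR ρ D h then m₀ (barycentre ρ D h) else m₁ (barycentre ρ D h)

/-- The threshold decision rule with parameters `(A, B)`. -/
def thresholdDecision {k : ℕ} (ρ : CMat d) (D : Set (CMat d)) (A B : ℝ)
    (h : Fin k → POVM d X × X) : Decision :=
  open Classical in
  if B ≤ mixtureLLR ρ D h then Decision.null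
  else if mixtureLLR ρ D h ≤ -A then Decision.alternative
  else Decision.continue

theorem measurable_nextPOVM {k : ℕ} (ρ : CMat d) (D : Set (CMat d)) {m₀ m₁ : CMat d → POVM d X}
    (hm₀ : Measurable m₀) (hm₁ : Measurable m₁) :
    Measurable (nextPOVM (k := k) ρ D m₀ m₁) := by
  unfold nextPOVM
  exact Measurable.ite (measurableSet_le measurable_const (measurable_mixtureLLR ρ D))
    (hm₀.comp (measurable_barycentre ρ D)) (hm₁.comp (measurable_barycentre ρ D))

theorem measurableSet_thresholdDecision {k : ℕ} (ρ : CMat d) (D : Set (CMat d)) (A B : ℝ)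
    (δ : Decision) :
    MeasurableSet {h : Fin k → POVM d X × X | thresholdDecision ρ D A B h = δ} := by
  let _ : MeasurableSpace Decision := ⊤
  have hm : Measurable (thresholdDecision (X := X) (k := k) ρ D A B) := by
    unfold thresholdDecision
    exact Measurable.ite (measurableSet_le measurable_const (measurable_mixtureLLR ρ D))
      measurable_const
      (Measurable.ite (measurableSet_le (measurable_mixtureLLR ρ D) measurable_const)
        measurable_const measurable_const)
  exact hm (t := {δ}) trivial

/-- The mixture-SQPRT for `ρ` against `D` with parameters `(A, B)`, built from the measurement
selections `m₀` and `m₁`. -/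
def mixtureSQPRT (ρ : CMat d) (D : Set (CMat d)) (m₀ m₁ : CMat d → POVM d X)
    (hm₀ : Measurable m₀) (hm₁ : Measurable m₁) (A B : ℝ) : SQHT d X where
  strategy k := Kernel.deterministic (nextPOVM (k := k) ρ D m₀ m₁)
    (measurable_nextPOVM ρ D hm₀ hm₁)
  isMarkovKernel_strategy _ := inferInstance
  decide _ := thresholdDecision ρ D A B
  measurableSet_decide _ := measurableSet_thresholdDecision ρ D A B

end Mixture

end SequentialQHT

end

noncomputable section

namespace SequentialQHT

/-! By linearity of Born's rule, averaging outcome laws over the posterior amounts to measuring its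
barycentre. Hence `mixtureLLR` grows in each round by the log-likelihood ratio of `ρ` against the
current barycentre (`mixtureLLR_snoc`), which lies in `D` by convexity. The selected measurements
are optimal for this pair, so the relevant divergence is at least the rate `κ₀ = D_M(ρ‖D)` or `κ₁ =
D_M(D‖ρ)`. This uses that `d` outcomes suffice for the measured relative entropy
(`exists_bornRelEnt_ge`, an operator Jensen inequality for the logarithm). A compactness argument
makes both rates positive, and one-step ratios are uniformly bounded because compact sets of
full-rank states lie between two multiples of the identity.

Conversely, the mixture loses only a logarithm against each single `σ ∈ D` (`mixtureLLR_le`):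
shrinking `D` towards `σ` by the factor `1/(k+1)` keeps prior mass `(k+1)^(-dim)`, and by linearity
costs at most a factor `e` of likelihood over `k` rounds.

Errors are controlled by change of measure. On stopping for the alternative the mixture likelihood
ratio is at least `e^A`, and its integral over the disjoint stopping events is an average of
probabilities, so the Type-I error is at most `e^(-A)` (`typeI_le`). For Type II, the logarithmic
loss gives `e^(-B)` times a polynomial in the stopping time. Late stopping is exponentially unlikely
under `ρ`, so the polynomial costs only a factor `exp (C + ε B)` (`exists_typeII_le`).

Expected times follow from a Wald argument (`expectedTime_le`). Under `ρ` the drift of `mixtureLLR`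
is at least `κ₀` when `m₀` is used, and it is uniformly positive even when `m₁` is used, so rounds
with the wrong sign are summable. Under `σ ∈ D` the barycentre need not be close to `σ`, and the
drift of `-mixtureLLR` is not controlled directly. The combination `K S̃ - (K+1) S(σ)` adds a reward
for the discrepancy: its drift is `D(P_σ‖P_ρ) + K D(P_σ‖P_barycentre)`, which exceeds
`D(P_barycentre‖P_ρ)` up to an error of order `1/K`, while its value exceeds `-S̃` by at most a
logarithm. No consistency of the posterior is needed.

Lowering the thresholds by `n τ` leaves linear slack for all constants. A diagonal choice `τ_n → 0`
gives the second assertion. -/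

/-! ### Relative entropy of finite distributions -/

/-- The relative entropy `∑ p log (p / q)` of two finitely supported distributions. -/
def relEnt {X : Type*} [Fintype X] (p q : X → ℝ) : ℝ := ∑ x, p x * Real.log (p x / q x)

/-- With `a = √p` and `b = √q`, the bound `log (b/a) ≤ b/a - 1` yields `2a² - 2ab = p - q + (a -
b)²`, and `(p - q)² ≤ 4 (a - b)²` since `a + b ≤ 2`. Summed over outcomes this is a weak Pinsker
inequality, because the linear terms cancel. -/
theorem mul_log_div_ge {p q : ℝ} (hp : 0 ≤ p) (hq : 0 ≤ q) (hp1 : p ≤ 1) (hq1 : q ≤ 1)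
    (h : q = 0 → p = 0) : p - q + (p - q) ^ 2 / 4 ≤ p * Real.log (p / q) := by
  rcases hp.eq_or_lt with rfl | hp'
  · simp only [zero_mul]
    nlinarith
  have hq' : 0 < q := hq.lt_of_ne fun h' => hp'.ne' (h h'.symm)
  set a := √p with ha
  set b := √q with hb
  have ha0 : 0 < a := Real.sqrt_pos.mpr hp'
  have hb0 : 0 < b := Real.sqrt_pos.mpr hq'
  have hpa : p = a ^ 2 := (Real.sq_sqrt hp).symm
  have hqb : q = b ^ 2 := (Real.sq_sqrt hq).symm
  have ha1 : a ≤ 1 := Real.sqrt_le_one.mpr hp1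
  have hb1 : b ≤ 1 := Real.sqrt_le_one.mpr hq1
  have hlog : Real.log (p / q) = -(2 * Real.log (b / a)) := by
    have : Real.log (a / b) = -Real.log (b / a) := by rw [← Real.log_inv, inv_div]
    rw [hpa, hqb, ← div_pow, Real.log_pow, this]
    push_cast
    ring
  have h1 := Real.log_le_sub_one_of_pos (div_pos hb0 ha0)
  have h2 : a ^ 2 * (b / a) = a * b := by field_simp
  have h3 : a ^ 2 * Real.log (b / a) ≤ a * b - a ^ 2 := by
    calc _ ≤ a ^ 2 * (b / a - 1) := by gcongr
      _ = _ := by rw [mul_sub, h2, mul_one]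
  rw [hlog, hpa, hqb]
  have h4 : (a + b) ^ 2 ≤ 4 := by nlinarith
  nlinarith [mul_nonneg (sq_nonneg (a - b)) (sub_nonneg.mpr h4)]

theorem sq_dist_le_relEnt {X : Type*} [Fintype X] {p q : X → ℝ} (hp : ∀ x, 0 ≤ p x)
    (hq : ∀ x, 0 ≤ q x) (hp1 : ∑ x, p x = 1) (hq1 : ∑ x, q x = 1) (h : ∀ x, q x = 0 → p x = 0) :
    (∑ x, (p x - q x) ^ 2) / 4 ≤ relEnt p q := by
  have h1 : ∀ x, p x ≤ 1 := fun x => hp1 ▸ Finset.single_le_sum (fun i _ => hp i) (Finset.mem_univ x)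
  have h2 : ∀ x, q x ≤ 1 := fun x => hq1 ▸ Finset.single_le_sum (fun i _ => hq i) (Finset.mem_univ x)
  have := Finset.sum_le_sum fun x (_ : x ∈ Finset.univ) =>
    mul_log_div_ge (hp x) (hq x) (h1 x) (h2 x) (h x)
  rw [Finset.sum_add_distrib, Finset.sum_sub_distrib, hp1, hq1, sub_self, zero_add,
    ← Finset.sum_div] at this
  exact this

theorem relEnt_nonneg {X : Type*} [Fintype X] {p q : X → ℝ} (hp : ∀ x, 0 ≤ p x)
    (hq : ∀ x, 0 ≤ q x) (hp1 : ∑ x, p x = 1) (hq1 : ∑ x, q x = 1) (h : ∀ x, q x = 0 → p x = 0) :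
    0 ≤ relEnt p q :=
  (div_nonneg (Finset.sum_nonneg fun _ _ => sq_nonneg _) (by norm_num)).trans
    (sq_dist_le_relEnt hp hq hp1 hq1 h)

/-- A trade-off between the drift of a log-likelihood ratio against a reference `r` and the
regret of predicting with `s` instead of the true distribution `p`. -/
theorem relEnt_sub_le_drift {X : Type*} [Fintype X] {p s r : X → ℝ} (hp : ∀ x, 0 ≤ p x)
    (hs : ∀ x, 0 ≤ s x) (hp1 : ∑ x, p x = 1) (hs1 : ∑ x, s x = 1)
    (hps : ∀ x, p x = 0 ↔ s x = 0) (hpr : ∀ x, p x = 0 ↔ r x = 0) {L K : ℝ} (hK : 0 ≤ K)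
    (hL : ∀ x, |Real.log (s x / r x)| ≤ L) :
    relEnt s r - Fintype.card X * L ^ 2 / (K + 1) ≤
      ∑ x, p x * ((K + 1) * Real.log (p x / r x) - K * Real.log (s x / r x)) := by
  have h1 : ∀ x, p x ≤ 1 := fun x => hp1 ▸ Finset.single_le_sum (fun i _ => hp i) (Finset.mem_univ x)
  have h2 : ∀ x, s x ≤ 1 := fun x => hs1 ▸ Finset.single_le_sum (fun i _ => hs i) (Finset.mem_univ x)
  -- The right-hand side equals `p ((K+1) log (p/s) + log (s/r))`. The quadratic gain in `(K+1) p
  -- log (p/s)` pays for replacing the weight `p` by `s` in front of `log (s/r)`.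
  have key : ∀ x, s x * Real.log (s x / r x) + (K + 1) * (p x - s x) - L ^ 2 / (K + 1) ≤
      p x * ((K + 1) * Real.log (p x / r x) - K * Real.log (s x / r x)) := by
    intro x
    by_cases h0 : p x = 0
    · have h0' := (hps x).mp h0
      simp only [h0, h0', zero_mul, sub_self, mul_zero, add_zero, zero_sub]
      have : 0 ≤ L ^ 2 / (K + 1) := by positivity
      linarith
    have hs0 : s x ≠ 0 := fun h => h0 ((hps x).mpr h)
    have hr0 : r x ≠ 0 := fun h => h0 ((hpr x).mpr h)
    have e : Real.log (p x / s x) = Real.log (p x / r x) - Real.log (s x / r x) := by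
      rw [Real.log_div h0 hs0, Real.log_div h0 hr0, Real.log_div hs0 hr0]; ring
    have g := mul_log_div_ge (hp x) (hs x) (h1 x) (h2 x) (hps x).mpr
    rw [e] at g
    have hl : Real.log (s x / r x) ^ 2 ≤ L ^ 2 := by
      rw [← sq_abs]; gcongr; exact hL x
    set l := Real.log (s x / r x)
    set t := Real.log (p x / r x)
    have hK1 : 0 < K + 1 := by linarith
    have g' := mul_le_mul_of_nonneg_left g hK1.le
    have amgm : -((K + 1) * (p x - s x) ^ 2 / 4) - L ^ 2 / (K + 1) ≤ (p x - s x) * l := by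
      have : l ^ 2 / (K + 1) ≤ L ^ 2 / (K + 1) := by gcongr
      have h5 : 0 ≤ ((K + 1) * (p x - s x) / 2 + l) ^ 2 / (K + 1) := by positivity
      have h6 : ((K + 1) * (p x - s x) / 2 + l) ^ 2 / (K + 1) =
        (K + 1) * (p x - s x) ^ 2 / 4 + (p x - s x) * l + l ^ 2 / (K + 1) := by
        field_simp; ring
      linarith
    nlinarith
  have := Finset.sum_le_sum fun x (_ : x ∈ Finset.univ) => key x
  rw [Finset.sum_sub_distrib, Finset.sum_add_distrib, ← Finset.mul_sum, Finset.sum_sub_distrib, hp1,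
    hs1, sub_self, mul_zero, add_zero, Finset.sum_const, nsmul_eq_mul, Finset.card_univ,
    ← mul_div_assoc] at this
  exact this

/-- The case `r = p` of the trade-off. For large `K` it turns a lower bound on one divergence into a
lower bound on the reversed one. -/
theorem relEnt_sub_le_mul_relEnt_swap {X : Type*} [Fintype X] {p s : X → ℝ} (hp : ∀ x, 0 ≤ p x)
    (hs : ∀ x, 0 ≤ s x) (hp1 : ∑ x, p x = 1) (hs1 : ∑ x, s x = 1)
    (hps : ∀ x, p x = 0 ↔ s x = 0) {L K : ℝ} (hK : 0 ≤ K)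
    (hL : ∀ x, |Real.log (s x / p x)| ≤ L) :
    relEnt s p - Fintype.card X * L ^ 2 / (K + 1) ≤ K * relEnt p s := by
  refine (relEnt_sub_le_drift hp hs hp1 hs1 hps (fun _ => Iff.rfl) hK hL).trans_eq ?_
  rw [relEnt, Finset.mul_sum]
  refine Finset.sum_congr rfl fun x _ => ?_
  by_cases h0 : p x = 0
  · simp [h0]
  have : Real.log (p x / s x) = - Real.log (s x / p x) := by rw [← Real.log_inv, inv_div]
  rw [this, div_self h0, Real.log_one]; ring

/-! ### Positive matrices and Born probabilities -/

section Positivity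

open scoped MatrixOrder

theorem trace_mul_re_nonneg {d : ℕ} {A B : CMat d} (hA : A.PosSemidef) (hB : B.PosSemidef) :
    0 ≤ (Matrix.trace (A * B)).re := by
  obtain ⟨C, hC⟩ : ∃ C : CMat d, A = C.conjTranspose * C :=
    CStarAlgebra.nonneg_iff_eq_star_mul_self.mp hA.nonneg
  have h := (hB.mul_mul_conjTranspose_same C).trace_nonneg
  rw [hC, Matrix.mul_assoc, Matrix.trace_mul_comm]
  exact (Complex.le_def.mp h).1

end Positivity

theorem bornProb_sub {d : ℕ} {X : Type*} [Fintype X] (m : POVM d X) (x : X) (σ τ : CMat d) :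
    bornProb m x (σ - τ) = bornProb m x σ - bornProb m x τ := by
  simp [bornProb, mul_sub]

theorem bornProb_add {d : ℕ} {X : Type*} [Fintype X] (m : POVM d X) (x : X) (σ τ : CMat d) :
    bornProb m x (σ + τ) = bornProb m x σ + bornProb m x τ := by
  simp [bornProb, mul_add]

theorem bornProb_smul {d : ℕ} {X : Type*} [Fintype X] (m : POVM d X) (x : X) (c : ℝ)
    (σ : CMat d) : bornProb m x (c • σ) = c * bornProb m x σ := by
  simp [bornProb]

/-- The quadratic form of a matrix on a compact set of matrices is comparable to the squared norm:
uniform upper and, for positive definite matrices, lower bounds. -/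
theorem exists_uniform_bounds {d : ℕ} {F : Set (CMat d)} (hF : IsCompact F)
    (hpos : ∀ σ ∈ F, σ.PosDef) :
    ∃ c C : ℝ, 0 < c ∧ 0 < C ∧ ∀ σ ∈ F, (σ - c • (1 : CMat d)).PosSemidef ∧
      (C • (1 : CMat d) - σ).PosSemidef := by
  let f : CMat d × EuclideanSpace ℂ (Fin d) → ℝ := fun p =>
    (star p.2.ofLp ⬝ᵥ (p.1.mulVec p.2.ofLp)).re
  have hf : Continuous f := by
    have : Continuous fun p : CMat d × EuclideanSpace ℂ (Fin d) =>
      star p.2.ofLp ⬝ᵥ (p.1.mulVec p.2.ofLp) := by fun_prop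
    exact Complex.continuous_re.comp this
  have hcomp : IsCompact (F ×ˢ Metric.sphere (0 : EuclideanSpace ℂ (Fin d)) 1) :=
    hF.prod (isCompact_sphere _ _)
  have hb : ∃ c C : ℝ, 0 < c ∧ 0 < C ∧
      ∀ p ∈ F ×ˢ Metric.sphere (0 : EuclideanSpace ℂ (Fin d)) 1, c ≤ f p ∧ f p ≤ C := by
    rcases (F ×ˢ Metric.sphere (0 : EuclideanSpace ℂ (Fin d)) 1).eq_empty_or_nonempty with h | h
    · exact ⟨1, 1, one_pos, one_pos, by simp [h]⟩
    obtain ⟨p₀, hp₀, h₀⟩ := hcomp.exists_isMinOn h hf.continuousOn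
    obtain ⟨p₁, hp₁, h₁⟩ := hcomp.exists_isMaxOn h hf.continuousOn
    have hp : ∀ p ∈ F ×ˢ Metric.sphere (0 : EuclideanSpace ℂ (Fin d)) 1, 0 < f p := by
      rintro ⟨σ, v⟩ ⟨hσ, hv⟩
      have hv0 : v.ofLp ≠ 0 := by
        intro h0
        have : v = 0 := by ext i; exact congrFun h0 i
        simp [this] at hv
      exact (Complex.lt_def.mp ((hpos σ hσ).dotProduct_mulVec_pos hv0)).1
    exact ⟨f p₀, f p₁, hp _ hp₀, hp _ hp₁, fun p hp => ⟨h₀ hp, h₁ hp⟩⟩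
  obtain ⟨c, C, hc, hC, hcC⟩ := hb
  have hq : ∀ σ ∈ F, ∀ v : Fin d → ℂ, c * (star v ⬝ᵥ v).re ≤ (star v ⬝ᵥ σ.mulVec v).re ∧
      (star v ⬝ᵥ σ.mulVec v).re ≤ C * (star v ⬝ᵥ v).re := by
    intro σ hσ v
    by_cases hv : v = 0
    · simp [hv]
    set w : EuclideanSpace ℂ (Fin d) := WithLp.toLp 2 v with hw
    have hw0 : ‖w‖ ≠ 0 := by
      rw [norm_ne_zero_iff]; intro h; apply hv; ext i; exact congrArg (fun z => z.ofLp i) h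
    have hn : (star v ⬝ᵥ v).re = ‖w‖ ^ 2 := by
      rw [EuclideanSpace.norm_sq_eq]
      simp [dotProduct, hw, Complex.sq_norm, Complex.normSq_apply]
    have hs : ((‖w‖⁻¹ : ℝ) : ℂ) • w ∈ Metric.sphere (0 : EuclideanSpace ℂ (Fin d)) 1 := by
      rw [mem_sphere_zero_iff_norm, norm_smul, Complex.norm_real, norm_inv, norm_norm,
        inv_mul_cancel₀ hw0]
    have hfe : f (σ, ((‖w‖⁻¹ : ℝ) : ℂ) • w) = (‖w‖ ^ 2)⁻¹ * (star v ⬝ᵥ σ.mulVec v).re := by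
      simp only [f, WithLp.ofLp_smul, star_smul, Matrix.mulVec_smul, smul_dotProduct,
        dotProduct_smul, smul_eq_mul, hw]
      rw [← mul_assoc, RCLike.star_def, Complex.conj_ofReal, ← Complex.ofReal_mul,
        Complex.re_ofReal_mul]
      congr 1
      rw [← mul_inv, sq]
    have := hcC _ (Set.mk_mem_prod hσ hs)
    rw [hfe] at this
    have hw2 : 0 < ‖w‖ ^ 2 := by positivity
    rw [hn, ← div_eq_inv_mul, le_div_iff₀ hw2, div_le_iff₀ hw2] at *
    exact this
  have him : ∀ A : CMat d, A.IsHermitian → (∀ v : Fin d → ℂ, 0 ≤ (star v ⬝ᵥ A.mulVec v).re) →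
      A.PosSemidef := by
    intro A hA hv
    refine Matrix.PosSemidef.of_dotProduct_mulVec_nonneg hA fun v => ?_
    rw [Complex.le_def]
    refine ⟨hv v, ?_⟩
    have := hA.im_star_dotProduct_mulVec_self v
    simpa using this.symm
  have h1 : ∀ c : ℝ, (c • (1 : CMat d)).IsHermitian := by
    intro c
    rw [Matrix.IsHermitian, Matrix.conjTranspose_smul, Matrix.conjTranspose_one, star_trivial]
  refine ⟨c, C, hc, hC, fun σ hσ => ⟨him _ ((hpos σ hσ).1.sub (h1 c)) fun v => ?_,
    him _ ((h1 C).sub (hpos σ hσ).1) fun v => ?_⟩⟩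
  · have := (hq σ hσ v).1
    simp only [Matrix.sub_mulVec, Matrix.smul_mulVec, Matrix.one_mulVec, dotProduct_sub,
      dotProduct_smul, Complex.sub_re, Complex.smul_re, smul_eq_mul]
    linarith
  · have := (hq σ hσ v).2
    simp only [Matrix.sub_mulVec, Matrix.smul_mulVec, Matrix.one_mulVec, dotProduct_sub,
      dotProduct_smul, Complex.sub_re, Complex.smul_re, smul_eq_mul]
    linarith

/-- From `c ≤ σ ≤ C` as operators, every Born probability lies between `c` and `C` times the trace
of the effect. Ratios are then bounded independently of the measurement; for a zero effect the ratio
is `0 / 0 = 0`, with logarithm `0`. -/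
theorem exists_log_bornProb_bound {d : ℕ} (X : Type*) [Fintype X] {F : Set (CMat d)}
    (hF : IsCompact F) (hpos : ∀ σ ∈ F, σ.PosDef) :
    ∃ L : ℝ, 0 ≤ L ∧ ∀ (m : POVM d X) (x : X), ∀ σ ∈ F, ∀ τ ∈ F,
      (bornProb m x σ = 0 → bornProb m x τ = 0) ∧
        |Real.log (bornProb m x σ / bornProb m x τ)| ≤ L := by
  obtain ⟨c, C, hc, hC, h⟩ := exists_uniform_bounds hF hpos
  have hb : ∀ (m : POVM d X) (x : X), ∀ σ ∈ F, c * bornProb m x 1 ≤ bornProb m x σ ∧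
      bornProb m x σ ≤ C * bornProb m x 1 := by
    intro m x σ hσ
    have h1 : 0 ≤ bornProb m x (σ - c • (1 : CMat d)) :=
      trace_mul_re_nonneg (m.2.1 x) (h σ hσ).1
    have h2 : 0 ≤ bornProb m x (C • (1 : CMat d) - σ) :=
      trace_mul_re_nonneg (m.2.1 x) (h σ hσ).2
    rw [bornProb_sub, bornProb_smul] at h1 h2
    exact ⟨by linarith, by linarith⟩
  have h0 : ∀ (m : POVM d X) (x : X), 0 ≤ bornProb m x (1 : CMat d) := fun m x =>
    trace_mul_re_nonneg (m.2.1 x) Matrix.PosSemidef.one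
  have hlog : ∀ (m : POVM d X) (x : X), ∀ σ ∈ F, ∀ τ ∈ F, 0 < bornProb m x (1 : CMat d) →
      Real.log (bornProb m x σ / bornProb m x τ) ≤ |Real.log (C / c)| := by
    intro m x σ hσ τ hτ ht
    refine le_trans ?_ (le_abs_self _)
    have hτ0 : 0 < bornProb m x τ := lt_of_lt_of_le (by positivity) (hb m x τ hτ).1
    have hσ0 : 0 < bornProb m x σ := lt_of_lt_of_le (by positivity) (hb m x σ hσ).1
    refine Real.log_le_log (by positivity) ?_
    rw [div_le_div_iff₀ hτ0 hc]
    nlinarith [(hb m x σ hσ).2, (hb m x τ hτ).1]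
  refine ⟨|Real.log (C / c)|, abs_nonneg _, fun m x σ hσ τ hτ => ?_⟩
  rcases (h0 m x).eq_or_lt with ht | ht
  · have hz : ∀ υ ∈ F, bornProb m x υ = 0 := by
      intro υ hυ
      have := hb m x υ hυ
      rw [← ht] at this
      linarith
    simp [hz σ hσ, hz τ hτ]
  · have hσ0 : 0 < bornProb m x σ := lt_of_lt_of_le (by positivity) (hb m x σ hσ).1
    refine ⟨fun h => absurd h hσ0.ne', abs_le.mpr ⟨?_, hlog m x σ hσ τ hτ ht⟩⟩
    have := hlog m x τ hτ σ hσ ht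
    rw [← inv_div, Real.log_inv] at this
    linarith

/-! ### Measured relative entropy as a finite sum -/

theorem sum_smul_dirac_singleton {X : Type*} [Fintype X] [MeasurableSpace X]
    [DiscreteMeasurableSpace X] (p : X → ℝ≥0∞) (x : X) :
    (∑ y, p y • Measure.dirac y : Measure X) {x} = p x := by
  classical
  simp only [Measure.coe_finsetSum, Finset.sum_apply, Measure.smul_apply, smul_eq_mul,
    Measure.dirac_apply' _ (MeasurableSet.of_discrete (s := {x}))]
  rw [Finset.sum_eq_single x]
  · simp
  · intro y _ hy
    simp [hy]
  · simp

theorem lintegral_sum_smul_dirac {X : Type*} [Fintype X] [MeasurableSpace X]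
    [DiscreteMeasurableSpace X] (p f : X → ℝ≥0∞) :
    ∫⁻ x, f x ∂(∑ y, p y • Measure.dirac y : Measure X) = ∑ x, p x * f x := by
  rw [lintegral_fintype]
  exact Finset.sum_congr rfl fun x _ => by rw [sum_smul_dirac_singleton, mul_comm]

/-- The Radon–Nikodym derivative is `p / q`, and the total-mass correction in `klDiv` vanishes
because both measures have mass one. -/
theorem klDiv_sum_dirac {X : Type*} [Fintype X] [MeasurableSpace X]
    [DiscreteMeasurableSpace X] {p q : X → ℝ} (hp : ∀ x, 0 ≤ p x) (hq : ∀ x, 0 ≤ q x)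
    (hp1 : ∑ x, p x = 1) (hq1 : ∑ x, q x = 1) (h : ∀ x, q x = 0 → p x = 0) :
    InformationTheory.klDiv (∑ x, ENNReal.ofReal (p x) • Measure.dirac x)
      (∑ x, ENNReal.ofReal (q x) • Measure.dirac x : Measure X) =
      ENNReal.ofReal (relEnt p q) := by
  set μ : Measure X := ∑ x, ENNReal.ofReal (p x) • Measure.dirac x with hμ
  set ν : Measure X := ∑ x, ENNReal.ofReal (q x) • Measure.dirac x with hν
  have hfin : ∀ r : X → ℝ, (∀ x, 0 ≤ r x) → ∑ x, r x = 1 →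
      IsProbabilityMeasure (∑ x, ENNReal.ofReal (r x) • Measure.dirac x : Measure X) := by
    intro r hr hr1
    constructor
    simp only [Measure.coe_finsetSum, Finset.sum_apply, Measure.smul_apply, smul_eq_mul,
      measure_univ, mul_one]
    rw [← ENNReal.ofReal_sum_of_nonneg fun x _ => hr x, hr1, ENNReal.ofReal_one]
  have : IsProbabilityMeasure μ := hfin p hp hp1
  have : IsProbabilityMeasure ν := hfin q hq hq1
  have hwd : μ = ν.withDensity fun x => ENNReal.ofReal (p x / q x) := by
    refine Measure.ext_of_singleton fun x => ?_
    rw [withDensity_apply _ (MeasurableSet.of_discrete), lintegral_singleton,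
      hμ, sum_smul_dirac_singleton, hν, sum_smul_dirac_singleton,
      ← ENNReal.ofReal_mul (div_nonneg (hp x) (hq x))]
    congr 1
    by_cases h0 : q x = 0
    · simp [h0, h x h0]
    · field_simp
  have hac : μ ≪ ν := hwd ▸ withDensity_absolutelyContinuous _ _
  have hrn : μ.rnDeriv ν =ᵐ[ν] fun x => ENNReal.ofReal (p x / q x) := by
    conv_lhs => rw [hwd]
    exact Measure.rnDeriv_withDensity ν Measurable.of_discrete
  have hllr : llr μ ν =ᵐ[μ] fun x => Real.log (p x / q x) := by
    filter_upwards [hac.ae_le hrn] with x hx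
    rw [llr, hx, ENNReal.toReal_ofReal (div_nonneg (hp x) (hq x))]
  rw [InformationTheory.klDiv_of_ac_of_integrable hac (Integrable.of_finite), probReal_univ,
    probReal_univ, integral_congr_ae hllr, integral_fintype Integrable.of_finite]
  congr 1
  rw [add_sub_cancel_right, relEnt]
  refine Finset.sum_congr rfl fun x _ => ?_
  rw [measureReal_def, hμ, sum_smul_dirac_singleton, ENNReal.toReal_ofReal (hp x), smul_eq_mul]

/-- The relative entropy of the outcome distributions as a real number. -/
def bornRelEnt {d : ℕ} {X : Type*} [Fintype X] (ρ σ : CMat d) (m : POVM d X) : ℝ :=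
  relEnt (fun x => bornProb m x ρ) (fun x => bornProb m x σ)

theorem bornProb_eq_zero_of_posDef {d : ℕ} {X : Type*} [Fintype X] {σ τ : CMat d}
    (hσ : σ.PosDef) (hτ : τ.PosDef) (m : POVM d X) (x : X) (h : bornProb m x σ = 0) :
    bornProb m x τ = 0 := by
  obtain ⟨L, -, hL⟩ := exists_log_bornProb_bound X (F := {σ, τ}) (Set.toFinite _).isCompact
    (by rintro _ (rfl | rfl) <;> assumption)
  exact (hL m x σ (by simp) τ (by simp)).1 h

theorem outcomeRelEntropy_eq {d : ℕ} {X : Type*} [Fintype X] [MeasurableSpace X]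
    [DiscreteMeasurableSpace X] {ρ σ : State d} (hρ : ρ.1.PosDef) (hσ : σ.1.PosDef)
    (m : POVM d X) : outcomeRelEntropy ρ.1 σ.1 m = ENNReal.ofReal (bornRelEnt ρ.1 σ.1 m) :=
  klDiv_sum_dirac (fun x => bornProb_nonneg m x ρ) (fun x => bornProb_nonneg m x σ)
    (sum_bornProb m ρ) (sum_bornProb m σ) fun x => bornProb_eq_zero_of_posDef hσ hρ m x

theorem bornRelEnt_nonneg {d : ℕ} {X : Type*} [Fintype X] {ρ σ : State d} (hρ : ρ.1.PosDef)
    (hσ : σ.1.PosDef) (m : POVM d X) : 0 ≤ bornRelEnt ρ.1 σ.1 m :=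
  relEnt_nonneg (fun x => bornProb_nonneg m x ρ) (fun x => bornProb_nonneg m x σ)
    (sum_bornProb m ρ) (sum_bornProb m σ) fun x => bornProb_eq_zero_of_posDef hσ hρ m x

theorem sq_dist_le_bornRelEnt {d : ℕ} {X : Type*} [Fintype X] {ρ σ : State d} (hρ : ρ.1.PosDef)
    (hσ : σ.1.PosDef) (m : POVM d X) (x : X) :
    (bornProb m x ρ.1 - bornProb m x σ.1) ^ 2 / 4 ≤ bornRelEnt ρ.1 σ.1 m := by
  refine le_trans ?_ (sq_dist_le_relEnt (fun x => bornProb_nonneg m x ρ)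
    (fun x => bornProb_nonneg m x σ) (sum_bornProb m ρ) (sum_bornProb m σ)
    fun x => bornProb_eq_zero_of_posDef hσ hρ m x)
  gcongr
  exact Finset.single_le_sum (f := fun x => (bornProb m x ρ.1 - bornProb m x σ.1) ^ 2)
    (fun i _ => sq_nonneg _) (Finset.mem_univ x)

/-! ### Reduction to projective measurements -/

/-- The easy half of the Gibbs variational formula, from `log t ≤ t - 1` at `t = q w / p`. Any
positive guess `w` for the likelihood ratio certifies a lower bound on the divergence. -/
theorem gibbs_le_relEnt {X : Type*} [Fintype X] {p q w : X → ℝ} (hp : ∀ x, 0 ≤ p x)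
    (hq : ∀ x, 0 ≤ q x) (hp1 : ∑ x, p x = 1) (h : ∀ x, q x = 0 → p x = 0) (hw : ∀ x, 0 < w x) :
    ∑ x, p x * Real.log (w x) - ∑ x, q x * w x + 1 ≤ relEnt p q := by
  rw [← hp1, relEnt, ← Finset.sum_sub_distrib, ← Finset.sum_add_distrib]
  refine Finset.sum_le_sum fun x _ => ?_
  rcases (hp x).eq_or_lt with h0 | h0
  · simp only [← h0, zero_mul]
    nlinarith [mul_nonneg (hq x) (hw x).le]
  have hq0 : 0 < q x := (hq x).lt_of_ne fun h' => h0.ne' (h x h'.symm)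
  have h1 := Real.log_le_sub_one_of_pos (x := q x * w x / p x)
    (div_pos (mul_pos hq0 (hw x)) h0)
  rw [Real.log_div (mul_pos hq0 (hw x)).ne' h0.ne', Real.log_mul hq0.ne' (hw x).ne'] at h1
  rw [Real.log_div h0.ne' hq0.ne']
  have h2 : p x * (q x * w x / p x) = q x * w x := by field_simp
  nlinarith [mul_le_mul_of_nonneg_left h1 h0.le]

/-- This plays the role of the integral representation of the logarithm by resolvents. Shifting all
arguments by `s`, the difference of the two sums has nonpositive derivative in `s` by the resolvent
inequality and tends to `0` at infinity because the total masses agree; hence it is nonnegative at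
`s = 0`. -/
theorem sum_mul_log_le_of_resolvent {ι κ : Type*} [Fintype ι] [Fintype κ] {p c : ι → ℝ}
    {q w : κ → ℝ} (hc : ∀ i, 0 < c i) (hw : ∀ j, 0 < w j) (hpq : ∑ i, p i = ∑ j, q j)
    (h : ∀ s : ℝ, 0 ≤ s → ∑ j, q j / (w j + s) ≤ ∑ i, p i / (c i + s)) :
    ∑ i, p i * Real.log (c i) ≤ ∑ j, q j * Real.log (w j) := by
  let g : ℝ → ℝ := fun s => ∑ j, q j * Real.log (w j + s) - ∑ i, p i * Real.log (c i + s)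
  have hd : ∀ s : ℝ, 0 ≤ s →
      HasDerivAt g (∑ j, q j * (1 / (w j + s)) - ∑ i, p i * (1 / (c i + s))) s := by
    intro s hs
    refine HasDerivAt.sub (HasDerivAt.fun_sum fun j _ => ?_) (HasDerivAt.fun_sum fun i _ => ?_)
    · exact (((hasDerivAt_id s).const_add (w j)).log (by have := hw j; simp; positivity)).const_mul _
    · exact (((hasDerivAt_id s).const_add (c i)).log (by have := hc i; simp; positivity)).const_mul _
  have hanti : AntitoneOn g (Set.Ici 0) := by
    refine antitoneOn_of_deriv_nonpos (convex_Ici 0)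
      (fun s hs => (hd s hs).continuousAt.continuousWithinAt) ?_ ?_
    · intro s hs
      rw [interior_Ici] at hs
      exact (hd s (le_of_lt hs)).differentiableAt.differentiableWithinAt
    · intro s hs
      rw [interior_Ici] at hs
      rw [(hd s (le_of_lt hs)).deriv]
      have := h s (le_of_lt hs)
      simp only [mul_one_div]
      linarith
  have hlim0 : ∀ a : ℝ, Tendsto (fun s : ℝ => Real.log (a / s + 1)) atTop (𝓝 0) := by
    intro a
    have h1 : Tendsto (fun s : ℝ => a / s + 1) atTop (𝓝 (0 + 1)) :=
      (tendsto_const_nhds.div_atTop tendsto_id).add_const 1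
    rw [zero_add] at h1
    simpa using h1.log one_ne_zero
  have hlim : Tendsto g atTop (𝓝 0) := by
    have h1 : Tendsto (fun s : ℝ => ∑ j, q j * Real.log (w j / s + 1) -
        ∑ i, p i * Real.log (c i / s + 1)) atTop (𝓝 0) := by
      have := (tendsto_finsetSum Finset.univ fun j _ => (hlim0 (w j)).const_mul (q j)).sub
        (tendsto_finsetSum Finset.univ fun i _ => (hlim0 (c i)).const_mul (p i))
      simpa using this
    refine h1.congr' ?_
    filter_upwards [eventually_gt_atTop 0] with s hs
    have e : ∀ a : ℝ, 0 < a → Real.log (a / s + 1) = Real.log (a + s) - Real.log s := by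
      intro a ha
      rw [← Real.log_div (by positivity) hs.ne']
      congr 1
      field_simp
    simp only [g, e _ (hw _), e _ (hc _), mul_sub, Finset.sum_sub_distrib, ← Finset.sum_mul, hpq]
    ring
  have h0 : 0 ≤ g 0 := le_of_tendsto hlim <| by
    filter_upwards [eventually_ge_atTop 0] with s hs
    exact hanti Set.self_mem_Ici hs hs
  simpa [g] using h0

/-- The matrix `U diag(f) U*`. -/
def conjDiag {d : ℕ} (U : CMat d) (f : Fin d → ℝ) : CMat d :=
  U * Matrix.diagonal (fun i => (f i : ℂ)) * U.conjTranspose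

theorem conjDiag_posSemidef {d : ℕ} (U : CMat d) {f : Fin d → ℝ} (hf : ∀ i, 0 ≤ f i) :
    (conjDiag U f).PosSemidef :=
  (Matrix.PosSemidef.diagonal fun i => by simpa using hf i).mul_mul_conjTranspose_same U

theorem conjDiag_isHermitian {d : ℕ} (U : CMat d) (f : Fin d → ℝ) :
    (conjDiag U f).IsHermitian := by
  refine Matrix.isHermitian_mul_mul_conjTranspose U ?_
  refine Matrix.isHermitian_diagonal_of_self_adjoint _ ?_
  ext i; simp

theorem conjDiag_mul {d : ℕ} {U : CMat d} (hU : U.conjTranspose * U = 1) (f g : Fin d → ℝ) :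
    conjDiag U f * conjDiag U g = conjDiag U fun i => f i * g i := by
  simp only [conjDiag]
  calc _ = U * Matrix.diagonal (fun i => (f i : ℂ)) * (U.conjTranspose * U) *
        Matrix.diagonal (fun i => (g i : ℂ)) * U.conjTranspose := by simp only [Matrix.mul_assoc]
    _ = _ := by
      rw [hU, Matrix.mul_one, Matrix.mul_assoc U, Matrix.diagonal_mul_diagonal]
      simp

theorem conjDiag_one {d : ℕ} {U : CMat d} (hU : U * U.conjTranspose = 1) :
    conjDiag U (fun _ => 1) = 1 := by
  simp [conjDiag, hU]

theorem conjDiag_eq_sum {d : ℕ} (U : CMat d) (f : Fin d → ℝ) :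
    conjDiag U f = ∑ i, f i • conjDiag U (Pi.single i 1) := by
  have : (Matrix.diagonal fun i => (f i : ℂ)) =
      ∑ i, f i • Matrix.diagonal (fun j => (((Pi.single i 1 : Fin d → ℝ) j : ℝ) : ℂ)) := by
    ext a b
    simp only [Matrix.sum_apply, Matrix.smul_apply, Matrix.diagonal_apply]
    by_cases hab : a = b
    · subst hab
      simp only [Pi.single_apply, Complex.real_smul, if_true]
      rw [Finset.sum_eq_single a] <;> simp +contextual [eq_comm]
    · simp [hab]
  simp only [conjDiag]
  rw [this, Finset.mul_sum, Finset.sum_mul]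
  simp

/-- Resolvent form of the operator Jensen inequality. -/
theorem resolvent_posSemidef {d : ℕ} {X : Type*} [Fintype X] (m : POVM d X) {c : X → ℝ}
    {W : CMat d} (hc : ∀ x, 0 < c x) (hW : W.IsHermitian) (hinv : W * (∑ x, c x • m.1 x) = 1) :
    ((∑ x, (c x)⁻¹ • m.1 x) - W).PosSemidef := by
  -- Completing the square: on expansion the cross terms give `-2 W`, and the quadratic term is `W
  -- (∑ c m) W = W`.
  have key : (∑ x, (c x)⁻¹ • m.1 x) - W =
      ∑ x, (c x)⁻¹ • ((1 - c x • W) * m.1 x * (1 - c x • W).conjTranspose) := by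
    have e : ∀ x, (c x)⁻¹ • ((1 - c x • W) * m.1 x * (1 - c x • W).conjTranspose) =
        (c x)⁻¹ • m.1 x - W * m.1 x - m.1 x * W + W * (c x • m.1 x) * W := by
      intro x
      have hc' := (hc x).ne'
      rw [Matrix.conjTranspose_sub, Matrix.conjTranspose_smul, hW.eq, star_trivial,
        Matrix.conjTranspose_one]
      simp only [sub_mul, mul_sub, one_mul, mul_one, smul_mul_assoc, mul_smul_comm, smul_sub,
        smul_smul]
      rw [inv_mul_cancel₀ hc', one_smul, one_smul, inv_mul_cancel_left₀ hc']
      abel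
    simp only [e, Finset.sum_add_distrib, Finset.sum_sub_distrib, ← Finset.mul_sum,
      ← Finset.sum_mul, m.2.2, hinv, mul_one, one_mul]
    abel
  rw [key]
  refine Matrix.posSemidef_sum _ fun x _ => ?_
  exact ((m.2.1 x).mul_mul_conjTranspose_same _).smul (inv_nonneg.mpr (hc x).le)

/-- The rank-one measurement in an orthonormal basis, with outcomes relabelled. -/
def basisPOVM {d : ℕ} {X : Type*} [Fintype X] (U : CMat d) (hU : U * U.conjTranspose = 1)
    (e : Fin d → X) : POVM d X :=
  open Classical in
  ⟨fun x => ∑ i, if e i = x then conjDiag U (Pi.single i 1) else 0, by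
    constructor
    · intro x
      refine Matrix.posSemidef_sum _ fun i _ => ?_
      split_ifs
      · exact conjDiag_posSemidef U fun j => by
          by_cases h : j = i <;> simp [h]
      · exact Matrix.PosSemidef.zero
    · rw [Finset.sum_comm]
      rw [← conjDiag_one hU, conjDiag_eq_sum]
      refine Finset.sum_congr rfl fun i _ => ?_
      rw [one_smul, Finset.sum_eq_single (e i)] <;> simp +contextual [eq_comm]⟩

theorem bornProb_basisPOVM {d : ℕ} {X : Type*} [Fintype X] [DecidableEq X] (U : CMat d)
    (hU : U * U.conjTranspose = 1) (e : Fin d → X) (x : X) (ρ : CMat d) :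
    bornProb (basisPOVM U hU e) x ρ =
      ∑ i, if e i = x then (Matrix.trace (conjDiag U (Pi.single i 1) * ρ)).re else 0 := by
  simp only [bornProb, basisPOVM, Finset.sum_mul, Matrix.trace_sum, Complex.re_sum]
  refine Finset.sum_congr rfl fun i _ => ?_
  split_ifs <;> simp

theorem sum_bornProb_basisPOVM_mul {d : ℕ} {X : Type*} [Fintype X] (U : CMat d)
    (hU : U * U.conjTranspose = 1) (e : Fin d → X) (f : X → ℝ) (ρ : CMat d) :
    ∑ x, bornProb (basisPOVM U hU e) x ρ * f x =
      ∑ i, (Matrix.trace (conjDiag U (Pi.single i 1) * ρ)).re * f (e i) := by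
  classical
  simp only [bornProb_basisPOVM, Finset.sum_mul, ite_mul, zero_mul]
  rw [Finset.sum_comm]
  simp

theorem trace_conjDiag_mul {d : ℕ} (U : CMat d) (f : Fin d → ℝ) (ρ : CMat d) :
    (Matrix.trace (conjDiag U f * ρ)).re =
      ∑ i, f i * (Matrix.trace (conjDiag U (Pi.single i 1) * ρ)).re := by
  rw [conjDiag_eq_sum, Finset.sum_mul, Matrix.trace_sum, Complex.re_sum]
  simp

theorem re_trace_sum_smul_mul {d : ℕ} {Y : Type*} [Fintype Y] (m : POVM d Y) (c : Y → ℝ)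
    (ρ : CMat d) :
    (Matrix.trace ((∑ y, c y • m.1 y) * ρ)).re = ∑ y, c y * bornProb m y ρ := by
  rw [Finset.sum_mul, Matrix.trace_sum, Complex.re_sum]
  simp [bornProb]

/-- Projective measurements with `d` outcomes attain the measured relative entropy. -/
theorem exists_bornRelEnt_ge {d : ℕ} {X Y : Type*} [Fintype X] [Fintype Y]
    (hX : d ≤ Fintype.card X) {ρ σ : State d} (hρ : ρ.1.PosDef) (hσ : σ.1.PosDef)
    (m : POVM d Y) : ∃ m' : POVM d X, bornRelEnt ρ.1 σ.1 m ≤ bornRelEnt ρ.1 σ.1 m' := by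
  classical
  obtain ⟨e⟩ : Nonempty (Fin d ↪ X) :=
    Function.Embedding.nonempty_of_card_le (by simpa using hX)
  set p : Y → ℝ := fun y => bornProb m y ρ.1 with hp
  set q : Y → ℝ := fun y => bornProb m y σ.1 with hq
  have hp0 : ∀ y, 0 ≤ p y := fun y => bornProb_nonneg m y ρ
  have hq0 : ∀ y, 0 ≤ q y := fun y => bornProb_nonneg m y σ
  have hpq : ∀ y, p y = 0 → q y = 0 := fun y => bornProb_eq_zero_of_posDef hρ hσ m y
  have hqp : ∀ y, q y = 0 → p y = 0 := fun y => bornProb_eq_zero_of_posDef hσ hρ m y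
  -- The likelihood ratio, set to `1` on null outcomes to keep `ω = ∑ c m` positive definite. The
  -- projective measurement sought is the eigenbasis of `ω`.
  set c : Y → ℝ := fun y => if p y = 0 then 1 else p y / q y with hcdef
  have hc : ∀ y, 0 < c y := by
    intro y
    simp only [hcdef]
    split_ifs with h
    · exact one_pos
    · exact div_pos ((hp0 y).lt_of_ne' h) ((hq0 y).lt_of_ne' fun h' => h (hqp y h'))
  set ω : CMat d := ∑ y, c y • m.1 y with hω
  have hωH : ω.IsHermitian :=
    (Matrix.posSemidef_sum _ fun y _ => (m.2.1 y).smul (hc y).le).1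
  obtain ⟨cm, hcm, hcm'⟩ : ∃ a : ℝ, 0 < a ∧ ∀ y, a ≤ c y := by
    rcases isEmpty_or_nonempty Y with hY | hY
    · exact ⟨1, one_pos, fun y => hY.elim y⟩
    · obtain ⟨y₀, hy₀⟩ := Finite.exists_min c
      exact ⟨c y₀, hc y₀, hy₀⟩
  have hωpos : ω.PosDef := by
    have e1 : ω = (∑ y, (c y - cm) • m.1 y) + cm • (1 : CMat d) := by
      have h1 : cm • (1 : CMat d) = ∑ y, cm • m.1 y := by rw [← Finset.smul_sum, m.2.2]
      rw [h1, ← Finset.sum_add_distrib]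
      simp [hω, sub_smul]
    rw [e1]
    refine Matrix.PosDef.posSemidef_add
      (Matrix.posSemidef_sum _ fun y _ => (m.2.1 y).smul (sub_nonneg.mpr (hcm' y))) ?_
    exact Matrix.PosDef.one.smul hcm
  set U : CMat d := (hωH.eigenvectorUnitary : CMat d) with hUdef
  have hU1 : U.conjTranspose * U = 1 := Unitary.coe_star_mul_self hωH.eigenvectorUnitary
  have hU2 : U * U.conjTranspose = 1 := Unitary.coe_mul_star_self hωH.eigenvectorUnitary
  set w : Fin d → ℝ := hωH.eigenvalues with hw
  have hw0 : ∀ i, 0 < w i := hωpos.eigenvalues_pos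
  have hspec : ω = conjDiag U w := by
    have := hωH.spectral_theorem
    rw [Unitary.conjStarAlgAut_apply] at this
    exact this
  set P : State d → Fin d → ℝ := fun τ i =>
    (Matrix.trace (conjDiag U (Pi.single i 1) * τ.1)).re with hP
  have hP1 : ∀ τ : State d, ∑ i, P τ i = 1 := by
    intro τ
    have := trace_conjDiag_mul U (fun _ => 1) τ.1
    rw [conjDiag_one hU2, one_mul, τ.2.2] at this
    simpa using this.symm
  -- Operator Jensen: `∑ log (c) m ≤ log ω`, tested against `ρ`.
  have hJ : ∑ y, p y * Real.log (c y) ≤ ∑ i, P ρ i * Real.log (w i) := by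
    refine sum_mul_log_le_of_resolvent hc hw0 ((sum_bornProb m ρ).trans (hP1 ρ).symm) fun s hs => ?_
    have hinv : conjDiag U (fun i => (w i + s)⁻¹) * (∑ y, (c y + s) • m.1 y) = 1 := by
      have e1 : ∑ y, (c y + s) • m.1 y = conjDiag U fun i => w i + s := by
        simp only [add_smul, Finset.sum_add_distrib, ← Finset.smul_sum, m.2.2]
        rw [← hω, hspec, ← conjDiag_one hU2, conjDiag_eq_sum U fun i => w i + s,
          conjDiag_eq_sum U w, conjDiag_eq_sum U fun _ => 1]
        simp only [add_smul, Finset.sum_add_distrib, ← Finset.smul_sum, one_smul]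
      rw [e1, conjDiag_mul hU1, ← conjDiag_one hU2]
      congr 1
      ext i
      exact inv_mul_cancel₀ (by have := hw0 i; positivity)
    have h1 := trace_mul_re_nonneg (resolvent_posSemidef m (c := fun y => c y + s)
      (fun y => by have := hc y; positivity) (conjDiag_isHermitian U _) hinv) ρ.2.1
    rw [sub_mul, Matrix.trace_sub, Complex.sub_re, re_trace_sum_smul_mul, trace_conjDiag_mul,
      sub_nonneg] at h1
    simpa only [div_eq_inv_mul] using h1
  -- Both sides are `tr (σ ω) = ∑ c q = ∑ p`, so the linear term of the Gibbs bound cancels its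
  -- constant.
  have hW : ∑ i, P σ i * w i = 1 := by
    have h1 := trace_conjDiag_mul U w σ.1
    rw [← hspec, hω, re_trace_sum_smul_mul] at h1
    simp only [mul_comm (P σ _)]
    rw [← h1, ← sum_bornProb m ρ]
    refine Finset.sum_congr rfl fun y _ => ?_
    change c y * q y = p y
    simp only [hcdef]
    split_ifs with h
    · rw [h, hpq y h, mul_zero]
    · have : q y ≠ 0 := fun h' => h (hqp y h')
      field_simp
  refine ⟨basisPOVM U hU2 e, ?_⟩
  have hext : ∀ i, Function.extend e w (fun _ => 1) (e i) = w i := fun i =>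
    e.injective.extend_apply w _ i
  -- The eigenvalues serve as guessed likelihood ratios. Outcomes outside the range of `e` have
  -- probability zero, so the value `1` there is arbitrary.
  have hG := gibbs_le_relEnt (p := fun x => bornProb (basisPOVM U hU2 e) x ρ.1)
    (q := fun x => bornProb (basisPOVM U hU2 e) x σ.1) (w := Function.extend e w fun _ => 1)
    (fun x => bornProb_nonneg _ x ρ) (fun x => bornProb_nonneg _ x σ) (sum_bornProb _ ρ)
    (fun x => bornProb_eq_zero_of_posDef hσ hρ _ x) (fun x => by
      by_cases hx : ∃ i, e i = x
      · obtain ⟨i, rfl⟩ := hx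
        rw [hext]; exact hw0 i
      · rw [Function.extend_apply' _ _ _ hx]; exact one_pos)
  rw [sum_bornProb_basisPOVM_mul U hU2 e (fun x => Real.log (Function.extend e w (fun _ => 1) x)),
    sum_bornProb_basisPOVM_mul] at hG
  simp only [hext] at hG
  have hG' : ∑ i, P ρ i * Real.log (w i) - ∑ i, P σ i * w i + 1 ≤
    bornRelEnt ρ.1 σ.1 (basisPOVM U hU2 e) := hG
  rw [hW, sub_add_cancel] at hG'
  refine le_trans (le_of_eq ?_) (hJ.trans hG')
  refine Finset.sum_congr rfl fun y _ => ?_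
  simp only [hcdef]
  split_ifs with h
  · simp only [p] at h
    simp [h]
  · rfl

/-- With at least `d` outcomes available, optimality over one outcome set is optimality over all
finite ones. -/
theorem measuredRelEntropy_le_outcomeRelEntropy {d : ℕ} {X : Type*} [Fintype X]
    [MeasurableSpace X] [DiscreteMeasurableSpace X] (hX : d ≤ Fintype.card X) {ρ σ : State d}
    (hρ : ρ.1.PosDef) (hσ : σ.1.PosDef) {m : POVM d X}
    (hm : IsMaxOn (outcomeRelEntropy (X := X) ρ.1 σ.1) Set.univ m) :
    measuredRelEntropy ρ.1 σ.1 ≤ outcomeRelEntropy ρ.1 σ.1 m := by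
  refine iSup₂_le fun k m₁ => ?_
  obtain ⟨m₂, h⟩ := exists_bornRelEnt_ge hX hρ hσ m₁
  refine le_trans ?_ (hm (Set.mem_univ m₂))
  change outcomeRelEntropy ρ.1 σ.1 m₁ ≤ outcomeRelEntropy ρ.1 σ.1 m₂
  rw [outcomeRelEntropy_eq hρ hσ, outcomeRelEntropy_eq hρ hσ]
  exact ENNReal.ofReal_le_ofReal h

theorem ofReal_bornRelEnt_le_measuredRelEntropy {d : ℕ} {ρ σ : State d} (hρ : ρ.1.PosDef)
    (hσ : σ.1.PosDef) {k : ℕ} (m : POVM d (Fin k)) :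
    ENNReal.ofReal (bornRelEnt ρ.1 σ.1 m) ≤ measuredRelEntropy ρ.1 σ.1 := by
  rw [← outcomeRelEntropy_eq hρ hσ]
  exact le_iSup₂_of_le k m le_rfl

/-! ### Positivity of the measured relative entropy to a compact set -/

/-- A two-outcome measurement whose first effect is a positive multiple of `C + ρ - σ`. -/
theorem exists_distinguishing_POVM {d : ℕ} {ρ σ : CMat d} (hρ : ρ.PosDef) (hσ : σ.PosDef) :
    ∃ (m : POVM d (Fin 2)) (a b : ℝ), 0 < a ∧
      ∀ τ : CMat d, bornProb m 0 τ = b * τ.trace.re + a * (Matrix.trace ((ρ - σ) * τ)).re := by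
  obtain ⟨_, C, _, hC, h⟩ := exists_uniform_bounds (F := {ρ, σ}) (Set.toFinite _).isCompact
    (by rintro _ (rfl | rfl) <;> assumption)
  have h1 := (h ρ (by simp)).2
  have h2 := (h σ (by simp)).2
  have e1 : (C • (1 : CMat d) + ρ - σ).PosSemidef := by
    convert h2.add hρ.posSemidef using 1; abel
  have e2 : (C • (1 : CMat d) - ρ + σ).PosSemidef := h1.add hσ.posSemidef
  have hs : 0 ≤ (2 * C)⁻¹ := by positivity
  refine ⟨⟨![(2 * C)⁻¹ • (C • (1 : CMat d) + ρ - σ), (2 * C)⁻¹ • (C • (1 : CMat d) - ρ + σ)],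
    ?_, ?_⟩, (2 * C)⁻¹, 1 / 2, by positivity, fun τ => ?_⟩
  · intro x
    fin_cases x
    · exact e1.smul hs
    · exact e2.smul hs
  · rw [Fin.sum_univ_two]
    simp only [Matrix.cons_val_zero, Matrix.cons_val_one]
    rw [← smul_add]
    have : C • (1 : CMat d) + ρ - σ + (C • (1 : CMat d) - ρ + σ) = (2 * C) • (1 : CMat d) := by
      rw [two_mul, add_smul]; abel
    rw [this, smul_smul, inv_mul_cancel₀ (by positivity), one_smul]
  · simp only [bornProb, Matrix.cons_val_zero]
    rw [add_sub_assoc, smul_add, smul_smul, add_mul, smul_mul_assoc, smul_mul_assoc, one_mul,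
      Matrix.trace_add, Matrix.trace_smul, Matrix.trace_smul, Complex.add_re, Complex.smul_re,
      Complex.smul_re]
    have : (2 * C)⁻¹ * C = 1 / 2 := by field_simp
    rw [this]; simp

theorem re_trace_mul_self_pos {d : ℕ} {H : CMat d} (hH : H.IsHermitian) (h0 : H ≠ 0) :
    0 < (Matrix.trace (H * H)).re := by
  have h1 : 0 ≤ Matrix.trace (H * H) := by
    have := (Matrix.posSemidef_conjTranspose_mul_self H).trace_nonneg
    rwa [hH.eq] at this
  have h2 : Matrix.trace (H * H) ≠ 0 := by
    have := (Matrix.trace_conjTranspose_mul_self_eq_zero_iff (A := H)).not.mpr h0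
    rwa [hH.eq] at this
  exact (Complex.lt_def.mp (h1.lt_of_ne' h2)).1

/-- A two-outcome measurement built from `ρ - σ₀` separates `ρ` from all `σ` near `σ₀` by a fixed
gap, and Pinsker turns the gap into both divergences. Finitely many neighbourhoods cover `D`, so
continuity of the measured relative entropy is not used. -/
theorem exists_pos_le_measuredRelEntropy {d : ℕ} {ρ : State d} (hρ : ρ.1.PosDef)
    {D : Set (CMat d)} (hD_state : ∀ σ ∈ D, σ.PosDef ∧ σ.trace = 1) (hD : IsCompact D)
    (hρD : ρ.1 ∉ D) :
    ∃ δ : ℝ, 0 < δ ∧ ∀ σ ∈ D, ENNReal.ofReal δ ≤ measuredRelEntropy ρ.1 σ ∧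
      ENNReal.ofReal δ ≤ measuredRelEntropy σ ρ.1 := by
  -- The duplicated membership remains when compactness induction replaces the first `D` by
  -- arbitrary sets.
  suffices H : ∃ δ : ℝ, 0 < δ ∧ ∀ σ ∈ D, σ ∈ D → ENNReal.ofReal δ ≤ measuredRelEntropy ρ.1 σ ∧
      ENNReal.ofReal δ ≤ measuredRelEntropy σ ρ.1 by
    obtain ⟨δ, hδ, h⟩ := H
    exact ⟨δ, hδ, fun σ hσ => h σ hσ hσ⟩
  refine hD.induction_on (p := fun s => ∃ δ : ℝ, 0 < δ ∧ ∀ σ ∈ s, σ ∈ D →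
    ENNReal.ofReal δ ≤ measuredRelEntropy ρ.1 σ ∧ ENNReal.ofReal δ ≤ measuredRelEntropy σ ρ.1)
    ⟨1, one_pos, by simp⟩ ?_ ?_ ?_
  · rintro s t hst ⟨δ, hδ, h⟩
    exact ⟨δ, hδ, fun σ hσ => h σ (hst hσ)⟩
  · rintro s t ⟨δ, hδ, h⟩ ⟨ε, hε, h'⟩
    refine ⟨min δ ε, lt_min hδ hε, fun σ hσ hσD => ?_⟩
    have l1 := ENNReal.ofReal_le_ofReal (min_le_left δ ε)
    have l2 := ENNReal.ofReal_le_ofReal (min_le_right δ ε)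
    rcases hσ with hσ | hσ
    · exact ⟨l1.trans (h σ hσ hσD).1, l1.trans (h σ hσ hσD).2⟩
    · exact ⟨l2.trans (h' σ hσ hσD).1, l2.trans (h' σ hσ hσD).2⟩
  · intro σ₀ hσ₀
    have hσ₀p := (hD_state σ₀ hσ₀).1
    obtain ⟨m, a, b, ha, hm⟩ := exists_distinguishing_POVM hρ hσ₀p
    have hne : ρ.1 - σ₀ ≠ 0 := fun h => hρD (by rw [sub_eq_zero.mp h]; exact hσ₀)
    have hpos := re_trace_mul_self_pos (hρ.1.sub hσ₀p.1) hne
    set t := (Matrix.trace ((ρ.1 - σ₀) * (ρ.1 - σ₀))).re with ht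
    have hcont : Continuous fun σ : CMat d => (Matrix.trace ((ρ.1 - σ₀) * (ρ.1 - σ))).re :=
      Complex.continuous_re.comp (by fun_prop)
    have hev : ∀ᶠ σ in 𝓝 σ₀, t / 2 < (Matrix.trace ((ρ.1 - σ₀) * (ρ.1 - σ))).re :=
      hcont.continuousAt.eventually (lt_mem_nhds (half_lt_self hpos))
    refine ⟨_, mem_nhdsWithin_of_mem_nhds hev, (a * (t / 2)) ^ 2 / 4, by positivity,
      fun σ hσ hσD => ?_⟩
    have hσs := hD_state σ hσD
    let σ' : State d := ⟨σ, hσs.1.posSemidef, hσs.2⟩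
    have hd : bornProb m 0 ρ.1 - bornProb m 0 σ =
        a * (Matrix.trace ((ρ.1 - σ₀) * (ρ.1 - σ))).re := by
      rw [hm, hm, ρ.2.2, hσs.2, mul_sub, Matrix.trace_sub, Complex.sub_re]
      ring
    have hsq : (a * (t / 2)) ^ 2 / 4 ≤ (bornProb m 0 ρ.1 - bornProb m 0 σ) ^ 2 / 4 := by
      rw [hd]
      have : t / 2 ≤ (Matrix.trace ((ρ.1 - σ₀) * (ρ.1 - σ))).re := le_of_lt hσ
      gcongr
    constructor
    · exact (ENNReal.ofReal_le_ofReal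
        (hsq.trans (sq_dist_le_bornRelEnt (ρ := ρ) (σ := σ') hρ hσs.1 m 0))).trans
        (ofReal_bornRelEnt_le_measuredRelEntropy (ρ := ρ) (σ := σ') hρ hσs.1 m)
    · rw [← neg_sub (bornProb m 0 σ), neg_sq] at hsq
      exact (ENNReal.ofReal_le_ofReal
        (hsq.trans (sq_dist_le_bornRelEnt (ρ := σ') (σ := ρ) hσs.1 hρ m 0))).trans
        (ofReal_bornRelEnt_le_measuredRelEntropy (ρ := σ') (σ := ρ) hσs.1 hρ m)

/-! ### The uniform prior -/

/-- The chart of the Hermitian matrices of trace one used to define `volAffine`. -/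
def affineChart (d : ℕ) (H : tracelessHermitian d) : CMat d :=
  (d : ℂ)⁻¹ • (1 : CMat d) + (H : CMat d)

theorem continuous_affineChart (d : ℕ) : Continuous (affineChart d) :=
  continuous_const.add continuous_subtype_val

theorem affineChart_mem {d : ℕ} (hd : d ≠ 0) (H : tracelessHermitian d) :
    affineChart d H ∈ affineStates d := by
  obtain ⟨H, hH, hH'⟩ := H
  have hd' : (d : ℂ) ≠ 0 := by exact_mod_cast hd
  refine ⟨?_, ?_⟩
  · refine Matrix.IsHermitian.add ?_ hH
    rw [Matrix.IsHermitian, Matrix.conjTranspose_smul, Matrix.conjTranspose_one]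
    simp
  · change Matrix.trace ((d : ℂ)⁻¹ • (1 : CMat d) + H) = 1
    rw [Matrix.trace_add, hH', add_zero, Matrix.trace_smul, Matrix.trace_one, Fintype.card_fin,
      smul_eq_mul, inv_mul_cancel₀ hd']

theorem exists_affineChart_eq {d : ℕ} (hd : d ≠ 0) {σ : CMat d} (hσ : σ ∈ affineStates d) :
    ∃ H, affineChart d H = σ := by
  have hd' : (d : ℂ) ≠ 0 := by exact_mod_cast hd
  refine ⟨⟨σ - (d : ℂ)⁻¹ • (1 : CMat d), ?_, ?_⟩, by simp [affineChart]⟩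
  · refine hσ.1.sub ?_
    rw [Matrix.IsHermitian, Matrix.conjTranspose_smul, Matrix.conjTranspose_one]
    simp
  · rw [Matrix.trace_sub, hσ.2, Matrix.trace_smul, Matrix.trace_one, Fintype.card_fin,
      smul_eq_mul, inv_mul_cancel₀ hd', sub_self]

theorem affineChart_injective (d : ℕ) : Function.Injective (affineChart d) := fun H H' h => by
  have : (H : CMat d) = H' := add_left_cancel (a := (d : ℂ)⁻¹ • (1 : CMat d)) h
  exact Subtype.ext this

theorem isClosedEmbedding_affineChart (d : ℕ) : IsClosedEmbedding (affineChart d) :=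
  (Homeomorph.addLeft ((d : ℂ)⁻¹ • (1 : CMat d))).isClosedEmbedding.comp
    (isClosed_tracelessHermitian d).isClosedEmbedding_subtypeVal

theorem volAffine_apply {d : ℕ} {s : Set (CMat d)} (hs : MeasurableSet s) :
    volAffine d s = Measure.addHaar (affineChart d ⁻¹' s) :=
  Measure.map_apply (continuous_affineChart d).measurable hs

theorem volAffine_lt_top {d : ℕ} {s : Set (CMat d)} (hs : IsCompact s) : volAffine d s < ∞ := by
  rw [volAffine_apply hs.isClosed.measurableSet]
  exact ((isClosedEmbedding_affineChart d).isCompact_preimage hs).measure_lt_top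

theorem volAffine_pos {d : ℕ} (hd : d ≠ 0) {s : Set (CMat d)} (hs : MeasurableSet s)
    {σ : CMat d} (hσ : σ ∈ affineStates d) (h : s ∈ 𝓝[affineStates d] σ) : 0 < volAffine d s := by
  rw [volAffine_apply hs]
  obtain ⟨H, rfl⟩ := exists_affineChart_eq hd hσ
  refine Measure.measure_pos_of_mem_nhds _ (x := H) ?_
  have : Tendsto (affineChart d) (𝓝 H) (𝓝[affineStates d] (affineChart d H)) :=
    tendsto_nhdsWithin_of_tendsto_nhds_of_eventually_within _
      (continuous_affineChart d).continuousAt (Eventually.of_forall (affineChart_mem hd))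
  exact this h

/-- A linear homeomorphism onto Euclidean space carries homotheties to homotheties and Haar measures
to Haar measures. This form needs no norm on `E`, which suits a space of matrices. -/
theorem addHaar_image_homothety_of_finiteDimensional {E : Type*} [AddCommGroup E] [Module ℝ E]
    [TopologicalSpace E] [IsTopologicalAddGroup E] [ContinuousSMul ℝ E] [T2Space E]
    [FiniteDimensional ℝ E] [MeasurableSpace E] [BorelSpace E] (μ : Measure E)
    [μ.IsAddHaarMeasure] (x : E) (r : ℝ) (s : Set E) :
    μ ((fun y => x + r • (y - x)) '' s) =
      ENNReal.ofReal (abs (r ^ Module.finrank ℝ E)) * μ s := by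
  let e : E ≃L[ℝ] EuclideanSpace ℝ (Fin (Module.finrank ℝ E)) := toEuclidean
  have hm : ∀ t : Set E, μ t = μ.map e (e '' t) := by
    intro t
    have h := e.toHomeomorph.toMeasurableEquiv.map_apply (μ := μ) (e '' t)
    have h' : μ.map e (e '' t) = μ (e ⁻¹' (e '' t)) := h
    rw [h', Set.preimage_image_eq _ e.injective]
  have : (μ.map e).IsAddHaarMeasure := e.isAddHaarMeasure_map μ
  have key := Measure.addHaar_image_homothety (μ.map e) (e x) r (e '' s)
  rw [hm, hm s, finrank_euclideanSpace_fin] at *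
  rw [← key, Set.image_image, Set.image_image]
  congr 2
  ext y
  simp [AffineMap.homothety_apply, add_comm]

theorem integral_mem_of_convex_of_isCompact {d : ℕ} {D : Set (CMat d)} (hD : Convex ℝ D)
    (hc : IsCompact D) {μ : Measure (CMat d)} [IsProbabilityMeasure μ] (hμ : ∀ᵐ σ ∂μ, σ ∈ D) :
    (∀ i j, Integrable (fun σ : CMat d => σ i j) μ) ∧
      (Matrix.of fun i j => ∫ σ, σ i j ∂μ) ∈ D := by
  obtain ⟨C, hC⟩ := (IsCompact.isBounded (α := Fin d → Fin d → ℂ) hc).exists_norm_le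
  let f : CMat d → (Fin d → Fin d → ℂ) := fun σ => σ
  let g : Fin d → CMat d → (Fin d → ℂ) := fun i σ => σ i
  have hmeas : Measurable f := measurable_id
  have hint : Integrable f μ :=
    Integrable.of_bound hmeas.aestronglyMeasurable C (hμ.mono fun σ hσ => hC σ hσ)
  have hint' : ∀ i, Integrable (g i) μ := fun i =>
    Integrable.eval (E := fun _ : Fin d => Fin d → ℂ) hint i
  refine ⟨fun i j => (hint' i).eval j, ?_⟩
  have h : (∫ σ, f σ ∂μ) ∈ (D : Set (Fin d → Fin d → ℂ)) :=
    Convex.integral_mem (E := Fin d → Fin d → ℂ) (s := D) hD hc.isClosed hμ hint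
  have e : ∀ i j, (∫ σ, f σ ∂μ) i j = ∫ σ : CMat d, σ i j ∂μ := fun i j => by
    have e1 : (∫ σ, f σ ∂μ) i = ∫ σ, g i σ ∂μ :=
      eval_integral (E := fun _ : Fin d => Fin d → ℂ) hint' i
    rw [e1]
    exact eval_integral (E := fun _ : Fin d => ℂ) (fun j => (hint' i).eval j) j
  have e' : (Matrix.of fun i j => ∫ σ, σ i j ∂μ) = (∫ σ, f σ ∂μ : Fin d → Fin d → ℂ) :=
    funext fun i => funext fun j => (e i j).symm
  rw [e']
  exact h

theorem isProbabilityMeasure_uniformPrior {d : ℕ} (hd : d ≠ 0) {D : Set (CMat d)}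
    (hDc : IsCompact D) {σ : CMat d} (hσ : σ ∈ affineStates d) (h : D ∈ 𝓝[affineStates d] σ) :
    IsProbabilityMeasure (uniformPrior D) :=
  cond_isProbabilityMeasure_of_finite (volAffine_pos hd hDc.isClosed.measurableSet hσ h).ne'
    (volAffine_lt_top hDc).ne

theorem ae_mem_uniformPrior {d : ℕ} {D : Set (CMat d)} (hDc : IsCompact D) :
    ∀ᵐ σ ∂(uniformPrior D), σ ∈ D :=
  ae_cond_mem hDc.isClosed.measurableSet

/-- The contraction of `D` by a factor `r` towards one of its points carries a fraction
`r ^ dim` of the uniform prior. -/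
theorem uniformPrior_contraction {d : ℕ} (hd : d ≠ 0) {D : Set (CMat d)} (hDc : IsCompact D)
    (hDconv : Convex ℝ D) (hDa : D ⊆ affineStates d) (hpos : volAffine d D ≠ 0) {σ : CMat d}
    (hσ : σ ∈ D) {r : ℝ} (hr0 : 0 ≤ r) (hr1 : r ≤ 1) :
    uniformPrior D ((fun τ => (1 - r) • σ + r • τ) '' D) =
      ENNReal.ofReal (r ^ Module.finrank ℝ (tracelessHermitian d)) := by
  have hDm := hDc.isClosed.measurableSet
  have hc : IsCompact ((fun τ => (1 - r) • σ + r • τ) '' D) := hDc.image (by fun_prop)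
  have hsub : (fun τ => (1 - r) • σ + r • τ) '' D ⊆ D := by
    rintro _ ⟨τ, hτ, rfl⟩
    exact hDconv hσ hτ (by linarith) hr0 (by ring)
  have key : volAffine d ((fun τ => (1 - r) • σ + r • τ) '' D) =
      ENNReal.ofReal (r ^ Module.finrank ℝ (tracelessHermitian d)) * volAffine d D := by
    obtain ⟨H, rfl⟩ := exists_affineChart_eq hd (hDa hσ)
    rw [volAffine_apply hc.isClosed.measurableSet, volAffine_apply hDm]
    have hcomb : ∀ K : tracelessHermitian d, affineChart d (H + r • (K - H)) =
        (1 - r) • affineChart d H + r • affineChart d K := by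
      intro K
      simp only [affineChart, Submodule.coe_add, Submodule.coe_smul, Submodule.coe_sub, smul_add,
        smul_sub, sub_smul, one_smul]
      abel
    -- In the chart, contraction towards `σ` is the homothety of ratio `r` centred at `H`.
    have e : affineChart d ⁻¹' ((fun τ => (1 - r) • affineChart d H + r • τ) '' D) =
        (fun K => H + r • (K - H)) '' (affineChart d ⁻¹' D) := by
      ext K
      constructor
      · rintro ⟨τ, hτ, hK⟩
        obtain ⟨K', rfl⟩ := exists_affineChart_eq hd (hDa hτ)
        refine ⟨K', hτ, affineChart_injective d ?_⟩
        simp only [hcomb]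
        exact hK
      · rintro ⟨K', hK', rfl⟩
        exact ⟨_, hK', (hcomb K').symm⟩
    rw [e, addHaar_image_homothety_of_finiteDimensional, abs_of_nonneg (by positivity)]
  rw [uniformPrior, cond_apply hDm, Set.inter_eq_right.mpr hsub, key, mul_left_comm,
    ENNReal.inv_mul_cancel hpos (volAffine_lt_top hDc).ne, mul_one]

/-! ### The mixture likelihood ratio -/

/-- The standing assumptions on the null state `ρ` and the composite alternative `D`, with a common
bound `L` for all one-step log-likelihood ratios. -/
structure TestSetting {d : ℕ} (X : Type*) [Fintype X] (ρ : State d) (D : Set (CMat d)) (L : ℝ) :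
    Prop where
  posDef : ρ.1.PosDef
  state : ∀ σ ∈ D, σ.PosDef ∧ σ.trace = 1
  compact : IsCompact D
  convex : Convex ℝ D
  interior : ∃ σ ∈ D, D ∈ 𝓝[affineStates d] σ
  nonneg : 0 ≤ L
  bound : ∀ (m : POVM d X) (x : X), ∀ σ ∈ insert ρ.1 D, ∀ τ ∈ insert ρ.1 D,
    (bornProb m x σ = 0 → bornProb m x τ = 0) ∧
      |Real.log (bornProb m x σ / bornProb m x τ)| ≤ L

theorem pointwiseLLR_snoc {d : ℕ} {X : Type*} [Fintype X] {k : ℕ} (ρ : CMat d)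
    (h : Fin k → POVM d X × X) (y : POVM d X × X) (σ : CMat d) :
    pointwiseLLR ρ (Fin.snoc h y : Fin (k + 1) → POVM d X × X) σ = pointwiseLLR ρ h σ +
      Real.log (bornProb y.1 y.2 ρ / bornProb y.1 y.2 σ) := by
  simp [pointwiseLLR, Fin.sum_univ_castSucc]

namespace TestSetting

variable {d : ℕ} {X : Type*} [Fintype X] {ρ : State d} {D : Set (CMat d)} {L : ℝ}

theorem dim_ne_zero (hT : TestSetting X ρ D L) : d ≠ 0 := by
  rintro rfl
  have := ρ.2.2
  simp [Matrix.trace] at this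

theorem subset_affineStates (hT : TestSetting X ρ D L) : D ⊆ affineStates d := fun σ hσ =>
  ⟨(hT.state σ hσ).1.1, (hT.state σ hσ).2⟩

theorem isProbabilityMeasure (hT : TestSetting X ρ D L) :
    IsProbabilityMeasure (uniformPrior D) := by
  obtain ⟨σ, hσ, h⟩ := hT.interior
  exact isProbabilityMeasure_uniformPrior hT.dim_ne_zero hT.compact (hT.subset_affineStates hσ) h

theorem ae_mem (hT : TestSetting X ρ D L) : ∀ᵐ σ ∂(uniformPrior D), σ ∈ D :=
  ae_mem_uniformPrior hT.compact

theorem bornProb_nonneg (hT : TestSetting X ρ D L) (m : POVM d X) (x : X) {σ : CMat d}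
    (hσ : σ ∈ D) : 0 ≤ bornProb m x σ :=
  SequentialQHT.bornProb_nonneg m x ⟨σ, (hT.state σ hσ).1.posSemidef, (hT.state σ hσ).2⟩

theorem sum_bornProb (hT : TestSetting X ρ D L) (m : POVM d X) {σ : CMat d} (hσ : σ ∈ D) :
    ∑ x, bornProb m x σ = 1 :=
  SequentialQHT.sum_bornProb m ⟨σ, (hT.state σ hσ).1.posSemidef, (hT.state σ hσ).2⟩

theorem bornProb_eq_zero_iff (hT : TestSetting X ρ D L) (m : POVM d X) (x : X) {σ τ : CMat d}
    (hσ : σ ∈ insert ρ.1 D) (hτ : τ ∈ insert ρ.1 D) : bornProb m x σ = 0 ↔ bornProb m x τ = 0 :=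
  ⟨(hT.bound m x σ hσ τ hτ).1, (hT.bound m x τ hτ σ hσ).1⟩

theorem abs_log_le (hT : TestSetting X ρ D L) (m : POVM d X) (x : X) {σ τ : CMat d}
    (hσ : σ ∈ insert ρ.1 D) (hτ : τ ∈ insert ρ.1 D) :
    |Real.log (bornProb m x σ / bornProb m x τ)| ≤ L := (hT.bound m x σ hσ τ hτ).2

theorem abs_pointwiseLLR_le (hT : TestSetting X ρ D L) {k : ℕ} (h : Fin k → POVM d X × X)
    {σ : CMat d} (hσ : σ ∈ D) : |pointwiseLLR ρ.1 h σ| ≤ k * L := by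
  refine (Finset.abs_sum_le_sum_abs _ _).trans ?_
  refine (Finset.sum_le_sum fun i _ =>
    hT.abs_log_le _ _ (Set.mem_insert _ _) (Set.mem_insert_of_mem _ hσ)).trans_eq ?_
  simp

/-- One factor of the likelihood ratio. -/
theorem exp_neg_log_div (hT : TestSetting X ρ D L) (m : POVM d X) (x : X) {σ : CMat d}
    (hσ : σ ∈ D) (h0 : bornProb m x ρ.1 ≠ 0) :
    Real.exp (-Real.log (bornProb m x ρ.1 / bornProb m x σ)) =
      bornProb m x σ / bornProb m x ρ.1 := by
  have h1 : bornProb m x σ ≠ 0 := fun h => h0 ((hT.bornProb_eq_zero_iff m x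
    (Set.mem_insert_of_mem _ hσ) (Set.mem_insert _ _)).mp h)
  rw [← Real.log_inv, inv_div, Real.exp_log]
  exact div_pos ((hT.bornProb_nonneg m x hσ).lt_of_ne' h1)
    ((SequentialQHT.bornProb_nonneg m x ρ).lt_of_ne' h0)

theorem mixtureLLR_zero (hT : TestSetting X ρ D L) (h : Fin 0 → POVM d X × X) :
    mixtureLLR ρ.1 D h = 0 := by
  have := hT.isProbabilityMeasure
  simp [mixtureLLR, mixtureLR, pointwiseLLR]

variable [MeasurableSpace X] [DiscreteMeasurableSpace X]

theorem integrable_exp (hT : TestSetting X ρ D L) {k : ℕ} (h : Fin k → POVM d X × X) :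
    Integrable (fun σ => Real.exp (-pointwiseLLR ρ.1 h σ)) (uniformPrior D) := by
  have hm : Measurable fun σ => Real.exp (-pointwiseLLR ρ.1 h σ) :=
    ((measurable_pointwiseLLR ρ.1).comp measurable_prodMk_left).neg.exp
  refine Integrable.of_bound hm.aestronglyMeasurable (Real.exp (k * L)) ?_
  filter_upwards [hT.ae_mem] with σ hσ
  rw [Real.norm_eq_abs, Real.abs_exp]
  exact Real.exp_le_exp.mpr ((neg_le_abs _).trans (hT.abs_pointwiseLLR_le h hσ))

theorem mixtureLR_pos (hT : TestSetting X ρ D L) {k : ℕ} (h : Fin k → POVM d X × X) :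
    0 < mixtureLR ρ.1 D h := by
  have := hT.isProbabilityMeasure
  exact integral_exp_pos (hT.integrable_exp h)

theorem exp_neg_mixtureLLR (hT : TestSetting X ρ D L) {k : ℕ} (h : Fin k → POVM d X × X) :
    Real.exp (-mixtureLLR ρ.1 D h) = mixtureLR ρ.1 D h := by
  rw [mixtureLLR, neg_neg, Real.exp_log (hT.mixtureLR_pos h)]

/-- Every point `(1-r)σ + rτ` of the shrunken copy of `D` has, by linearity and positivity, at least
the fraction `1-r` of the likelihood of `σ` in each round. Integrating only over this copy gives the
bound. -/
theorem contraction_le_mixtureLR (hT : TestSetting X ρ D L) {k : ℕ} (h : Fin k → POVM d X × X)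
    {σ : CMat d} (hσ : σ ∈ D) {r : ℝ} (hr0 : 0 ≤ r) (hr1 : r < 1) :
    r ^ Module.finrank ℝ (tracelessHermitian d) *
      ((1 - r) ^ k * Real.exp (-pointwiseLLR ρ.1 h σ)) ≤ mixtureLR ρ.1 D h := by
  have hprob := hT.isProbabilityMeasure
  set s := (fun τ => (1 - r) • σ + r • τ) '' D with hs
  have hsc : IsCompact s := hT.compact.image (by fun_prop)
  have hsub : s ⊆ D := by
    rintro _ ⟨τ, hτ, rfl⟩
    exact hT.convex hσ hτ (by linarith) hr0 (by ring)
  have hpos : volAffine d D ≠ 0 := by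
    obtain ⟨σ, hσ, h⟩ := hT.interior
    exact (volAffine_pos hT.dim_ne_zero hT.compact.isClosed.measurableSet
      (hT.subset_affineStates hσ) h).ne'
  have hmeas : (uniformPrior D).real s = r ^ Module.finrank ℝ (tracelessHermitian d) := by
    rw [measureReal_def, uniformPrior_contraction hT.dim_ne_zero hT.compact hT.convex
      hT.subset_affineStates hpos hσ hr0 hr1.le, ENNReal.toReal_ofReal (by positivity)]
  have hpt : ∀ τ ∈ s, (1 - r) ^ k * Real.exp (-pointwiseLLR ρ.1 h σ) ≤
      Real.exp (-pointwiseLLR ρ.1 h τ) := by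
    intro τ' hτ'
    have hτD := hsub hτ'
    obtain ⟨τ, hτ, rfl⟩ := hτ'
    have hk : (1 - r) ^ k = ∏ _i : Fin k, (1 - r) := by simp
    simp only [pointwiseLLR, ← Finset.sum_neg_distrib, Real.exp_sum]
    rw [hk, ← Finset.prod_mul_distrib]
    refine Finset.prod_le_prod (fun i _ => mul_nonneg (by linarith) (Real.exp_pos _).le)
      fun i _ => ?_
    by_cases h0 : bornProb (h i).1 (h i).2 ρ.1 = 0
    -- A round with a null outcome contributes the factor `exp 0 = 1` on both sides, and `1 - r ≤
    -- 1`.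
    · simp [h0, hr0]
    · have hp := (SequentialQHT.bornProb_nonneg (h i).1 (h i).2 ρ).lt_of_ne' h0
      rw [hT.exp_neg_log_div _ _ hσ h0, hT.exp_neg_log_div _ _ hτD h0, ← mul_div_assoc]
      gcongr
      rw [bornProb_add, bornProb_smul, bornProb_smul]
      have := mul_nonneg hr0 (hT.bornProb_nonneg (h i).1 (h i).2 hτ)
      linarith
  calc _ = ∫ _ in s, (1 - r) ^ k * Real.exp (-pointwiseLLR ρ.1 h σ) ∂(uniformPrior D) := by
        rw [setIntegral_const, hmeas, smul_eq_mul]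
    _ ≤ ∫ τ in s, Real.exp (-pointwiseLLR ρ.1 h τ) ∂(uniformPrior D) :=
        setIntegral_mono_on (integrableOn_const (by finiteness)) (hT.integrable_exp h).integrableOn
          hsc.isClosed.measurableSet hpt
    _ ≤ _ := setIntegral_le_integral (hT.integrable_exp h)
        (Eventually.of_forall fun _ => (Real.exp_pos _).le)

/-- The mixture pays at most a logarithmic price against any fixed alternative. -/
theorem mixtureLLR_le (hT : TestSetting X ρ D L) {k : ℕ} (h : Fin k → POVM d X × X)
    {σ : CMat d} (hσ : σ ∈ D) :
    mixtureLLR ρ.1 D h ≤ pointwiseLLR ρ.1 h σ + 1 +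
      Module.finrank ℝ (tracelessHermitian d) * Real.log (k + 1) := by
  rcases Nat.eq_zero_or_pos k with rfl | hk
  · rw [hT.mixtureLLR_zero]
    simp [pointwiseLLR]
  have hk' : (0 : ℝ) < k := by exact_mod_cast hk
  -- The ratio `r = 1/(k+1)` balances the two losses: prior mass `(k+1)^(-dim)` and likelihood
  -- `(k/(k+1))^k ≥ 1/e`. At `k = 0` it would be `1`, hence the separate case.
  have hr1 : (1 : ℝ) / (k + 1) < 1 := by rw [div_lt_one (by positivity)]; linarith
  have h1 := hT.contraction_le_mixtureLR h hσ (r := 1 / ((k : ℝ) + 1)) (by positivity) hr1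
  have e1 : 1 - 1 / ((k : ℝ) + 1) = k / (k + 1) := by field_simp; ring
  have h2 := Real.log_le_log (mul_pos (by positivity) (mul_pos (by rw [e1]; positivity)
    (Real.exp_pos _))) h1
  rw [Real.log_mul (by positivity) (mul_pos (by rw [e1]; positivity) (Real.exp_pos _)).ne',
    Real.log_mul (by rw [e1]; positivity) (Real.exp_pos _).ne', Real.log_exp, Real.log_pow,
    Real.log_pow, one_div, Real.log_inv] at h2
  have h3 : -1 ≤ (k : ℝ) * Real.log (1 - ((k : ℝ) + 1)⁻¹) := by
    rw [← one_div, e1]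
    have h4 := Real.log_le_sub_one_of_pos (x := ((k : ℝ) + 1) / k) (by positivity)
    have h5 : Real.log ((k : ℝ) / (k + 1)) = -Real.log ((k + 1) / k) := by
      rw [← Real.log_inv, inv_div]
    have h6 : (k : ℝ) * (((k : ℝ) + 1) / k - 1) = 1 := by field_simp; ring
    rw [h5]
    nlinarith
  rw [mixtureLLR]
  linarith

theorem posterior_spec (hT : TestSetting X ρ D L) {k : ℕ} (h : Fin k → POVM d X × X) :
    IsProbabilityMeasure (posterior ρ.1 D h) ∧ ∀ᵐ σ ∂(posterior ρ.1 D h), σ ∈ D := by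
  refine ⟨⟨?_⟩, (withDensity_absolutelyContinuous _ _).ae_le hT.ae_mem⟩
  have hpos := hT.mixtureLR_pos h
  rw [posterior, withDensity_apply _ MeasurableSet.univ, setLIntegral_univ,
    ← ofReal_integral_eq_lintegral_ofReal ((hT.integrable_exp h).div_const _)
      (Eventually.of_forall fun σ => div_nonneg (Real.exp_pos _).le hpos.le),
    integral_div, ← mixtureLR, div_self hpos.ne', ENNReal.ofReal_one]

theorem barycentre_mem (hT : TestSetting X ρ D L) {k : ℕ} (h : Fin k → POVM d X × X) :
    barycentre ρ.1 D h ∈ D := by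
  have := (hT.posterior_spec h).1
  exact (integral_mem_of_convex_of_isCompact hT.convex hT.compact (hT.posterior_spec h).2).2

theorem bornProb_barycentre (hT : TestSetting X ρ D L) {k : ℕ} (h : Fin k → POVM d X × X)
    (m : POVM d X) (x : X) :
    bornProb m x (barycentre ρ.1 D h) = ∫ σ, bornProb m x σ ∂(posterior ρ.1 D h) := by
  have := (hT.posterior_spec h).1
  have hint := (integral_mem_of_convex_of_isCompact hT.convex hT.compact (hT.posterior_spec h).2).1
  have e : ∀ σ : CMat d, bornProb m x σ = (∑ i, ∑ j, m.1 x i j * σ j i).re := fun σ => by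
    simp [bornProb, Matrix.trace, Matrix.mul_apply]
  have hi : ∀ i j, Integrable (fun σ : CMat d => m.1 x i j * σ j i) (posterior ρ.1 D h) :=
    fun i j => (hint j i).const_mul _
  simp only [e]
  have h1 : ∫ σ, (∑ i, ∑ j, m.1 x i j * σ j i).re ∂(posterior ρ.1 D h) =
      (∫ σ, (∑ i, ∑ j, m.1 x i j * σ j i) ∂(posterior ρ.1 D h)).re :=
    integral_re (𝕜 := ℂ)
      (integrable_finsetSum _ fun i _ => integrable_finsetSum _ fun j _ => hi i j)
  rw [h1, integral_finsetSum _ fun i _ => integrable_finsetSum _ fun j _ => hi i j]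
  simp only [integral_finsetSum _ fun j _ => hi _ j, integral_const_mul]
  rfl

/-- Bayesian prediction: the mixture likelihood ratio is multiplied by the posterior mean of the
one-step ratio, and linearity of Born's rule moves this mean onto the state. The composite problem
thus becomes a test of `ρ` against a moving simple alternative. -/
theorem mixtureLLR_snoc (hT : TestSetting X ρ D L) {k : ℕ} (h : Fin k → POVM d X × X)
    (y : POVM d X × X) :
    mixtureLLR ρ.1 D (Fin.snoc h y : Fin (k + 1) → POVM d X × X) = mixtureLLR ρ.1 D h +
      Real.log (bornProb y.1 y.2 ρ.1 / bornProb y.1 y.2 (barycentre ρ.1 D h)) := by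
  by_cases h0 : bornProb y.1 y.2 ρ.1 = 0
  · have h1 : ∀ σ, pointwiseLLR ρ.1 (Fin.snoc h y : Fin (k + 1) → POVM d X × X) σ =
        pointwiseLLR ρ.1 h σ := fun σ => by
      rw [pointwiseLLR_snoc]; simp [h0]
    simp [mixtureLLR, mixtureLR, h1, h0]
  have hpos := hT.mixtureLR_pos h
  have hρ := (SequentialQHT.bornProb_nonneg y.1 y.2 ρ).lt_of_ne' h0
  have hb0 : bornProb y.1 y.2 (barycentre ρ.1 D h) ≠ 0 := fun hb => h0
    ((hT.bornProb_eq_zero_iff y.1 y.2 (Set.mem_insert_of_mem _ (hT.barycentre_mem h))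
      (Set.mem_insert _ _)).mp hb)
  have key : mixtureLR ρ.1 D (Fin.snoc h y : Fin (k + 1) → POVM d X × X) = mixtureLR ρ.1 D h *
      (bornProb y.1 y.2 (barycentre ρ.1 D h) / bornProb y.1 y.2 ρ.1) := by
    have hm : Measurable fun σ => ENNReal.ofReal
        (Real.exp (-pointwiseLLR ρ.1 h σ) / mixtureLR ρ.1 D h) :=
      (((measurable_pointwiseLLR ρ.1).comp measurable_prodMk_left).neg.exp.div_const _).ennreal_ofReal
    rw [hT.bornProb_barycentre, posterior, integral_withDensity_eq_integral_toReal_smul hm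
      (ae_of_all _ fun _ => ENNReal.ofReal_lt_top), mixtureLR, ← integral_div,
      ← integral_const_mul]
    refine integral_congr_ae ?_
    filter_upwards [hT.ae_mem] with σ hσ
    rw [pointwiseLLR_snoc, neg_add, Real.exp_add, hT.exp_neg_log_div _ _ hσ h0,
      ENNReal.toReal_ofReal (div_nonneg (Real.exp_pos _).le hpos.le), smul_eq_mul]
    field_simp
  rw [mixtureLLR, mixtureLLR, key, Real.log_mul hpos.ne' (div_ne_zero hb0 h0), neg_add,
    ← Real.log_inv (_ / _), inv_div]

end TestSetting

/-! ### Appending a round to a record. -/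

theorem measurable_snoc {Y : Type*} [MeasurableSpace Y] (k : ℕ) :
    Measurable fun p : (Fin k → Y) × Y => (Fin.snoc p.1 p.2 : Fin (k + 1) → Y) := by
  refine measurable_pi_lambda _ fun i => ?_
  refine Fin.lastCases ?_ (fun j => ?_) i
  · simpa using measurable_snd
  · simpa [Function.comp_def] using (measurable_pi_apply j).comp measurable_fst

theorem measurable_snoc_left {Y : Type*} [MeasurableSpace Y] {k : ℕ} (h : Fin k → Y) :
    Measurable fun y : Y => (Fin.snoc h y : Fin (k + 1) → Y) := by
  have := (measurable_snoc k).comp (measurable_prodMk_left (x := h) (β := Y))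
  exact this

theorem measurable_hist {Y : Type*} [MeasurableSpace Y] (k : ℕ) :
    Measurable (hist k : (ℕ → Y) → Fin k → Y) :=
  measurable_pi_lambda _ fun _ => measurable_pi_apply _

theorem measurable_init {Y : Type*} [MeasurableSpace Y] (k : ℕ) :
    Measurable fun h : Fin (k + 1) → Y => (Fin.init h : Fin k → Y) :=
  measurable_pi_lambda _ fun _ => measurable_pi_apply _

theorem init_hist {Y : Type*} (k : ℕ) (ω : ℕ → Y) :
    (Fin.init (hist (k + 1) ω) : Fin k → Y) = hist k ω := rfl

theorem snoc_hist {Y : Type*} (k : ℕ) (ω : ℕ → Y) :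
    (Fin.snoc (hist k ω) (ω k) : Fin (k + 1) → Y) = hist (k + 1) ω :=
  Fin.snoc_init_self (α := fun _ => Y) (hist (k + 1) ω)

theorem lintegral_bornMeasure {d : ℕ} {X : Type*} [Fintype X] [MeasurableSpace X]
    [DiscreteMeasurableSpace X] (ρ : CMat d) (m : POVM d X) (f : X → ℝ≥0∞) :
    ∫⁻ x, f x ∂(bornMeasure ρ m) = ∑ x, ENNReal.ofReal (bornProb m x ρ) * f x :=
  lintegral_sum_smul_dirac _ f

namespace SQHT

variable {d : ℕ} {X : Type*} [Fintype X] [MeasurableSpace X]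

/-! ### The stopping time -/

/-- Records of length `k` after which the test is still running. -/
def running (S : SQHT d X) : ∀ k, Set (Fin k → POVM d X × X)
  -- The decision at time `0` is ignored, in accordance with `k ≥ 1` in `stoppingTime`.
  | 0 => Set.univ
  | k + 1 => {h | Fin.init h ∈ S.running k ∧ S.decide (k + 1) h = Decision.continue}

/-- Records of length `k + 1` after which the test stops with decision `δ`. -/
def stopped (S : SQHT d X) (δ : Decision) (k : ℕ) : Set (Fin (k + 1) → POVM d X × X) :=
  {h | Fin.init h ∈ S.running k ∧ S.decide (k + 1) h = δ}

theorem measurableSet_running (S : SQHT d X) : ∀ k, MeasurableSet (S.running k)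
  | 0 => MeasurableSet.univ
  | k + 1 => ((measurable_init k) (S.measurableSet_running k)).inter (S.measurableSet_decide _ _)

theorem measurableSet_stopped (S : SQHT d X) (δ : Decision) (k : ℕ) :
    MeasurableSet (S.stopped δ k) :=
  ((measurable_init k) (S.measurableSet_running k)).inter (S.measurableSet_decide _ _)

theorem hist_mem_running_iff (S : SQHT d X) (ω : ℕ → POVM d X × X) (k : ℕ) :
    hist k ω ∈ S.running k ↔
      ∀ j, 1 ≤ j → j ≤ k → S.decide j (hist j ω) = Decision.continue := by
  induction k with
  | zero => simpa [running] using fun j h1 h2 => by omega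
  | succ k ih =>
    change hist k ω ∈ S.running k ∧ _ ↔ _
    rw [ih]
    constructor
    · rintro ⟨h1, h2⟩ j hj hjk
      rcases hjk.lt_or_eq with h | rfl
      · exact h1 j hj (by omega)
      · exact h2
    · exact fun h => ⟨fun j hj hjk => h j hj (by omega), h (k + 1) (by omega) le_rfl⟩

theorem lt_stoppingTime_iff (S : SQHT d X) (ω : ℕ → POVM d X × X) (k : ℕ) :
    (k : ℕ∞) < S.stoppingTime ω ↔ hist k ω ∈ S.running k := by
  rw [hist_mem_running_iff, ← not_le, ← ENat.lt_add_one_iff (ENat.natCast_ne_top k), not_lt,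
    stoppingTime]
  simp only [le_iInf_iff, Set.mem_ofPred_eq]
  constructor
  · intro h j hj hjk
    by_contra hc
    have := h j ⟨hj, hc⟩
    have h' : k + 1 ≤ j := by exact_mod_cast this
    omega
  · rintro h j ⟨hj, hc⟩
    have : k < j := by
      by_contra h'
      exact hc (h j hj (by omega))
    exact_mod_cast Nat.succ_le_of_lt this

theorem toENNReal_eq_tsum (n : ℕ∞) :
    (n : ℝ≥0∞) = ∑' k : ℕ, {k : ℕ | (k : ℕ∞) < n}.indicator (fun _ => (1 : ℝ≥0∞)) k := by
  induction n with
  | top => simp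
  | coe n =>
    rw [tsum_eq_sum (s := Finset.range n)]
    · rw [Finset.sum_congr rfl (g := fun _ => 1)]
      · simp
      · intro k hk
        simpa using hk
    · intro k hk
      simpa using hk

/-! ### The law of the record -/

variable [DiscreteMeasurableSpace X]

instance (S : SQHT d X) (ρ : State d) : IsProbabilityMeasure (S.law ρ) := by
  unfold law; infer_instance

theorem map_law_zero (S : SQHT d X) (ρ : State d) :
    (S.law ρ).map (fun ω => ω 0) = S.step ρ 0 Fin.elim0 := by
  let μ₀ : Measure (POVM d X × X) := S.step ρ 0 Fin.elim0
  have h1 : (S.law ρ).map (Preorder.frestrictLe (π := fun _ : ℕ => POVM d X × X) 0) =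
      μ₀.map (MeasurableEquiv.piUnique fun _ : Finset.Iic 0 => POVM d X × X).symm := by
    rw [law, Kernel.trajMeasure, Measure.map_comp _ _ (by fun_prop), Kernel.traj_map_frestrictLe,
      Kernel.partialTraj_self]
    exact Measure.id_comp
  have h2 : (fun ω : ℕ → POVM d X × X => ω 0) =
      (fun z : (∀ _ : Finset.Iic 0, POVM d X × X) => z ⟨0, by simp⟩) ∘
        (Preorder.frestrictLe (π := fun _ : ℕ => POVM d X × X) 0) := rfl
  rw [h2, ← Measure.map_map (measurable_pi_apply _) (by fun_prop), h1,
    Measure.map_map (measurable_pi_apply _) (MeasurableEquiv.measurable _)]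
  exact Measure.map_id

/-- Disintegration of the law of the record after one more round. -/
theorem lintegral_hist_succ (S : SQHT d X) (ρ : State d) (k : ℕ)
    {f : (Fin (k + 1) → POVM d X × X) → ℝ≥0∞} (hf : Measurable f) :
    ∫⁻ ω, f (hist (k + 1) ω) ∂(S.law ρ) =
      ∫⁻ ω, ∫⁻ y, f (Fin.snoc (hist k ω) y) ∂(S.step ρ k (hist k ω)) ∂(S.law ρ) := by
  -- The first round is drawn from the initial measure of `trajMeasure`, and only later rounds from
  -- `stepIic`, hence the case split.
  cases k with
  | zero =>
    have h0 : ∀ ω : ℕ → POVM d X × X, hist 0 ω = (Fin.elim0 : Fin 0 → POVM d X × X) :=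
      fun ω => Subsingleton.elim _ _
    have e : ∫⁻ ω, ∫⁻ y, f (Fin.snoc (hist 0 ω) y) ∂(S.step ρ 0 (hist 0 ω)) ∂(S.law ρ) =
        ∫⁻ _, (∫⁻ y, f (Fin.snoc (Fin.elim0 : Fin 0 → POVM d X × X) y) ∂(S.step ρ 0 Fin.elim0))
          ∂(S.law ρ) := lintegral_congr fun ω => by rw [h0 ω]
    rw [e, lintegral_const, measure_univ, mul_one, ← map_law_zero, lintegral_map (f := fun y =>
      f (Fin.snoc (Fin.elim0 : Fin 0 → POVM d X × X) y))
      (hf.comp (measurable_snoc_left Fin.elim0)) (measurable_pi_apply 0)]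
    refine lintegral_congr fun ω => ?_
    have := snoc_hist 0 ω
    rw [h0 ω] at this
    exact congrArg f this.symm
  | succ a =>
    let φ : (∀ _ : Finset.Iic a, POVM d X × X) → Fin (a + 1) → POVM d X × X :=
      fun h i => h ⟨i, Finset.mem_Iic.mpr (Nat.lt_succ_iff.mp i.isLt)⟩
    have hφ : Measurable φ := measurable_pi_lambda _ fun _ => measurable_pi_apply _
    have hF : Measurable fun p : (∀ _ : Finset.Iic a, POVM d X × X) × (POVM d X × X) =>
        f (Fin.snoc (φ p.1) p.2) :=
      hf.comp ((measurable_snoc _).comp ((hφ.comp measurable_fst).prodMk measurable_snd))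
    have hr : Measurable (Preorder.frestrictLe (π := fun _ : ℕ => POVM d X × X) a) := by fun_prop
    have key := Kernel.map_frestrictLe_trajMeasure_compProd_eq_map_trajMeasure
      (X := fun _ => POVM d X × X) (μ₀ := S.step ρ 0 Fin.elim0) (κ := S.stepIic ρ) (a := a)
    have e1 : ∫⁻ ω, f (hist (a + 1 + 1) ω) ∂(S.law ρ) =
        ∫⁻ p, f (Fin.snoc (φ p.1) p.2) ∂((S.law ρ).map (fun x =>
          (Preorder.frestrictLe (π := fun _ : ℕ => POVM d X × X) a x, x (a + 1)))) := by
      rw [lintegral_map hF (hr.prodMk (measurable_pi_apply _))]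
      refine lintegral_congr fun ω => ?_
      rw [← snoc_hist]
      rfl
    rw [e1, law, ← key, Measure.lintegral_compProd hF, lintegral_map
      (hF.lintegral_kernel_prod_right') hr]
    rfl

/-- A test whose measurement in each round is a function of the past record. -/
def HasStrategy (S : SQHT d X) (M : ∀ k, (Fin k → POVM d X × X) → POVM d X) : Prop :=
  ∀ k h, S.strategy k h = Measure.dirac (M k h)

theorem lintegral_step (S : SQHT d X) {M : ∀ k, (Fin k → POVM d X × X) → POVM d X}
    (hM : S.HasStrategy M) (ρ : State d) (k : ℕ) (h : Fin k → POVM d X × X)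
    {f : POVM d X × X → ℝ≥0∞} (hf : Measurable f) :
    ∫⁻ y, f y ∂(S.step ρ k h) =
      ∑ x, ENNReal.ofReal (bornProb (M k h) x ρ.1) * f (M k h, x) := by
  have hm : Measurable fun m : POVM d X => ∫⁻ x, f (m, x) ∂(bornKernel ρ m) :=
    hf.lintegral_kernel_prod_right'
  rw [step, Kernel.lintegral_compProd _ _ _ hf, hM]
  simp only [Kernel.prodMkLeft_apply]
  rw [lintegral_dirac' _ hm]
  exact lintegral_bornMeasure _ _ _

theorem lintegral_hist_succ_eq_sum (S : SQHT d X)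
    {M : ∀ k, (Fin k → POVM d X × X) → POVM d X} (hM : S.HasStrategy M) (ρ : State d) (k : ℕ)
    {f : (Fin (k + 1) → POVM d X × X) → ℝ≥0∞} (hf : Measurable f) :
    ∫⁻ ω, f (hist (k + 1) ω) ∂(S.law ρ) =
      ∫⁻ ω, ∑ x, ENNReal.ofReal (bornProb (M k (hist k ω)) x ρ.1) *
        f (Fin.snoc (hist k ω) (M k (hist k ω), x)) ∂(S.law ρ) := by
  rw [S.lintegral_hist_succ ρ k hf]
  refine lintegral_congr fun ω => ?_
  exact S.lintegral_step hM ρ k _ (hf.comp (measurable_snoc_left _))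

/-- The tail-sum formula; the event of not having stopped by time `k` depends only on the first `k`
rounds. -/
theorem expectedTime_eq (S : SQHT d X) (ρ : State d) :
    S.expectedTime ρ = ∑' k, S.law ρ {ω | hist k ω ∈ S.running k} := by
  have hm : ∀ k, MeasurableSet {ω | hist k ω ∈ S.running k} := fun k =>
    measurable_hist k (S.measurableSet_running k)
  have : ∀ k, S.law ρ {ω | hist k ω ∈ S.running k} =
      ∫⁻ ω, {ω | hist k ω ∈ S.running k}.indicator (fun _ => 1) ω ∂(S.law ρ) := fun k => by
    rw [lintegral_indicator (hm k)]; simp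
  simp only [this]
  rw [expectedTime, ← lintegral_tsum fun k => (measurable_const.indicator (hm k)).aemeasurable]
  refine lintegral_congr fun ω => ?_
  rw [toENNReal_eq_tsum]
  refine tsum_congr fun k => ?_
  by_cases h : hist k ω ∈ S.running k <;> simp [lt_stoppingTime_iff, h]

theorem probDecide_le (S : SQHT d X) (ρ : State d) (δ : Decision) :
    S.probDecide ρ δ ≤ ∑' k, S.law ρ {ω | hist (k + 1) ω ∈ S.stopped δ k} := by
  refine le_trans (measure_mono ?_) (measure_iUnion_le _)
  rintro ω ⟨k, hk, hd⟩
  rw [Set.mem_iUnion]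
  have h0 : hist 0 ω ∈ S.running 0 := Set.mem_univ _
  have hk0 : k ≠ 0 := by
    rintro rfl
    have := (S.lt_stoppingTime_iff ω 0).mpr h0
    rw [hk] at this
    exact lt_irrefl _ this
  obtain ⟨j, rfl⟩ := Nat.exists_eq_succ_of_ne_zero hk0
  refine ⟨j, (S.lt_stoppingTime_iff ω j).mp ?_, hd⟩
  rw [hk]
  exact_mod_cast Nat.lt_succ_self j

theorem tsum_stopped_le_one (S : SQHT d X) (ρ : State d) {δ : Decision}
    (hδ : δ ≠ Decision.continue) :
    ∑' k, S.law ρ {ω | hist (k + 1) ω ∈ S.stopped δ k} ≤ 1 := by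
  rw [← measure_univ (μ := S.law ρ)]
  refine tsum_meas_le_meas_iUnion_of_disjoint _ (fun k =>
    measurable_hist (k + 1) (S.measurableSet_stopped δ k)) ?_ |>.trans (measure_mono (Set.subset_univ _))
  have key : ∀ i j, i < j → Disjoint {ω : ℕ → POVM d X × X | hist (i + 1) ω ∈ S.stopped δ i}
      {ω | hist (j + 1) ω ∈ S.stopped δ j} := by
    intro i j hij
    refine Set.disjoint_left.mpr fun ω hi hj => hδ ?_
    have h1 : hist j ω ∈ S.running j := hj.1
    rw [← (S.hist_mem_running_iff ω j).mp h1 (i + 1) (by omega) (by omega)]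
    exact hi.2.symm
  intro i j hij
  rcases lt_or_gt_of_ne hij with h | h
  · exact key i j h
  · exact (key j i h).symm

end SQHT

/-! ### Change of measure -/

namespace TestSetting

variable {d : ℕ} {X : Type*} [Fintype X] [MeasurableSpace X] [DiscreteMeasurableSpace X]
  {ρ : State d} {D : Set (CMat d)} {L : ℝ}

/-- Both laws choose measurements by the same rule, so the density on `k` rounds is the product of
the Born ratios. Outcomes that are null for one state are null for the other, so no singular part
arises. -/
theorem lintegral_hist_change_of_measure (hT : TestSetting X ρ D L) (S : SQHT d X)
    {M : ∀ k, (Fin k → POVM d X × X) → POVM d X} (hM : S.HasStrategy M)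
    (hMm : ∀ k, Measurable (M k)) {σ : State d} (hσ : σ.1 ∈ D) (k : ℕ)
    {f : (Fin k → POVM d X × X) → ℝ≥0∞} (hf : Measurable f) :
    ∫⁻ ω, f (hist k ω) ∂(S.law σ) =
      ∫⁻ ω, f (hist k ω) * ENNReal.ofReal (Real.exp (-pointwiseLLR ρ.1 (hist k ω) σ.1))
        ∂(S.law ρ) := by
  induction k with
  | zero =>
    have h0 : ∀ ω : ℕ → POVM d X × X, hist 0 ω = Fin.elim0 := fun ω => Subsingleton.elim _ _
    simp [h0, pointwiseLLR]
  | succ k ih =>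
    have hmS : ∀ k, Measurable fun h : Fin k → POVM d X × X =>
        ENNReal.ofReal (Real.exp (-pointwiseLLR ρ.1 h σ.1)) := fun k =>
      ((measurable_pointwiseLLR ρ.1).comp measurable_prodMk_right).neg.exp.ennreal_ofReal
    have hpair : ∀ x : X, Measurable fun h : Fin k → POVM d X × X => (M k h, x) := fun x =>
      (hMm k).prodMk measurable_const
    rw [S.lintegral_hist_succ_eq_sum hM σ k hf,
      S.lintegral_hist_succ_eq_sum hM ρ k (f := fun h => f h *
        ENNReal.ofReal (Real.exp (-pointwiseLLR ρ.1 h σ.1))) (hf.mul (hmS _)),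
      ih (f := fun h => ∑ x, ENNReal.ofReal (bornProb (M k h) x σ.1) * f (Fin.snoc h (M k h, x)))
        (Finset.measurable_sum _ fun x _ => Measurable.mul
          (measurable_bornProb.comp ((hpair x).prodMk measurable_const)).ennreal_ofReal
          (hf.comp ((measurable_snoc k).comp (measurable_id.prodMk (hpair x)))))]
    refine lintegral_congr fun ω => ?_
    rw [Finset.sum_mul]
    refine Finset.sum_congr rfl fun x _ => ?_
    set m := M k (hist k ω)
    rw [pointwiseLLR_snoc, neg_add, Real.exp_add, ENNReal.ofReal_mul (Real.exp_pos _).le]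
    by_cases h0 : bornProb m x ρ.1 = 0
    · have h1 := (hT.bornProb_eq_zero_iff m x (Set.mem_insert _ _)
        (Set.mem_insert_of_mem _ hσ)).mp h0
      simp [h0, h1]
    · have hp := (SequentialQHT.bornProb_nonneg m x ρ).lt_of_ne' h0
      have e : ENNReal.ofReal (bornProb m x σ.1) = ENNReal.ofReal (bornProb m x ρ.1) *
          ENNReal.ofReal (Real.exp (-Real.log (bornProb m x ρ.1 / bornProb m x σ.1))) := by
        rw [← ENNReal.ofReal_mul hp.le, hT.exp_neg_log_div m x hσ h0, mul_div_cancel₀ _ h0]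
      rw [e]
      ring

end TestSetting

/-! ### Adapted processes with positive drift -/

theorem sum_ofReal_bornProb_mul {d : ℕ} {X : Type*} [Fintype X] (m : POVM d X) (τ : State d) {f : X → ℝ} (hf : ∀ x, 0 ≤ f x) :
    ∑ x, ENNReal.ofReal (bornProb m x τ.1) * ENNReal.ofReal (f x) =
      ENNReal.ofReal (∑ x, bornProb m x τ.1 * f x) := by
  rw [ENNReal.ofReal_sum_of_nonneg fun x _ => mul_nonneg (bornProb_nonneg m x τ) (hf x)]
  exact Finset.sum_congr rfl fun x _ => (ENNReal.ofReal_mul (bornProb_nonneg m x τ)).symm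

section Drift

variable {d : ℕ} {X : Type*} [Fintype X] [MeasurableSpace X]

/-- The expected one-step increment of the process `Z` under the state `τ`, given the record. -/
def drift (M : ∀ k, (Fin k → POVM d X × X) → POVM d X) (τ : CMat d)
    (Z : ∀ k, (Fin k → POVM d X × X) → ℝ) (k : ℕ) (h : Fin k → POVM d X × X) : ℝ :=
  ∑ x, bornProb (M k h) x τ * (Z (k + 1) (Fin.snoc h (M k h, x)) - Z k h)

/-- A process started at zero whose increments along the strategy `M` are bounded by `C`. -/
structure HasBoundedIncrements (M : ∀ k, (Fin k → POVM d X × X) → POVM d X)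
    (Z : ∀ k, (Fin k → POVM d X × X) → ℝ) (C : ℝ) : Prop where
  measurable : ∀ k, Measurable (Z k)
  zero : ∀ h, Z 0 h = 0
  nonneg : 0 ≤ C
  abs_sub_le : ∀ k h y, |Z (k + 1) (Fin.snoc h y) - Z k h| ≤ C

variable [DiscreteMeasurableSpace X]
  {S : SQHT d X} {M : ∀ k, (Fin k → POVM d X × X) → POVM d X}
  {Z : ∀ k, (Fin k → POVM d X × X) → ℝ} {C : ℝ}

namespace HasBoundedIncrements

/-- Exponential supermartingale estimate for a process with positive drift. -/
theorem lintegral_exp_le (hZ : HasBoundedIncrements M Z C) (hM : S.HasStrategy M) {τ : State d}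
    {δ t : ℝ} (hδ : ∀ k h, δ ≤ drift M τ.1 Z k h) (ht : 0 ≤ t) (htC : t * C ≤ 1) (k : ℕ) :
    ∫⁻ ω, ENNReal.ofReal (Real.exp (-(t * Z k (hist k ω)))) ∂(S.law τ) ≤
      ENNReal.ofReal (Real.exp (-(k * (t * δ - t ^ 2 * C ^ 2)))) := by
  induction k with
  | zero => simp [hZ.zero]
  | succ k ih =>
    have hm : Measurable fun h : Fin (k + 1) → POVM d X × X =>
        ENNReal.ofReal (Real.exp (-(t * Z (k + 1) h))) :=
      ((hZ.measurable _).const_mul t).neg.exp.ennreal_ofReal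
    rw [S.lintegral_hist_succ_eq_sum hM τ k hm]
    have key : ∀ h : Fin k → POVM d X × X,
        ∑ x, ENNReal.ofReal (bornProb (M k h) x τ.1) *
          ENNReal.ofReal (Real.exp (-(t * Z (k + 1) (Fin.snoc h (M k h, x))))) ≤
        ENNReal.ofReal (Real.exp (-(t * δ - t ^ 2 * C ^ 2))) *
          ENNReal.ofReal (Real.exp (-(t * Z k h))) := by
      intro h
      rw [sum_ofReal_bornProb_mul _ _ fun x => (Real.exp_pos _).le,
        ← ENNReal.ofReal_mul (Real.exp_pos _).le]
      refine ENNReal.ofReal_le_ofReal ?_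
      have hx : ∀ x, bornProb (M k h) x τ.1 *
          Real.exp (-(t * Z (k + 1) (Fin.snoc h (M k h, x)))) ≤
          (bornProb (M k h) x τ.1 * (1 + t ^ 2 * C ^ 2) - t * (bornProb (M k h) x τ.1 *
            (Z (k + 1) (Fin.snoc h (M k h, x)) - Z k h))) * Real.exp (-(t * Z k h)) := by
        intro x
        have hp := bornProb_nonneg (M k h) x τ
        have hb := hZ.abs_sub_le k h (M k h, x)
        set u := Z (k + 1) (Fin.snoc h (M k h, x)) - Z k h with hu
        have hu1 : |-(t * u)| ≤ 1 := by
          rw [abs_neg, abs_mul, abs_of_nonneg ht]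
          exact (mul_le_mul_of_nonneg_left hb ht).trans htC
        -- Since `|t u| ≤ 1`, this gives `exp (-t u) ≤ 1 - t u + t² C²`. Averaging replaces `u` by
        -- the drift.
        have he := (abs_le.mp (Real.abs_exp_sub_one_sub_id_le hu1)).2
        have hu2 : (-(t * u)) ^ 2 ≤ t ^ 2 * C ^ 2 := by
          rw [neg_sq, mul_pow, ← sq_abs u]
          gcongr
        have e1 : Real.exp (-(t * Z (k + 1) (Fin.snoc h (M k h, x)))) =
            Real.exp (-(t * u)) * Real.exp (-(t * Z k h)) := by
          rw [← Real.exp_add]; congr 1; rw [hu]; ring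
        rw [e1, ← mul_assoc]
        refine mul_le_mul_of_nonneg_right ?_ (Real.exp_pos _).le
        nlinarith [mul_le_mul_of_nonneg_left (show Real.exp (-(t * u)) ≤ 1 + t ^ 2 * C ^ 2 - t * u
          by linarith) hp]
      refine (Finset.sum_le_sum fun x _ => hx x).trans ?_
      rw [← Finset.sum_mul]
      refine mul_le_mul_of_nonneg_right ?_ (Real.exp_pos _).le
      rw [Finset.sum_sub_distrib, ← Finset.sum_mul, sum_bornProb, ← Finset.mul_sum]
      have h1 := mul_le_mul_of_nonneg_left (hδ k h) ht
      have h2 := Real.add_one_le_exp (-(t * δ - t ^ 2 * C ^ 2))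
      rw [drift] at h1
      linarith
    refine (lintegral_mono fun ω => key (hist k ω)).trans ?_
    rw [lintegral_const_mul' _ _ ENNReal.ofReal_ne_top]
    refine (mul_le_mul_right ih _).trans_eq ?_
    rw [← ENNReal.ofReal_mul (Real.exp_pos _).le, ← Real.exp_add]
    congr 2
    push_cast
    ring

theorem measure_le_le (hZ : HasBoundedIncrements M Z C) (hM : S.HasStrategy M) {τ : State d}
    {δ t : ℝ} (hδ : ∀ k h, δ ≤ drift M τ.1 Z k h) (ht : 0 ≤ t) (htC : t * C ≤ 1) (k : ℕ)
    (z : ℝ) : S.law τ {ω | Z k (hist k ω) ≤ z} ≤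
      ENNReal.ofReal (Real.exp (t * z - k * (t * δ - t ^ 2 * C ^ 2))) := by
  have hms : MeasurableSet {ω | Z k (hist k ω) ≤ z} :=
    measurableSet_le ((hZ.measurable k).comp (measurable_hist k)) measurable_const
  have hle : S.law τ {ω | Z k (hist k ω) ≤ z} ≤
      ∫⁻ ω, ENNReal.ofReal (Real.exp (t * z)) *
        ENNReal.ofReal (Real.exp (-(t * Z k (hist k ω)))) ∂(S.law τ) := by
    rw [← lintegral_indicator_one hms]
    refine lintegral_mono fun ω => ?_
    rw [← ENNReal.ofReal_mul (Real.exp_pos _).le, ← Real.exp_add]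
    by_cases h : ω ∈ {ω | Z k (hist k ω) ≤ z}
    · rw [Set.indicator_of_mem h, Pi.one_apply, ENNReal.one_le_ofReal, Real.one_le_exp_iff]
      have := mul_le_mul_of_nonneg_left (show Z k (hist k ω) ≤ z from h) ht
      linarith
    · rw [Set.indicator_of_notMem h]; exact zero_le
  refine hle.trans ?_
  rw [lintegral_const_mul' _ _ ENNReal.ofReal_ne_top]
  refine (mul_le_mul_right (hZ.lintegral_exp_le hM hδ ht htC k) _).trans_eq ?_
  rw [← ENNReal.ofReal_mul (Real.exp_pos _).le, ← Real.exp_add]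
  congr 2

/-- The running times form an initial segment, so the increments telescope up to the first exit and
`hrun` bounds the final value. The shift by `C`, counted once per running round, makes increments
bounded by `C` nonnegative for later use in `lintegral`. -/
theorem sum_increments_le {Y : Type*} {R : ∀ k, Set (Fin k → Y)}
    (hR : ∀ k (h : Fin (k + 1) → Y), h ∈ R (k + 1) → Fin.init h ∈ R k)
    {Z : ∀ k, (Fin k → Y) → ℝ} (hZ0 : ∀ h, Z 0 h = 0) {K η C : ℝ} (hK : 0 ≤ K)
    (hrun : ∀ k (h : Fin (k + 1) → Y), Fin.init h ∈ R k → Z (k + 1) h ≤ K + η * (k + 1))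
    (ω : ℕ → Y) (N : ℕ) :
    ∑ k ∈ Finset.range N, (hist k ⁻¹' R k).indicator
        (fun ω => Z (k + 1) (hist (k + 1) ω) - Z k (hist k ω) + C) ω ≤
      K + (η + C) * ∑ k ∈ Finset.range N, (hist k ⁻¹' R k).indicator (fun _ => (1 : ℝ)) ω := by
  induction N with
  | zero => simpa using hK
  | succ N ih =>
    by_cases hN : hist N ω ∈ R N
    · have hall : ∀ k, k ≤ N → hist k ω ∈ R k := by
        intro k hk
        induction hk using Nat.decreasingInduction with
        | self => exact hN
        | of_succ k _ ihk => exact hR k _ ihk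
      have e1 : ∀ k ∈ Finset.range (N + 1), (hist k ⁻¹' R k).indicator
          (fun ω => Z (k + 1) (hist (k + 1) ω) - Z k (hist k ω) + C) ω =
          Z (k + 1) (hist (k + 1) ω) - Z k (hist k ω) + C := fun k hk =>
        Set.indicator_of_mem (s := hist k ⁻¹' R k) (hall k (Finset.mem_range_succ_iff.mp hk)) _
      have e2 : ∀ k ∈ Finset.range (N + 1), (hist k ⁻¹' R k).indicator (fun _ => (1 : ℝ)) ω = 1 :=
        fun k hk => Set.indicator_of_mem (s := hist k ⁻¹' R k) (hall k (Finset.mem_range_succ_iff.mp hk)) _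
      rw [Finset.sum_congr rfl e1, Finset.sum_congr rfl e2, Finset.sum_add_distrib,
        Finset.sum_range_sub (fun k => Z k (hist k ω)), hZ0]
      have := hrun N (hist (N + 1) ω) hN
      simp only [Finset.sum_const, Finset.card_range, nsmul_eq_mul]
      push_cast
      linarith
    · have hN' : ω ∉ hist N ⁻¹' R N := hN
      rw [Finset.sum_range_succ, Finset.sum_range_succ, Set.indicator_of_notMem hN',
        Set.indicator_of_notMem hN', add_zero, add_zero]
      exact ih

/-- Wald-type bound for the expected stopping time of a test: the process `Z` has drift at least
`a` except on rare bad records, and cannot be large while the test is running. -/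
theorem expectedTime_le (hZ : HasBoundedIncrements M Z C) (hM : S.HasStrategy M) {τ : State d}
    {a b K η B : ℝ} {bad : ∀ k, Set (Fin k → POVM d X × X)} (hbad : ∀ k, MeasurableSet (bad k))
    (hb : 0 ≤ b) (hK : 0 ≤ K) (hη : 0 ≤ η) (hηa : η < a) (hB : 0 ≤ B)
    (hdrift : ∀ k h, h ∉ bad k → a ≤ drift M τ.1 Z k h)
    (hdrift' : ∀ k h, a - b ≤ drift M τ.1 Z k h)
    (hrun : ∀ k (h : Fin (k + 1) → POVM d X × X), Fin.init h ∈ S.running k → Z (k + 1) h ≤ K + η * (k + 1))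
    (hsum : ∑' k, S.law τ {ω | hist k ω ∈ bad k} ≤ ENNReal.ofReal B) :
    S.expectedTime τ ≤ ENNReal.ofReal ((K + b * B) / (a - η)) := by
  rw [S.expectedTime_eq]
  refine ENNReal.tsum_le_of_sum_range_le fun N => ?_
  have hRm : ∀ k, MeasurableSet (hist k ⁻¹' S.running k) := fun k =>
    measurable_hist k (S.measurableSet_running k)
  have hC := hZ.nonneg
  set s := ∑ k ∈ Finset.range N, S.law τ {ω | hist k ω ∈ S.running k} with hs
  have hs_ne_top : s ≠ ∞ := ENNReal.sum_ne_top.mpr fun k _ => measure_ne_top _ _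
  -- While running, the shifted increment has conditional mean at least `a + C`, except on bad
  -- records, where the missing drift is at most `b`.
  have hstep : ∀ k, ENNReal.ofReal (a + C) * S.law τ {ω | hist k ω ∈ S.running k} ≤
      ∫⁻ ω, ENNReal.ofReal ((hist k ⁻¹' S.running k).indicator
        (fun ω => Z (k + 1) (hist (k + 1) ω) - Z k (hist k ω) + C) ω) ∂(S.law τ) +
      ENNReal.ofReal b * S.law τ {ω | hist k ω ∈ bad k} := by
    intro k
    have hbm : MeasurableSet (hist k ⁻¹' bad k) := measurable_hist k (hbad k)
    let f : (Fin (k + 1) → POVM d X × X) → ℝ≥0∞ := fun h =>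
      ENNReal.ofReal ((Fin.init ⁻¹' S.running k).indicator
        (fun h => Z (k + 1) h - Z k (Fin.init h) + C) h)
    have hf : Measurable f :=
      ((((hZ.measurable _).sub ((hZ.measurable k).comp (measurable_init k))).add_const C).indicator
        (measurable_init k (S.measurableSet_running k))).ennreal_ofReal
    have e1 := S.lintegral_hist_succ_eq_sum hM τ k hf
    have e2 : ∀ ω, f (hist (k + 1) ω) = ENNReal.ofReal ((hist k ⁻¹' S.running k).indicator
        (fun ω => Z (k + 1) (hist (k + 1) ω) - Z k (hist k ω) + C) ω) := by
      intro ω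
      by_cases hω : hist k ω ∈ S.running k
      · simp only [f]
        rw [Set.indicator_of_mem (show hist (k + 1) ω ∈ Fin.init ⁻¹' S.running k from hω),
          Set.indicator_of_mem (show ω ∈ hist k ⁻¹' S.running k from hω), init_hist]
      · simp only [f]
        rw [Set.indicator_of_notMem (show hist (k + 1) ω ∉ Fin.init ⁻¹' S.running k from hω),
          Set.indicator_of_notMem (show ω ∉ hist k ⁻¹' S.running k from hω)]
    simp only [e2] at e1
    have i1 : ENNReal.ofReal (a + C) * S.law τ {ω | hist k ω ∈ S.running k} =
        ∫⁻ ω, (hist k ⁻¹' S.running k).indicator (fun _ => ENNReal.ofReal (a + C)) ω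
          ∂(S.law τ) := by
      rw [lintegral_indicator (hRm k), lintegral_const, Measure.restrict_apply_univ]; rfl
    have i2 : ENNReal.ofReal b * S.law τ {ω | hist k ω ∈ bad k} =
        ∫⁻ ω, (hist k ⁻¹' bad k).indicator (fun _ => ENNReal.ofReal b) ω ∂(S.law τ) := by
      rw [lintegral_indicator hbm, lintegral_const, Measure.restrict_apply_univ]; rfl
    rw [e1, i1, i2, ← lintegral_add_right _ (measurable_const.indicator hbm)]
    refine lintegral_mono fun ω => ?_
    by_cases hω : hist k ω ∈ S.running k
    swap
    · rw [Set.indicator_of_notMem (show ω ∉ hist k ⁻¹' S.running k from hω)]; exact zero_le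
    rw [Set.indicator_of_mem (show ω ∈ hist k ⁻¹' S.running k from hω)]
    have e3 : ∀ x, f (Fin.snoc (hist k ω) (M k (hist k ω), x)) = ENNReal.ofReal
        (Z (k + 1) (Fin.snoc (hist k ω) (M k (hist k ω), x)) - Z k (hist k ω) + C) := by
      intro x
      simp only [f]
      rw [Set.indicator_of_mem]
      · rw [Fin.init_snoc]
      · rw [Set.mem_preimage, Fin.init_snoc]; exact hω
    simp only [e3]
    rw [sum_ofReal_bornProb_mul _ _ fun x => by
      have := (abs_le.mp (hZ.abs_sub_le k (hist k ω) (M k (hist k ω), x))).1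
      linarith]
    simp only [mul_add, Finset.sum_add_distrib]
    rw [← Finset.sum_mul, sum_bornProb, one_mul]
    change _ ≤ ENNReal.ofReal (drift M τ.1 Z k (hist k ω) + C) + _
    by_cases hω' : hist k ω ∈ bad k
    · rw [Set.indicator_of_mem (show ω ∈ hist k ⁻¹' bad k from hω')]
      refine le_trans (ENNReal.ofReal_le_ofReal ?_) ENNReal.ofReal_add_le
      linarith [hdrift' k (hist k ω)]
    · refine le_add_right (ENNReal.ofReal_le_ofReal ?_)
      linarith [hdrift k (hist k ω) hω']
  have hpath : ∑ k ∈ Finset.range N, ∫⁻ ω, ENNReal.ofReal ((hist k ⁻¹' S.running k).indicator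
        (fun ω => Z (k + 1) (hist (k + 1) ω) - Z k (hist k ω) + C) ω) ∂(S.law τ) ≤
      ENNReal.ofReal K + ENNReal.ofReal (η + C) * s := by
    have hmeas : ∀ k, Measurable fun ω => ENNReal.ofReal ((hist k ⁻¹' S.running k).indicator
        (fun ω => Z (k + 1) (hist (k + 1) ω) - Z k (hist k ω) + C) ω) := fun k =>
      (((((hZ.measurable (k + 1)).comp (measurable_hist (k + 1))).sub ((hZ.measurable k).comp
        (measurable_hist k))).add_const C).indicator (hRm k)).ennreal_ofReal
    rw [← lintegral_finsetSum _ fun k _ => hmeas k]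
    have i3 : ENNReal.ofReal K + ENNReal.ofReal (η + C) * s = ∫⁻ ω, (ENNReal.ofReal K +
        ENNReal.ofReal (η + C) * ∑ k ∈ Finset.range N,
          (hist k ⁻¹' S.running k).indicator (fun _ => (1 : ℝ≥0∞)) ω) ∂(S.law τ) := by
      rw [lintegral_add_left measurable_const, lintegral_const, measure_univ, mul_one,
        lintegral_const_mul' _ _ ENNReal.ofReal_ne_top, lintegral_finsetSum _ fun k _ =>
          measurable_const.indicator (hRm k), hs]
      congr 2
      refine Finset.sum_congr rfl fun k _ => ?_
      rw [lintegral_indicator (hRm k), lintegral_const, Measure.restrict_apply_univ, one_mul]; rfl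
    rw [i3]
    refine lintegral_mono fun ω => ?_
    have hnn : ∀ k ∈ Finset.range N, 0 ≤ (hist k ⁻¹' S.running k).indicator
        (fun ω => Z (k + 1) (hist (k + 1) ω) - Z k (hist k ω) + C) ω := fun k _ => by
      refine Set.indicator_nonneg (fun ω _ => ?_) ω
      have := (abs_le.mp (hZ.abs_sub_le k (hist k ω) (ω k))).1
      rw [snoc_hist] at this
      linarith
    rw [← ENNReal.ofReal_sum_of_nonneg hnn]
    refine (ENNReal.ofReal_le_ofReal (sum_increments_le (R := S.running) (fun k h hh => hh.1)
      hZ.zero hK hrun ω N)).trans ?_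
    refine ENNReal.ofReal_add_le.trans ?_
    rw [ENNReal.ofReal_mul (by linarith), ENNReal.ofReal_sum_of_nonneg fun k _ =>
      Set.indicator_nonneg (fun _ _ => zero_le_one) _]
    gcongr with k
    by_cases hω : ω ∈ hist k ⁻¹' S.running k <;> simp [hω]
  have htot : ENNReal.ofReal (a + C) * s ≤
      ENNReal.ofReal K + ENNReal.ofReal (η + C) * s + ENNReal.ofReal b * ENNReal.ofReal B := by
    calc _ = ∑ k ∈ Finset.range N, ENNReal.ofReal (a + C) *
          S.law τ {ω | hist k ω ∈ S.running k} := Finset.mul_sum _ _ _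
      _ ≤ _ := Finset.sum_le_sum fun k _ => hstep k
      _ ≤ _ := by
        rw [Finset.sum_add_distrib, ← Finset.mul_sum]
        gcongr
        exact (ENNReal.sum_le_tsum _).trans hsum
  -- The truncated sum is finite, so the shift terms `C * s` may be cancelled in real arithmetic.
  have hs' : s = ENNReal.ofReal s.toReal := (ENNReal.ofReal_toReal hs_ne_top).symm
  set r := s.toReal with hr
  have hr0 : 0 ≤ r := ENNReal.toReal_nonneg
  rw [hs', ← ENNReal.ofReal_mul (by linarith), ← ENNReal.ofReal_mul (by linarith),
    ← ENNReal.ofReal_mul hb, ← ENNReal.ofReal_add hK (by positivity),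
    ← ENNReal.ofReal_add (by positivity) (by positivity),
    ENNReal.ofReal_le_ofReal_iff (by positivity)] at htot
  rw [hs']
  refine ENNReal.ofReal_le_ofReal ?_
  rw [le_div_iff₀ (by linarith)]
  linarith

end HasBoundedIncrements

end Drift

/-! ### Elementary estimates for logarithmic terms and geometric tails. -/

theorem exists_mul_log_le {a ε : ℝ} (ha : 0 ≤ a) (hε : 0 < ε) :
    ∃ c : ℝ, 0 ≤ c ∧ ∀ k : ℕ, a * Real.log (k + 1) ≤ c + ε * k := by
  have hδ : 0 < ε / (a + 1) := by positivity
  set δ := ε / (a + 1) with hδdef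
  refine ⟨|a * (δ - 1 - Real.log δ)|, abs_nonneg _, fun k => ?_⟩
  have hk : (0 : ℝ) < k + 1 := by positivity
  have h1 := Real.log_le_sub_one_of_pos (mul_pos hδ hk)
  rw [Real.log_mul hδ.ne' hk.ne'] at h1
  have h2 : a * δ ≤ ε := by
    rw [hδdef, mul_div_assoc', div_le_iff₀ (by positivity)]
    nlinarith
  have h3 : a * Real.log (k + 1) ≤ a * (δ - 1 - Real.log δ) + a * δ * k := by
    have := mul_le_mul_of_nonneg_left (show Real.log ((k : ℝ) + 1) ≤ (δ - 1 - Real.log δ) + δ * k by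
      linarith) ha
    linarith
  have h4 : a * δ * k ≤ ε * k := by gcongr
  linarith [le_abs_self (a * (δ - 1 - Real.log δ))]

theorem measure_hist_mem {Y : Type*} [MeasurableSpace Y] (μ : Measure (ℕ → Y)) {k : ℕ}
    {E : Set (Fin k → Y)} (hE : MeasurableSet E) :
    μ {ω | hist k ω ∈ E} = ∫⁻ ω, E.indicator (fun _ => 1) (hist k ω) ∂μ :=
  (lintegral_indicator_one (μ := μ) (measurable_hist k hE)).symm

theorem tsum_ofReal_exp_le {c μ : ℝ} (hμ : 0 < μ) :
    ∑' k : ℕ, ENNReal.ofReal (Real.exp (c - μ * k)) ≤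
      ENNReal.ofReal (Real.exp c * (1 - Real.exp (-μ))⁻¹) := by
  have h1 : Real.exp (-μ) < 1 := by rw [Real.exp_lt_one_iff]; linarith
  have e : ∀ k : ℕ, Real.exp (c - μ * k) = Real.exp c * Real.exp (-μ) ^ k := fun k => by
    rw [← Real.exp_nat_mul, ← Real.exp_add]; congr 1; ring
  have hs := (summable_geometric_of_lt_one (Real.exp_pos (-μ)).le h1).mul_left (Real.exp c)
  simp only [e]
  rw [← ENNReal.ofReal_tsum_of_nonneg (fun k => by positivity) hs, tsum_mul_left,
    tsum_geometric_of_lt_one (Real.exp_pos (-μ)).le h1]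

/-- The Chernoff bound with `t` so small that the second-order term uses at most half of the drift.
-/
theorem HasBoundedIncrements.measure_le_le_exp {d : ℕ} {X : Type*} [Fintype X] [MeasurableSpace X]
    [DiscreteMeasurableSpace X] {S : SQHT d X} {M : ∀ k, (Fin k → POVM d X × X) → POVM d X}
    {Z : ∀ k, (Fin k → POVM d X × X) → ℝ} {C : ℝ}
    (hZ : HasBoundedIncrements M Z C) (hM : S.HasStrategy M) {τ : State d}
    {δ t : ℝ} (hδ : ∀ k h, δ ≤ drift M τ.1 Z k h) (ht : 0 ≤ t) (htC : t * C ≤ 1)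
    (htC' : t * C ^ 2 ≤ δ / 2) (k : ℕ) (z : ℝ) : S.law τ {ω | Z k (hist k ω) ≤ z} ≤
      ENNReal.ofReal (Real.exp (t * z - t * δ / 2 * k)) := by
  refine (hZ.measure_le_le hM hδ ht htC k z).trans (ENNReal.ofReal_le_ofReal ?_)
  rw [Real.exp_le_exp]
  have hk : (0 : ℝ) ≤ k := Nat.cast_nonneg k
  nlinarith [mul_le_mul_of_nonneg_left (mul_le_mul_of_nonneg_left htC' ht) hk]

theorem exists_small_rate {δ C : ℝ} (hδ : 0 < δ) (hC : 0 ≤ C) :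
    ∃ t₀ : ℝ, 0 < t₀ ∧ ∀ t, 0 ≤ t → t ≤ t₀ → t * C ≤ 1 ∧ t * C ^ 2 ≤ δ / 2 := by
  refine ⟨min (1 / (C + 1)) (δ / 2 / (C ^ 2 + 1)), by positivity, fun t ht h => ⟨?_, ?_⟩⟩
  · have h1 := h.trans (min_le_left _ _)
    rw [le_div_iff₀ (by positivity)] at h1
    linarith
  · have h1 := h.trans (min_le_right _ _)
    rw [le_div_iff₀ (by positivity)] at h1
    linarith

/-! ### Information rates of the mixture test. -/

/-- Measurement selections which guarantee the information rates `κ₀` and `κ₁`. -/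
structure GoodSelections {d : ℕ} {X : Type*} [Fintype X] (ρ : CMat d) (D : Set (CMat d))
    (m₀ m₁ : CMat d → POVM d X) (κ₀ κ₁ : ℝ) : Prop where
  pos₀ : 0 < κ₀
  pos₁ : 0 < κ₁
  le₀ : ∀ σ ∈ D, κ₀ ≤ bornRelEnt ρ σ (m₀ σ)
  le₁ : ∀ σ ∈ D, κ₁ ≤ bornRelEnt σ ρ (m₁ σ)

section Mixture

variable {d : ℕ} {X : Type*} [Fintype X]
  {ρ : State d} {D : Set (CMat d)} {L : ℝ} {m₀ m₁ : CMat d → POVM d X} {κ₀ κ₁ : ℝ}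

theorem thresholdDecision_eq_null {A B : ℝ} {k : ℕ} {h : Fin k → POVM d X × X}
    (hd : thresholdDecision ρ.1 D A B h = Decision.null) : B ≤ mixtureLLR ρ.1 D h := by
  unfold thresholdDecision at hd
  split_ifs at hd with h1
  exact h1

theorem thresholdDecision_eq_alternative {A B : ℝ} {k : ℕ} {h : Fin k → POVM d X × X}
    (hd : thresholdDecision ρ.1 D A B h = Decision.alternative) : mixtureLLR ρ.1 D h ≤ -A := by
  unfold thresholdDecision at hd
  split_ifs at hd with h1 h2
  exact h2

theorem thresholdDecision_eq_continue {A B : ℝ} {k : ℕ} {h : Fin k → POVM d X × X}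
    (hd : thresholdDecision ρ.1 D A B h = Decision.continue) :
    -A ≤ mixtureLLR ρ.1 D h ∧ mixtureLLR ρ.1 D h ≤ B := by
  unfold thresholdDecision at hd
  split_ifs at hd with h1 h2
  exact ⟨(not_le.mp h2).le, (not_le.mp h1).le⟩

namespace TestSetting

theorem relEnt_hypotheses (hT : TestSetting X ρ D L) (m : POVM d X) {σ : CMat d}
    (hσ : σ ∈ insert ρ.1 D) :
    (∀ x, 0 ≤ bornProb m x σ) ∧ ∑ x, bornProb m x σ = 1 := by
  rcases hσ with rfl | hσ
  · exact ⟨fun x => SequentialQHT.bornProb_nonneg m x ρ, SequentialQHT.sum_bornProb m ρ⟩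
  · exact ⟨fun x => hT.bornProb_nonneg m x hσ, hT.sum_bornProb m hσ⟩

theorem bornRelEnt_sub_le_mul_swap (hT : TestSetting X ρ D L) (m : POVM d X) {σ τ : CMat d}
    (hσ : σ ∈ insert ρ.1 D) (hτ : τ ∈ insert ρ.1 D) {K : ℝ} (hK : 0 ≤ K) :
    bornRelEnt τ σ m - Fintype.card X * L ^ 2 / (K + 1) ≤ K * bornRelEnt σ τ m :=
  relEnt_sub_le_mul_relEnt_swap (hT.relEnt_hypotheses m hσ).1 (hT.relEnt_hypotheses m hτ).1
    (hT.relEnt_hypotheses m hσ).2 (hT.relEnt_hypotheses m hτ).2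
    (fun x => hT.bornProb_eq_zero_iff m x hσ hτ) hK fun x => hT.abs_log_le m x hτ hσ

/-- The measurements chosen by the mixture test discriminate the null state from the posterior
barycentre, in both directions. -/
theorem exists_pos_le_bornRelEnt (hT : TestSetting X ρ D L)
    (hG : GoodSelections ρ.1 D m₀ m₁ κ₀ κ₁) :
    ∃ δ : ℝ, 0 < δ ∧ ∀ σ ∈ D, ∀ m, (m = m₀ σ ∨ m = m₁ σ) →
      δ ≤ bornRelEnt ρ.1 σ m ∧ δ ≤ bornRelEnt σ ρ.1 m := by
  have hκ : 0 < min κ₀ κ₁ := lt_min hG.pos₀ hG.pos₁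
  set κ := min κ₀ κ₁ with hκdef
  -- This `K` makes the error in the swap inequality at most `κ / 2`, leaving `κ / (2K)` for the
  -- reversed divergence.
  set K : ℝ := Fintype.card X * L ^ 2 / (κ / 2) + 1 with hKdef
  have hK : 0 < K := by positivity
  have hη : Fintype.card X * L ^ 2 / (K + 1) ≤ κ / 2 := by
    have : Fintype.card X * L ^ 2 / (κ / 2) ≤ K + 1 := by rw [hKdef]; linarith
    rw [div_le_iff₀ (by positivity)] at this
    rw [div_le_iff₀ (by positivity)]
    linarith
  refine ⟨min κ (κ / (2 * K)), by positivity, fun σ hσ m hm => ?_⟩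
  have hρ' : ρ.1 ∈ insert ρ.1 D := Set.mem_insert _ _
  have hσ' : σ ∈ insert ρ.1 D := Set.mem_insert_of_mem _ hσ
  have hswap : ∀ a b : ℝ, κ ≤ a → a - Fintype.card X * L ^ 2 / (K + 1) ≤ K * b →
      κ / (2 * K) ≤ b := by
    intro a b ha hab
    rw [div_le_iff₀ (by positivity)]
    linarith
  rcases hm with rfl | rfl
  · have h1 := (min_le_left κ₀ κ₁).trans (hG.le₀ σ hσ)
    exact ⟨(min_le_left _ _).trans h1, (min_le_right _ _).trans
      (hswap _ _ h1 (hT.bornRelEnt_sub_le_mul_swap (m₀ σ) hσ' hρ' hK.le))⟩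
  · have h1 := (min_le_right κ₀ κ₁).trans (hG.le₁ σ hσ)
    exact ⟨(min_le_right _ _).trans
      (hswap _ _ h1 (hT.bornRelEnt_sub_le_mul_swap (m₁ σ) hρ' hσ' hK.le)),
      (min_le_left _ _).trans h1⟩

theorem nextPOVM_eq_or {k : ℕ} (h : Fin k → POVM d X × X) :
    nextPOVM ρ.1 D m₀ m₁ h = m₀ (barycentre ρ.1 D h) ∨
      nextPOVM ρ.1 D m₀ m₁ h = m₁ (barycentre ρ.1 D h) := by
  unfold nextPOVM
  split_ifs
  · exact Or.inl rfl
  · exact Or.inr rfl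

end TestSetting

variable [MeasurableSpace X] [DiscreteMeasurableSpace X]

theorem mixtureSQPRT_hasStrategy (hm₀ : Measurable m₀) (hm₁ : Measurable m₁) (A B : ℝ) :
    (mixtureSQPRT ρ.1 D m₀ m₁ hm₀ hm₁ A B).HasStrategy fun k => nextPOVM (k := k) ρ.1 D m₀ m₁ :=
  fun _ h => Kernel.deterministic_apply (measurable_nextPOVM ρ.1 D hm₀ hm₁) h

namespace TestSetting

theorem mixtureLLR_mem_of_running (hT : TestSetting X ρ D L) (hm₀ : Measurable m₀)
    (hm₁ : Measurable m₁) {A B : ℝ} (hA : 0 ≤ A) (hB : 0 ≤ B) {k : ℕ}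
    {h : Fin k → POVM d X × X} (hr : h ∈ (mixtureSQPRT ρ.1 D m₀ m₁ hm₀ hm₁ A B).running k) :
    -A ≤ mixtureLLR ρ.1 D h ∧ mixtureLLR ρ.1 D h ≤ B := by
  cases k with
  | zero => rw [hT.mixtureLLR_zero]; exact ⟨by linarith, hB⟩
  | succ k => exact thresholdDecision_eq_continue hr.2

/-! ### Behaviour under the null state -/

theorem hasBoundedIncrements_mixtureLLR (hT : TestSetting X ρ D L)
    (M : ∀ k, (Fin k → POVM d X × X) → POVM d X) :
    HasBoundedIncrements M (fun k => mixtureLLR (k := k) ρ.1 D) L where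
  measurable k := measurable_mixtureLLR ρ.1 D
  zero h := hT.mixtureLLR_zero h
  nonneg := hT.nonneg
  abs_sub_le k h y := by
    rw [hT.mixtureLLR_snoc, add_sub_cancel_left]
    exact hT.abs_log_le _ _ (Set.mem_insert _ _) (Set.mem_insert_of_mem _ (hT.barycentre_mem h))

theorem drift_mixtureLLR (hT : TestSetting X ρ D L)
    (M : ∀ k, (Fin k → POVM d X × X) → POVM d X) (k : ℕ) (h : Fin k → POVM d X × X) :
    drift M ρ.1 (fun k => mixtureLLR (k := k) ρ.1 D) k h =
      bornRelEnt ρ.1 (barycentre ρ.1 D h) (M k h) := by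
  simp only [drift, hT.mixtureLLR_snoc, add_sub_cancel_left]
  rfl

/-- Bad records are those with negative `mixtureLLR`, where `m₁` is used. The drift is still at
least `δ > 0` there, so their expected number is bounded independently of the thresholds. -/
theorem exists_expectedTime_null_le (hT : TestSetting X ρ D L) (hm₀ : Measurable m₀)
    (hm₁ : Measurable m₁) (hG : GoodSelections ρ.1 D m₀ m₁ κ₀ κ₁) :
    ∃ C : ℝ, ∀ A B : ℝ, 0 ≤ A → 0 ≤ B →
      (mixtureSQPRT ρ.1 D m₀ m₁ hm₀ hm₁ A B).expectedTime ρ ≤ ENNReal.ofReal ((B + C) / κ₀) := by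
  obtain ⟨δ, hδ, hδ'⟩ := hT.exists_pos_le_bornRelEnt hG
  obtain ⟨t, ht, htC⟩ := exists_small_rate hδ hT.nonneg
  obtain ⟨htC, htC'⟩ := htC t ht.le le_rfl
  have hZ := hT.hasBoundedIncrements_mixtureLLR fun k => nextPOVM (k := k) ρ.1 D m₀ m₁
  have hdr : ∀ k h, δ ≤ drift (fun k => nextPOVM (k := k) ρ.1 D m₀ m₁) ρ.1
      (fun k => mixtureLLR (k := k) ρ.1 D) k h := fun k h => by
    rw [hT.drift_mixtureLLR]
    exact (hδ' _ (hT.barycentre_mem h) _ (nextPOVM_eq_or h)).1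
  have hB₀ : 0 ≤ Real.exp 0 * (1 - Real.exp (-(t * δ / 2)))⁻¹ := by
    have : Real.exp (-(t * δ / 2)) ≤ 1 := Real.exp_le_one_iff.mpr (by
      have := mul_pos ht hδ; linarith)
    exact mul_nonneg (Real.exp_pos _).le (inv_nonneg.mpr (by linarith))
  set B₀ := Real.exp 0 * (1 - Real.exp (-(t * δ / 2)))⁻¹
  refine ⟨L + κ₀ * B₀, fun A B hA hB => ?_⟩
  set S := mixtureSQPRT ρ.1 D m₀ m₁ hm₀ hm₁ A B
  have hM : S.HasStrategy fun k => nextPOVM (k := k) ρ.1 D m₀ m₁ :=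
    mixtureSQPRT_hasStrategy hm₀ hm₁ A B
  have key := hZ.expectedTime_le hM (τ := ρ) (a := κ₀) (b := κ₀) (K := B + L) (η := 0) (B := B₀)
    (bad := fun k => {h | mixtureLLR ρ.1 D h < 0})
    (fun k => measurableSet_lt (measurable_mixtureLLR ρ.1 D) measurable_const) hG.pos₀.le
    (add_nonneg hB hT.nonneg) le_rfl hG.pos₀ hB₀ ?_ ?_ ?_ ?_
  · rwa [sub_zero, add_assoc] at key
  · intro k h hh
    rw [hT.drift_mixtureLLR]
    have hpos : 0 ≤ mixtureLLR ρ.1 D h := not_lt.mp hh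
    have : nextPOVM ρ.1 D m₀ m₁ h = m₀ (barycentre ρ.1 D h) := by
      unfold nextPOVM; exact if_pos hpos
    rw [this]
    exact hG.le₀ _ (hT.barycentre_mem h)
  · intro k h
    rw [sub_self]
    exact hδ.le.trans (hdr k h)
  -- The value after one round started while running exceeds `B` by at most one increment `L`.
  · intro k h hr
    have h1 := (hT.mixtureLLR_mem_of_running hm₀ hm₁ hA hB hr).2
    have h2 := (abs_le.mp (hZ.abs_sub_le k (Fin.init h) (h (Fin.last k)))).2
    rw [Fin.snoc_init_self] at h2
    linarith
  · refine le_trans (ENNReal.tsum_le_tsum fun k => ?_)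
      (tsum_ofReal_exp_le (c := 0) (μ := t * δ / 2) (by positivity))
    refine (measure_mono fun ω hω => ?_).trans
      ((hZ.measure_le_le_exp hM hdr ht.le htC htC' k 0).trans_eq (by rw [mul_zero]))
    exact (show mixtureLLR ρ.1 D (hist k ω) < 0 from hω).le

/-! ### Behaviour under the alternatives -/

/-- The process `-(K + 1) S(σ) + K S̃` used to control the test under the alternative `σ`. -/
def alternativeProcess (ρ : CMat d) (D : Set (CMat d)) (σ : CMat d) (K : ℝ) (k : ℕ)
    (h : Fin k → POVM d X × X) : ℝ :=
  K * mixtureLLR ρ D h - (K + 1) * pointwiseLLR ρ h σ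

/-- The weights `K` and `-(K+1)` sum to `-1`, so replacing `S(σ)` by the smaller `S̃` minus a
logarithm leaves `-S̃` plus a logarithm. Hence the process cannot be large while the test runs. -/
theorem alternativeProcess_le (hT : TestSetting X ρ D L) {σ : CMat d} (hσ : σ ∈ D) {K : ℝ}
    (hK : 0 ≤ K) (k : ℕ) (h : Fin k → POVM d X × X) :
    alternativeProcess ρ.1 D σ K k h ≤ -mixtureLLR ρ.1 D h + (K + 1) *
      (1 + Module.finrank ℝ (tracelessHermitian d) * Real.log (k + 1)) := by
  have h1 := mul_le_mul_of_nonneg_left (hT.mixtureLLR_le h hσ) (show 0 ≤ K + 1 by linarith)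
  rw [alternativeProcess]
  linarith

theorem alternativeProcess_snoc_sub (hT : TestSetting X ρ D L) (σ : CMat d) (K : ℝ) (k : ℕ)
    (h : Fin k → POVM d X × X) (y : POVM d X × X) :
    alternativeProcess ρ.1 D σ K (k + 1) (Fin.snoc h y) - alternativeProcess ρ.1 D σ K k h =
      (K + 1) * Real.log (bornProb y.1 y.2 σ / bornProb y.1 y.2 ρ.1) -
        K * Real.log (bornProb y.1 y.2 (barycentre ρ.1 D h) / bornProb y.1 y.2 ρ.1) := by
  rw [alternativeProcess, alternativeProcess, hT.mixtureLLR_snoc, pointwiseLLR_snoc,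
    ← inv_div (bornProb y.1 y.2 ρ.1) (bornProb y.1 y.2 σ),
    ← inv_div (bornProb y.1 y.2 ρ.1) (bornProb y.1 y.2 (barycentre ρ.1 D h)),
    Real.log_inv, Real.log_inv]
  ring

theorem hasBoundedIncrements_alternativeProcess (hT : TestSetting X ρ D L)
    (M : ∀ k, (Fin k → POVM d X × X) → POVM d X) {σ : CMat d} (hσ : σ ∈ D) {K : ℝ}
    (hK : 0 ≤ K) :
    HasBoundedIncrements M (alternativeProcess ρ.1 D σ K) ((2 * K + 1) * L) where
  measurable k := ((measurable_mixtureLLR ρ.1 D).const_mul K).sub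
    (((measurable_pointwiseLLR ρ.1).comp measurable_prodMk_right).const_mul (K + 1))
  zero h := by rw [alternativeProcess, hT.mixtureLLR_zero]; simp [pointwiseLLR]
  nonneg := mul_nonneg (by linarith) hT.nonneg
  abs_sub_le k h y := by
    rw [hT.alternativeProcess_snoc_sub]
    have h1 := hT.abs_log_le y.1 y.2 (Set.mem_insert_of_mem _ hσ) (Set.mem_insert ρ.1 D)
    have h2 := hT.abs_log_le y.1 y.2 (Set.mem_insert_of_mem _ (hT.barycentre_mem h))
      (Set.mem_insert ρ.1 D)
    refine (abs_sub _ _).trans ?_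
    rw [abs_mul, abs_mul, abs_of_nonneg hK, abs_of_nonneg (by linarith : 0 ≤ K + 1)]
    nlinarith [mul_le_mul_of_nonneg_left h1 (by linarith : 0 ≤ K + 1),
      mul_le_mul_of_nonneg_left h2 hK]

/-- The trade-off inequality with `p`, `s`, `r` the outcome laws of `σ`, of the barycentre and of
`ρ`. The divergence on the left is the one that `m₁` maximises, although the outcomes come from `σ`.
-/
theorem bornRelEnt_sub_le_drift_alternativeProcess (hT : TestSetting X ρ D L)
    (M : ∀ k, (Fin k → POVM d X × X) → POVM d X) {σ : CMat d} (hσ : σ ∈ D) {K : ℝ}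
    (hK : 0 ≤ K) (k : ℕ) (h : Fin k → POVM d X × X) :
    bornRelEnt (barycentre ρ.1 D h) ρ.1 (M k h) - Fintype.card X * L ^ 2 / (K + 1) ≤
      drift M σ (alternativeProcess ρ.1 D σ K) k h := by
  have hρ' : ρ.1 ∈ insert ρ.1 D := Set.mem_insert _ _
  have hσ' : σ ∈ insert ρ.1 D := Set.mem_insert_of_mem _ hσ
  have hb' : barycentre ρ.1 D h ∈ insert ρ.1 D := Set.mem_insert_of_mem _ (hT.barycentre_mem h)
  simp only [drift, hT.alternativeProcess_snoc_sub]
  exact relEnt_sub_le_drift (hT.relEnt_hypotheses _ hσ').1 (hT.relEnt_hypotheses _ hb').1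
    (hT.relEnt_hypotheses _ hσ').2 (hT.relEnt_hypotheses _ hb').2
    (fun x => hT.bornProb_eq_zero_iff _ x hσ' hb') (fun x => hT.bornProb_eq_zero_iff _ x hσ' hρ')
    hK fun x => hT.abs_log_le _ x hb' hρ'

/-- Bad records are those with `0 ≤ mixtureLLR`. There `alternativeProcess` is at most logarithmic
in `k`, while its drift is always at least `δ / 2`, so such records are exponentially rare,
uniformly in `σ`. -/
theorem exists_expectedTime_alternative_le (hT : TestSetting X ρ D L) (hm₀ : Measurable m₀)
    (hm₁ : Measurable m₁) (hG : GoodSelections ρ.1 D m₀ m₁ κ₀ κ₁) {ε : ℝ} (hε : 0 < ε)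
    (hεκ : ε < κ₁) :
    ∃ C : ℝ, ∀ A B : ℝ, 0 ≤ A → 0 ≤ B → ∀ σ : State d, σ.1 ∈ D →
      (mixtureSQPRT ρ.1 D m₀ m₁ hm₀ hm₁ A B).expectedTime σ ≤
        ENNReal.ofReal ((A + C) / (κ₁ - ε)) := by
  obtain ⟨δ, hδ, hδ'⟩ := hT.exists_pos_le_bornRelEnt hG
  have hη : 0 < min (δ / 2) (ε / 2) := by positivity
  -- `K` will make the drift error at most `η`: the bound by `δ / 2` keeps the drift positive in
  -- every round, and the bound by `ε / 2` keeps it above `κ₁ - ε / 2` in good rounds.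
  set η := min (δ / 2) (ε / 2) with hηdef
  have hη1 : η ≤ δ / 2 := min_le_left _ _
  have hη2 : η ≤ ε / 2 := min_le_right _ _
  set K : ℝ := Fintype.card X * L ^ 2 / η with hKdef
  have hK : 0 ≤ K := by positivity
  have hKη : Fintype.card X * L ^ 2 / (K + 1) ≤ η := by
    have : Fintype.card X * L ^ 2 / η ≤ K + 1 := by rw [hKdef]; linarith
    rw [div_le_iff₀ (by positivity)] at this
    rw [div_le_iff₀ (by positivity)]
    linarith
  set C := (2 * K + 1) * L with hCdef
  have hC : 0 ≤ C := mul_nonneg (by linarith) hT.nonneg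
  have hδ2 : 0 < δ / 2 := by positivity
  obtain ⟨t, ht, htC⟩ := exists_small_rate hδ2 hC
  obtain ⟨htC, htC'⟩ := htC t ht.le le_rfl
  set dim : ℝ := (Module.finrank ℝ (tracelessHermitian d) : ℝ) with hdim
  have hdim0 : 0 ≤ (K + 1) * dim := by positivity
  -- Slope `δ / 8` is half of the Chernoff slope `δ / 4`, so the bad-record bound still decays. The
  -- slope `ε / 2` below is the second half of the loss in `κ₁ - ε`.
  obtain ⟨c₁, -, hc₁⟩ := exists_mul_log_le hdim0 (show 0 < δ / 8 by positivity)
  obtain ⟨c₂, hc₂0, hc₂⟩ := exists_mul_log_le hdim0 (show 0 < ε / 2 by positivity)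
  have hμ : 0 < t * δ / 8 := by positivity
  have hB₀ : 0 ≤ Real.exp (t * (K + 1 + c₁)) * (1 - Real.exp (-(t * δ / 8)))⁻¹ := by
    have : Real.exp (-(t * δ / 8)) ≤ 1 := Real.exp_le_one_iff.mpr (by linarith)
    exact mul_nonneg (Real.exp_pos _).le (inv_nonneg.mpr (by linarith))
  set B₀ := Real.exp (t * (K + 1 + c₁)) * (1 - Real.exp (-(t * δ / 8)))⁻¹
  refine ⟨L + (K + 1) + c₂ + κ₁ * B₀, fun A B hA hB σ hσ => ?_⟩
  set S := mixtureSQPRT ρ.1 D m₀ m₁ hm₀ hm₁ A B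
  have hM : S.HasStrategy fun k => nextPOVM (k := k) ρ.1 D m₀ m₁ :=
    mixtureSQPRT_hasStrategy hm₀ hm₁ A B
  have hZ := hT.hasBoundedIncrements_alternativeProcess
    (fun k => nextPOVM (k := k) ρ.1 D m₀ m₁) hσ hK
  have hdr := hT.bornRelEnt_sub_le_drift_alternativeProcess
    (fun k => nextPOVM (k := k) ρ.1 D m₀ m₁) hσ hK
  have hdr' : ∀ k h, δ / 2 ≤ drift (fun k => nextPOVM (k := k) ρ.1 D m₀ m₁) σ.1
      (alternativeProcess ρ.1 D σ.1 K) k h := fun k h => by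
    have h1 := (hδ' _ (hT.barycentre_mem h) _ (nextPOVM_eq_or h)).2
    linarith [hdr k h]
  have hL := hT.nonneg
  have key := hZ.expectedTime_le hM (τ := σ) (a := κ₁ - ε / 2) (b := κ₁) (K := A + L + (K + 1) + c₂)
    (η := ε / 2) (B := B₀) (bad := fun k => {h | 0 ≤ mixtureLLR ρ.1 D h})
    (fun k => measurableSet_le measurable_const (measurable_mixtureLLR ρ.1 D)) hG.pos₁.le
    (by positivity) (by positivity) (by linarith) hB₀ ?_ ?_ ?_ ?_
  · have e : κ₁ - ε / 2 - ε / 2 = κ₁ - ε := by ring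
    rw [e] at key
    convert key using 3
    ring
  · intro k h hh
    have h1 : nextPOVM ρ.1 D m₀ m₁ h = m₁ (barycentre ρ.1 D h) := by
      unfold nextPOVM; exact if_neg hh
    have h2 := hdr k h
    rw [h1] at h2
    linarith [hG.le₁ _ (hT.barycentre_mem h)]
  · intro k h
    linarith [hdr' k h]
  · intro k h hr
    have h1 := (hT.mixtureLLR_mem_of_running hm₀ hm₁ hA hB hr).1
    have h2 := (abs_le.mp ((hT.hasBoundedIncrements_mixtureLLR
      (fun k => nextPOVM (k := k) ρ.1 D m₀ m₁)).abs_sub_le k (Fin.init h) (h (Fin.last k)))).1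
    rw [Fin.snoc_init_self] at h2
    have h3 := hT.alternativeProcess_le hσ hK (k + 1) h
    have h4 := hc₂ (k + 1)
    rw [← hdim] at h3
    push_cast at h3 h4
    linarith
  · refine le_trans (ENNReal.tsum_le_tsum fun k => ?_)
      (tsum_ofReal_exp_le (c := t * (K + 1 + c₁)) hμ)
    refine (measure_mono (t := {ω | alternativeProcess ρ.1 D σ.1 K k (hist k ω) ≤
      K + 1 + c₁ + δ / 8 * k}) fun ω hω => ?_).trans
      ((hZ.measure_le_le_exp hM hdr' ht.le htC htC' k _).trans
        (ENNReal.ofReal_le_ofReal (Real.exp_le_exp.mpr ?_)))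
    · have h3 := hT.alternativeProcess_le hσ hK k (hist k ω)
      have h4 := hc₁ k
      have h5 : 0 ≤ mixtureLLR ρ.1 D (hist k ω) := hω
      rw [← hdim] at h3
      change alternativeProcess ρ.1 D σ.1 K k (hist k ω) ≤ K + 1 + c₁ + δ / 8 * k
      linarith
    · linarith

/-! ### Error probabilities -/

/-- On stopping for the alternative, `1 ≤ e^(-A) mixtureLR`. By Tonelli and change of measure, the
integrals of `mixtureLR` over the stopping events sum to a prior average of stopping probabilities,
hence to at most one. -/
theorem typeI_le (hT : TestSetting X ρ D L) (hm₀ : Measurable m₀) (hm₁ : Measurable m₁)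
    (A B : ℝ) : (mixtureSQPRT ρ.1 D m₀ m₁ hm₀ hm₁ A B).typeI ρ ≤
      ENNReal.ofReal (Real.exp (-A)) := by
  have := hT.isProbabilityMeasure
  set S := mixtureSQPRT ρ.1 D m₀ m₁ hm₀ hm₁ A B with hS
  have hM : S.HasStrategy fun k => nextPOVM (k := k) ρ.1 D m₀ m₁ :=
    mixtureSQPRT_hasStrategy hm₀ hm₁ A B
  have hE : ∀ k, MeasurableSet (S.stopped Decision.alternative k) := fun k =>
    S.measurableSet_stopped _ k
  let F : ∀ k, (Fin (k + 1) → POVM d X × X) → ℝ≥0∞ := fun k =>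
    (S.stopped Decision.alternative k).indicator fun _ => 1
  have hF : ∀ k, Measurable (F k) := fun k => measurable_const.indicator (hE k)
  have hlaw : ∀ (τ : State d) k, S.law τ {ω | hist (k + 1) ω ∈ S.stopped Decision.alternative k} =
      ∫⁻ ω, F k (hist (k + 1) ω) ∂(S.law τ) := by
    intro τ k
    exact measure_hist_mem _ (hE k)
  have hG : ∀ k, Measurable fun p : (ℕ → POVM d X × X) × CMat d => F k (hist (k + 1) p.1) *
      ENNReal.ofReal (Real.exp (-pointwiseLLR ρ.1 (hist (k + 1) p.1) p.2)) := fun k =>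
    ((hF k).comp ((measurable_hist _).comp measurable_fst)).mul
      ((measurable_pointwiseLLR ρ.1).comp (((measurable_hist _).comp measurable_fst).prodMk
        measurable_snd)).neg.exp.ennreal_ofReal
  have hk : ∀ k, S.law ρ {ω | hist (k + 1) ω ∈ S.stopped Decision.alternative k} ≤
      ENNReal.ofReal (Real.exp (-A)) * ∫⁻ σ, ∫⁻ ω, F k (hist (k + 1) ω) *
        ENNReal.ofReal (Real.exp (-pointwiseLLR ρ.1 (hist (k + 1) ω) σ)) ∂(S.law ρ)
          ∂(uniformPrior D) := by
    intro k
    rw [← lintegral_lintegral_swap (hG k).aemeasurable, hlaw,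
      ← lintegral_const_mul' _ _ ENNReal.ofReal_ne_top]
    refine lintegral_mono fun ω => ?_
    have e : ∫⁻ σ, F k (hist (k + 1) ω) * ENNReal.ofReal
        (Real.exp (-pointwiseLLR ρ.1 (hist (k + 1) ω) σ)) ∂(uniformPrior D) =
        F k (hist (k + 1) ω) * ENNReal.ofReal (mixtureLR ρ.1 D (hist (k + 1) ω)) := by
      have hfin : F k (hist (k + 1) ω) ≠ ∞ := by
        by_cases hω : hist (k + 1) ω ∈ S.stopped Decision.alternative k <;> simp [F, hω]
      rw [lintegral_const_mul' _ _ hfin, mixtureLR, ofReal_integral_eq_lintegral_ofReal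
        (hT.integrable_exp _) (Eventually.of_forall fun _ => (Real.exp_pos _).le)]
    rw [e]
    by_cases hω : hist (k + 1) ω ∈ S.stopped Decision.alternative k
    · have h1 := thresholdDecision_eq_alternative hω.2
      simp only [F, Set.indicator_of_mem hω, one_mul]
      rw [← hT.exp_neg_mixtureLLR, ← ENNReal.ofReal_mul (Real.exp_pos _).le, ← Real.exp_add,
        ENNReal.one_le_ofReal, Real.one_le_exp_iff]
      linarith
    · simp only [F, Set.indicator_of_notMem hω]; exact zero_le
  refine (S.probDecide_le ρ _).trans ((ENNReal.tsum_le_tsum hk).trans ?_)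
  rw [ENNReal.tsum_mul_left, ← lintegral_tsum fun k =>
    ((hG k).lintegral_prod_left' (μ := S.law ρ)).aemeasurable]
  refine (mul_le_mul_right ?_ _).trans_eq (mul_one _)
  have h1 : ∫⁻ _, (1 : ℝ≥0∞) ∂(uniformPrior D) = 1 := by simp
  rw [← h1]
  refine lintegral_mono_ae ?_
  filter_upwards [hT.ae_mem] with σ hσ
  let σ' : State d := ⟨σ, (hT.state σ hσ).1.posSemidef, (hT.state σ hσ).2⟩
  refine le_trans (le_of_eq (tsum_congr fun k => ?_))
    (S.tsum_stopped_le_one σ' (δ := Decision.alternative) (by simp))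
  rw [hlaw, hT.lintegral_hist_change_of_measure S hM
    (fun k => measurable_nextPOVM ρ.1 D hm₀ hm₁) (σ := σ') hσ (k + 1) (hF k)]

/-- For a fixed `σ` the likelihood ratio at stopping is `e^(-B)` times a polynomial in `k`. Reaching
time `k` requires `mixtureLLR ≤ B` there, which under `ρ` has probability at most `exp (t B - t δ k
/ 2)`. Summing over `k` costs a constant and `e^(t B)` with `t ≤ ε`. -/
theorem exists_typeII_le (hT : TestSetting X ρ D L) (hm₀ : Measurable m₀) (hm₁ : Measurable m₁)
    (hG : GoodSelections ρ.1 D m₀ m₁ κ₀ κ₁) {ε : ℝ} (hε : 0 < ε) :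
    ∃ C : ℝ, ∀ A B : ℝ, 0 ≤ A → 0 ≤ B →
      (mixtureSQPRT ρ.1 D m₀ m₁ hm₀ hm₁ A B).typeII D ≤
        ENNReal.ofReal (Real.exp (C - (1 - ε) * B)) := by
  obtain ⟨δ, hδ, hδ'⟩ := hT.exists_pos_le_bornRelEnt hG
  obtain ⟨t₀, ht₀, htC⟩ := exists_small_rate hδ hT.nonneg
  have ht : 0 < min t₀ ε := lt_min ht₀ hε
  set t := min t₀ ε
  obtain ⟨htC, htC'⟩ := htC t ht.le (min_le_left _ _)
  have hZ := hT.hasBoundedIncrements_mixtureLLR fun k => nextPOVM (k := k) ρ.1 D m₀ m₁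
  have hdr : ∀ k h, δ ≤ drift (fun k => nextPOVM (k := k) ρ.1 D m₀ m₁) ρ.1
      (fun k => mixtureLLR (k := k) ρ.1 D) k h := fun k h => by
    rw [hT.drift_mixtureLLR]
    exact (hδ' _ (hT.barycentre_mem h) _ (nextPOVM_eq_or h)).1
  set dim : ℝ := (Module.finrank ℝ (tracelessHermitian d) : ℝ) with hdim
  have hdim0 : 0 ≤ dim := by positivity
  have hμ : 0 < t * δ / 4 := by positivity
  -- Half of the decay rate `t δ / 2` absorbs the polynomial, and the other half makes the series
  -- geometric.
  obtain ⟨c, -, hc⟩ := exists_mul_log_le hdim0 hμ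
  have hq : 0 < (1 - Real.exp (-(t * δ / 4)))⁻¹ := by
    rw [inv_pos, sub_pos, Real.exp_lt_one_iff]; linarith
  refine ⟨1 + c + t * δ / 4 + Real.log (1 - Real.exp (-(t * δ / 4)))⁻¹, fun A B hA hB => ?_⟩
  set S := mixtureSQPRT ρ.1 D m₀ m₁ hm₀ hm₁ A B with hS
  have hM : S.HasStrategy fun k => nextPOVM (k := k) ρ.1 D m₀ m₁ :=
    mixtureSQPRT_hasStrategy hm₀ hm₁ A B
  refine iSup₂_le fun σ hσ => (S.probDecide_le σ _).trans ?_
  have hk : ∀ k, S.law σ {ω | hist (k + 1) ω ∈ S.stopped Decision.null k} ≤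
      ENNReal.ofReal (Real.exp (1 + c + t * δ / 4 - (1 - t) * B - t * δ / 4 * k)) := by
    intro k
    have hE := S.measurableSet_stopped Decision.null k
    let F : (Fin (k + 1) → POVM d X × X) → ℝ≥0∞ :=
      (S.stopped Decision.null k).indicator fun _ => 1
    have hlaw : S.law σ {ω | hist (k + 1) ω ∈ S.stopped Decision.null k} =
        ∫⁻ ω, F (hist (k + 1) ω) ∂(S.law σ) := measure_hist_mem _ hE
    rw [hlaw, hT.lintegral_hist_change_of_measure S hM
      (fun k => measurable_nextPOVM ρ.1 D hm₀ hm₁) hσ (k + 1) (measurable_const.indicator hE)]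
    have hpt : ∀ ω, F (hist (k + 1) ω) *
        ENNReal.ofReal (Real.exp (-pointwiseLLR ρ.1 (hist (k + 1) ω) σ.1)) ≤
        ENNReal.ofReal (Real.exp (-B + 1 + dim * Real.log ((k + 1 : ℕ) + 1))) *
          {ω | mixtureLLR ρ.1 D (hist k ω) ≤ B}.indicator (fun _ => 1) ω := by
      intro ω
      by_cases hω : hist (k + 1) ω ∈ S.stopped Decision.null k
      · have h1 := thresholdDecision_eq_null hω.2
        have h2 := (hT.mixtureLLR_mem_of_running hm₀ hm₁ hA hB (show hist k ω ∈ _ from hω.1)).2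
        have h3 := hT.mixtureLLR_le (hist (k + 1) ω) hσ
        rw [← hdim] at h3
        rw [Set.indicator_of_mem (show ω ∈ {ω | mixtureLLR ρ.1 D (hist k ω) ≤ B} from h2)]
        simp only [F, Set.indicator_of_mem hω, one_mul, mul_one]
        refine ENNReal.ofReal_le_ofReal (Real.exp_le_exp.mpr ?_)
        linarith
      · simp only [F, Set.indicator_of_notMem hω, zero_mul]; exact zero_le
    refine (lintegral_mono hpt).trans ?_
    have hms : MeasurableSet {ω : ℕ → POVM d X × X | mixtureLLR ρ.1 D (hist k ω) ≤ B} :=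
      measurableSet_le ((measurable_mixtureLLR ρ.1 D).comp (measurable_hist k)) measurable_const
    rw [lintegral_const_mul' _ _ ENNReal.ofReal_ne_top, lintegral_indicator hms, lintegral_const,
      Measure.restrict_apply_univ, one_mul]
    refine (mul_le_mul_right (hZ.measure_le_le_exp hM hdr ht.le htC htC' k B) _).trans ?_
    rw [← ENNReal.ofReal_mul (Real.exp_pos _).le, ← Real.exp_add]
    refine ENNReal.ofReal_le_ofReal (Real.exp_le_exp.mpr ?_)
    have := hc (k + 1)
    push_cast at this ⊢
    linarith
  refine (ENNReal.tsum_le_tsum hk).trans ((tsum_ofReal_exp_le hμ).trans ?_)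
  refine ENNReal.ofReal_le_ofReal ?_
  rw [← Real.exp_log hq, ← Real.exp_add, Real.exp_le_exp, Real.log_exp]
  have : t * B ≤ ε * B := by gcongr; exact min_le_right _ _
  linarith

end TestSetting

end Mixture

/-! ### Exponents -/

/-- Take the largest `j ≤ n` for which the thresholds of all indices up to `j` have been passed by
`n`. -/
theorem exists_tendsto_eventually_diagonal {P : ℕ → ℕ → Prop} (h : ∀ j, ∀ᶠ n in atTop, P j n) :
    ∃ φ : ℕ → ℕ, Tendsto φ atTop atTop ∧ ∀ᶠ n in atTop, P (φ n) n := by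
  classical
  simp only [eventually_atTop] at h
  choose N hN using h
  refine ⟨fun n => Nat.findGreatest (fun j => ∀ i ≤ j, N i ≤ n) n, ?_, ?_⟩
  · refine tendsto_atTop.mpr fun b => ?_
    filter_upwards [eventually_ge_atTop (max b ((Finset.range (b + 1)).sup N))] with n hn
    refine Nat.le_findGreatest ((le_max_left _ _).trans hn) fun i hi => ?_
    exact (Finset.le_sup (Finset.mem_range_succ_iff.mpr hi)).trans ((le_max_right _ _).trans hn)
  · filter_upwards [eventually_ge_atTop (N 0)] with n hn
    have h0 : ∀ i ≤ 0, N i ≤ n := fun i hi => by rwa [Nat.le_zero.mp hi]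
    exact hN _ n (Nat.findGreatest_spec (P := fun j => ∀ i ≤ j, N i ≤ n) (Nat.zero_le n) h0 _ le_rfl)

theorem le_exponent_of_le_exp {a : ℝ≥0∞} {r : ℝ} {n : ℕ} (hn : 1 ≤ n)
    (ha : a ≤ ENNReal.ofReal (Real.exp (-(n * r)))) :
    (r : EReal) ≤ ((1 / (n : ℝ) : ℝ) : EReal) * ENNReal.log (1 / a) := by
  have hn' : (0 : ℝ) < n := by exact_mod_cast hn
  have h1 : ENNReal.ofReal (Real.exp (n * r)) ≤ 1 / a := by
    rw [one_div, ← ENNReal.inv_le_inv, inv_inv, ← ENNReal.ofReal_inv_of_pos (Real.exp_pos _),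
      ← Real.exp_neg]
    exact ha
  have h2 : ((n * r : ℝ) : EReal) ≤ ENNReal.log (1 / a) := by
    have := ENNReal.log_le_log h1
    rwa [ENNReal.log_ofReal_of_pos (Real.exp_pos _), Real.log_exp] at this
  have h3 : (r : EReal) = ((1 / (n : ℝ) : ℝ) : EReal) * ((n * r : ℝ) : EReal) := by
    rw [← EReal.coe_mul]; congr 1; field_simp
  rw [h3]
  exact mul_le_mul_of_nonneg_left h2 (by exact_mod_cast (by positivity : (0 : ℝ) ≤ 1 / n))

theorem le_liminf_of_tendsto_coe {u : ℕ → ℝ} {r : ℝ} (hu : Tendsto u atTop (𝓝 r))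
    {g : ℕ → EReal} (h : ∀ᶠ n in atTop, (u n : EReal) ≤ g n) : (r : EReal) ≤ liminf g atTop := by
  have h1 : Tendsto (fun n => (u n : EReal)) atTop (𝓝 (r : EReal)) :=
    (continuous_coe_real_ereal.tendsto r).comp hu
  rw [← h1.liminf_eq]
  exact liminf_le_liminf h

theorem le_liminf_of_forall_sub {r : ℝ} {g : ℕ → EReal}
    (h : ∀ ε : ℝ, 0 < ε → ∀ᶠ n in atTop, ((r - ε : ℝ) : EReal) ≤ g n) :
    (r : EReal) ≤ liminf g atTop := by
  refine le_of_forall_lt fun c hc => ?_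
  obtain ⟨y, hcy, hyr⟩ := EReal.lt_iff_exists_real_btwn.mp hc
  have hyr' : y < r := by exact_mod_cast hyr
  have := h (r - y) (by linarith)
  rw [sub_sub_cancel] at this
  exact hcy.trans_le (le_liminf_of_le (h := this))

theorem limsup_sub_le_zero {w : ℕ → ℝ≥0∞} (h : ∀ᶠ n : ℕ in atTop, w n ≤ n) :
    limsup (fun n : ℕ => (w n : EReal) - ((n : ℝ) : EReal)) atTop ≤ 0 := by
  refine limsup_le_of_le (h := ?_)
  filter_upwards [h] with n hn
  refine EReal.sub_nonpos.mpr ?_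
  have : ((n : ℝ≥0∞) : EReal) = ((n : ℝ) : EReal) := by
    rw [← ENNReal.ofReal_natCast, EReal.coe_ennreal_ofReal, max_eq_left (Nat.cast_nonneg n)]
  rw [← this]
  exact_mod_cast hn

namespace TestSetting

variable {d : ℕ} {X : Type*} [Fintype X] [MeasurableSpace X] [DiscreteMeasurableSpace X]
  {ρ : State d} {D : Set (CMat d)} {L : ℝ} {m₀ m₁ : CMat d → POVM d X} {κ₀ κ₁ : ℝ}

theorem eventually_typeII_le (hT : TestSetting X ρ D L) (hm₀ : Measurable m₀)
    (hm₁ : Measurable m₁) (hG : GoodSelections ρ.1 D m₀ m₁ κ₀ κ₁) {τ ε : ℝ} (hτ : 0 < τ)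
    (hτ₀ : τ < κ₀) (hτ₁ : τ < κ₁) (hε : 0 < ε) :
    ∀ᶠ n : ℕ in atTop, (mixtureSQPRT ρ.1 D m₀ m₁ hm₀ hm₁ (n * (κ₁ - τ)) (n * (κ₀ - τ))).typeII D ≤
      ENNReal.ofReal (Real.exp (-(n * (κ₀ - τ - ε)))) := by
  have hκ₀ := hG.pos₀
  -- The relative loss `ε / (2 κ₀)` of a threshold below `n κ₀` costs at most `n ε / 2`; the other
  -- `n ε / 2` absorbs `C`.
  obtain ⟨C, hC⟩ := hT.exists_typeII_le hm₀ hm₁ hG (ε := ε / (2 * κ₀)) (by positivity)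
  filter_upwards [tendsto_natCast_atTop_atTop.eventually_ge_atTop (C / (ε / 2))] with n hn
  have hn0 : (0 : ℝ) ≤ n := Nat.cast_nonneg n
  refine (hC _ _ (mul_nonneg hn0 (by linarith)) (mul_nonneg hn0 (by linarith))).trans
    (ENNReal.ofReal_le_ofReal (Real.exp_le_exp.mpr ?_))
  rw [div_le_iff₀ (by positivity)] at hn
  have h1 : ε / (2 * κ₀) * (κ₀ - τ) ≤ ε / 2 := by
    rw [div_mul_eq_mul_div, div_le_div_iff₀ (by positivity) (by positivity)]
    nlinarith
  nlinarith [mul_le_mul_of_nonneg_left h1 hn0]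

/-- The thresholds fall short of `n κ₀` and `n κ₁` by `n τ`. Under `ρ` all of this absorbs the
additive constant; under `D` half of it pays for the rate `κ₁ - τ / 2` and half for the constant. -/
theorem eventually_worstExpectedTime_le (hT : TestSetting X ρ D L) (hm₀ : Measurable m₀)
    (hm₁ : Measurable m₁) (hG : GoodSelections ρ.1 D m₀ m₁ κ₀ κ₁) {τ : ℝ} (hτ : 0 < τ)
    (hτ₀ : τ < κ₀) (hτ₁ : τ < κ₁) :
    ∀ᶠ n : ℕ in atTop,
      (mixtureSQPRT ρ.1 D m₀ m₁ hm₀ hm₁ (n * (κ₁ - τ)) (n * (κ₀ - τ))).worstExpectedTime ρ D ≤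
        n := by
  have hκ₀ := hG.pos₀
  obtain ⟨C, hC⟩ := hT.exists_expectedTime_null_le hm₀ hm₁ hG
  obtain ⟨C', hC'⟩ := hT.exists_expectedTime_alternative_le hm₀ hm₁ hG (ε := τ / 2) (by positivity)
    (by linarith)
  filter_upwards [tendsto_natCast_atTop_atTop.eventually_ge_atTop (C / τ),
    tendsto_natCast_atTop_atTop.eventually_ge_atTop (C' / (τ / 2))] with n hn hn'
  have hn0 : (0 : ℝ) ≤ n := Nat.cast_nonneg n
  have hA : 0 ≤ n * (κ₁ - τ) := mul_nonneg hn0 (by linarith)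
  have hB : 0 ≤ n * (κ₀ - τ) := mul_nonneg hn0 (by linarith)
  rw [div_le_iff₀ (by positivity)] at hn hn'
  refine max_le ((hC _ _ hA hB).trans ?_) (iSup₂_le fun σ hσ => (hC' _ _ hA hB σ hσ).trans ?_)
  · rw [← ENNReal.ofReal_natCast]
    refine ENNReal.ofReal_le_ofReal ?_
    rw [div_le_iff₀ hκ₀]
    linarith
  · rw [← ENNReal.ofReal_natCast]
    refine ENNReal.ofReal_le_ofReal ?_
    rw [div_le_iff₀ (by linarith)]
    linarith

theorem achieves_of_pos (hT : TestSetting X ρ D L) (hm₀ : Measurable m₀)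
    (hm₁ : Measurable m₁) (hG : GoodSelections ρ.1 D m₀ m₁ κ₀ κ₁) {τ : ℝ} (hτ : 0 < τ)
    (hτ₀ : τ < κ₀) (hτ₁ : τ < κ₁) :
    Achieves (fun n : ℕ => mixtureSQPRT ρ.1 D m₀ m₁ hm₀ hm₁ (n * (κ₁ - τ)) (n * (κ₀ - τ))) ρ D
      ((κ₁ - τ : ℝ) : EReal) ((κ₀ - τ : ℝ) : EReal) where
  typeI_exponent := le_liminf_of_tendsto_coe (u := fun _ => κ₁ - τ) tendsto_const_nhds <| by
    filter_upwards [eventually_ge_atTop 1] with n hn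
    exact le_exponent_of_le_exp hn (hT.typeI_le hm₀ hm₁ _ _)
  typeII_exponent := le_liminf_of_forall_sub fun ε hε => by
    filter_upwards [eventually_ge_atTop 1, hT.eventually_typeII_le hm₀ hm₁ hG hτ hτ₀ hτ₁ hε]
      with n hn h
    exact le_exponent_of_le_exp hn h
  expectation := limsup_sub_le_zero (hT.eventually_worstExpectedTime_le hm₀ hm₁ hG hτ hτ₀ hτ₁)

/-- The Type-II and time bounds hold only for `n` large depending on `τ`, so `τ` and the exponent
loss are sent to zero together along a slow diagonal. The Type-I bound holds for every threshold and
needs no such care. -/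
theorem exists_achieves (hT : TestSetting X ρ D L) (hm₀ : Measurable m₀)
    (hm₁ : Measurable m₁) (hG : GoodSelections ρ.1 D m₀ m₁ κ₀ κ₁) :
    ∃ τ : ℕ → ℝ, (∀ n, 0 < τ n ∧ τ n < min κ₀ κ₁) ∧ Tendsto τ atTop (𝓝 0) ∧
      Achieves
        (fun n : ℕ => mixtureSQPRT ρ.1 D m₀ m₁ hm₀ hm₁ (n * (κ₁ - τ n)) (n * (κ₀ - τ n))) ρ D
        (κ₁ : EReal) (κ₀ : EReal) := by
  have hκ : 0 < min κ₀ κ₁ := lt_min hG.pos₀ hG.pos₁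
  let ε : ℕ → ℝ := fun j => 1 / ((j : ℝ) + 1)
  let η : ℕ → ℝ := fun j => min κ₀ κ₁ / 2 * ε j
  have hε : ∀ j, 0 < ε j := fun j => by positivity
  have hη : ∀ j, 0 < η j := fun j => mul_pos (by positivity) (hε j)
  have hε1 : ∀ j, ε j ≤ 1 := fun j => by
    simp only [ε]
    rw [div_le_one (by positivity)]
    linarith [Nat.cast_nonneg (α := ℝ) j]
  have hη1 : ∀ j, η j < min κ₀ κ₁ := fun j => by
    have := mul_le_mul_of_nonneg_left (hε1 j) (half_pos hκ).le
    simp only [η]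
    linarith
  have hε0 : Tendsto ε atTop (𝓝 0) := tendsto_one_div_add_atTop_nhds_zero_nat
  have hη0 : Tendsto η atTop (𝓝 0) := by simpa using hε0.const_mul (min κ₀ κ₁ / 2)
  obtain ⟨φ, hφ, hev⟩ := exists_tendsto_eventually_diagonal fun j =>
    (hT.eventually_typeII_le hm₀ hm₁ hG (hη j) ((hη1 j).trans_le (min_le_left _ _))
      ((hη1 j).trans_le (min_le_right _ _)) (hε j)).and
    (hT.eventually_worstExpectedTime_le hm₀ hm₁ hG (hη j) ((hη1 j).trans_le (min_le_left _ _))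
      ((hη1 j).trans_le (min_le_right _ _)))
  refine ⟨fun n => η (φ n), fun n => ⟨hη _, hη1 _⟩, hη0.comp hφ, ⟨?_, ?_, ?_⟩⟩
  · refine le_liminf_of_tendsto_coe (u := fun n => κ₁ - η (φ n)) ?_ ?_
    · simpa using (hη0.comp hφ).const_sub κ₁
    · filter_upwards [eventually_ge_atTop 1] with n hn
      exact le_exponent_of_le_exp hn (hT.typeI_le hm₀ hm₁ _ _)
  · refine le_liminf_of_tendsto_coe (u := fun n => κ₀ - η (φ n) - ε (φ n)) ?_ ?_
    · simpa using ((hη0.comp hφ).const_sub κ₀).sub (hε0.comp hφ)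
    · filter_upwards [eventually_ge_atTop 1, hev] with n hn h
      exact le_exponent_of_le_exp hn h.1
  · exact limsup_sub_le_zero (hev.mono fun n h => h.2)

end TestSetting

/-- The measured relative entropies to and from `D` are finite and positive, and the maximising
selections guarantee them as information rates. -/
theorem goodSelections_of_isMaxOn {d : ℕ} {X : Type*} [Fintype X] [MeasurableSpace X]
    [DiscreteMeasurableSpace X] (hX : d ≤ Fintype.card X) {ρ : State d} (hρ : ρ.1.PosDef)
    {D : Set (CMat d)} (hD_state : ∀ σ ∈ D, σ.PosDef ∧ σ.trace = 1) (hD : IsCompact D)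
    (hne : D.Nonempty) (hρD : ρ.1 ∉ D) {m₀ m₁ : CMat d → POVM d X}
    (hm₀ : ∀ σ ∈ D, IsMaxOn (outcomeRelEntropy (X := X) ρ.1 σ) Set.univ (m₀ σ))
    (hm₁ : ∀ σ ∈ D, IsMaxOn (outcomeRelEntropy (X := X) σ ρ.1) Set.univ (m₁ σ)) :
    measuredRelEntropyToSet ρ.1 D ≠ ∞ ∧ measuredRelEntropyFromSet D ρ.1 ≠ ∞ ∧
      GoodSelections ρ.1 D m₀ m₁ (measuredRelEntropyToSet ρ.1 D).toReal
        (measuredRelEntropyFromSet D ρ.1).toReal := by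
  obtain ⟨δ, hδ, hpos⟩ := exists_pos_le_measuredRelEntropy hρ hD_state hD hρD
  have h₀ : ∀ σ ∈ D, measuredRelEntropyToSet ρ.1 D ≤
      ENNReal.ofReal (bornRelEnt ρ.1 σ (m₀ σ)) := by
    intro σ hσ
    let σ' : State d := ⟨σ, (hD_state σ hσ).1.posSemidef, (hD_state σ hσ).2⟩
    rw [← outcomeRelEntropy_eq (σ := σ') hρ (hD_state σ hσ).1]
    exact (iInf₂_le σ hσ).trans
      (measuredRelEntropy_le_outcomeRelEntropy (σ := σ') hX hρ (hD_state σ hσ).1 (hm₀ σ hσ))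
  have h₁ : ∀ σ ∈ D, measuredRelEntropyFromSet D ρ.1 ≤
      ENNReal.ofReal (bornRelEnt σ ρ.1 (m₁ σ)) := by
    intro σ hσ
    let σ' : State d := ⟨σ, (hD_state σ hσ).1.posSemidef, (hD_state σ hσ).2⟩
    rw [← outcomeRelEntropy_eq (ρ := σ') (hD_state σ hσ).1 hρ]
    exact (iInf₂_le σ hσ).trans
      (measuredRelEntropy_le_outcomeRelEntropy (ρ := σ') hX (hD_state σ hσ).1 hρ (hm₁ σ hσ))
  obtain ⟨σ₀, hσ₀⟩ := hne
  have hf₀ := ((h₀ σ₀ hσ₀).trans_lt ENNReal.ofReal_lt_top).ne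
  have hf₁ := ((h₁ σ₀ hσ₀).trans_lt ENNReal.ofReal_lt_top).ne
  have hp₀ : ENNReal.ofReal δ ≤ measuredRelEntropyToSet ρ.1 D :=
    le_iInf₂ fun σ hσ => (hpos σ hσ).1
  have hp₁ : ENNReal.ofReal δ ≤ measuredRelEntropyFromSet D ρ.1 :=
    le_iInf₂ fun σ hσ => (hpos σ hσ).2
  have hδ' := ENNReal.ofReal_pos.mpr hδ
  refine ⟨hf₀, hf₁, ENNReal.toReal_pos (hδ'.trans_le hp₀).ne' hf₀,
    ENNReal.toReal_pos (hδ'.trans_le hp₁).ne' hf₁, fun σ hσ => ?_, fun σ hσ => ?_⟩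
  · let σ' : State d := ⟨σ, (hD_state σ hσ).1.posSemidef, (hD_state σ hσ).2⟩
    exact ENNReal.toReal_le_of_le_ofReal
      (bornRelEnt_nonneg (σ := σ') hρ (hD_state σ hσ).1 _) (h₀ σ hσ)
  · let σ' : State d := ⟨σ, (hD_state σ hσ).1.posSemidef, (hD_state σ hσ).2⟩
    exact ENNReal.toReal_le_of_le_ofReal
      (bornRelEnt_nonneg (ρ := σ') (hD_state σ hσ).1 hρ _) (h₁ σ hσ)

theorem exists_testSetting {d : ℕ} (X : Type*) [Fintype X] {ρ : State d} (hρ : ρ.1.PosDef)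
    {D : Set (CMat d)} (hD_state : ∀ σ ∈ D, σ.PosDef ∧ σ.trace = 1) (hD_compact : IsCompact D)
    (hD_convex : Convex ℝ D) (hD_interior : ∃ σ ∈ D, D ∈ 𝓝[affineStates d] σ) :
    ∃ L, TestSetting X ρ D L := by
  obtain ⟨L, hL, h⟩ := exists_log_bornProb_bound X (hD_compact.insert ρ.1) (by
    rintro σ (rfl | hσ)
    · exact hρ
    · exact (hD_state σ hσ).1)
  exact ⟨L, hρ, hD_state, hD_compact, hD_convex, hD_interior, hL, h⟩

end SequentialQHT

end

theorem mainTheorem2 {d : ℕ} {X : Type*} [Fintype X] [MeasurableSpace X]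
    [DiscreteMeasurableSpace X] (hX : d ≤ Fintype.card X)
    (ρ : SequentialQHT.State d) (hρ : ρ.1.PosDef)
    (D : Set (SequentialQHT.CMat d))
    (hD_state : ∀ σ ∈ D, σ.PosDef ∧ σ.trace = 1)
    (hD_compact : IsCompact D) (hD_convex : Convex ℝ D)
    (hD_interior : ∃ σ ∈ D, D ∈ 𝓝[SequentialQHT.affineStates d] σ)
    (hρD : ρ.1 ∉ D)
    (m₀ m₁ : SequentialQHT.CMat d → SequentialQHT.POVM d X)
    (hm₀ : Measurable m₀) (hm₁ : Measurable m₁)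
    (hm₀_max : ∀ σ ∈ D, IsMaxOn (SequentialQHT.outcomeRelEntropy (X := X) ρ.1 σ) Set.univ (m₀ σ))
    (hm₁_max : ∀ σ ∈ D,
      IsMaxOn (SequentialQHT.outcomeRelEntropy (X := X) σ ρ.1) Set.univ (m₁ σ)) :
    (∀ τ : ℝ, 0 < τ →
      ENNReal.ofReal τ < min (SequentialQHT.measuredRelEntropyToSet ρ.1 D)
        (SequentialQHT.measuredRelEntropyFromSet D ρ.1) →
      SequentialQHT.Achieves
        (fun n : ℕ => SequentialQHT.mixtureSQPRT ρ.1 D m₀ m₁ hm₀ hm₁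
          (n * ((SequentialQHT.measuredRelEntropyFromSet D ρ.1).toReal - τ))
          (n * ((SequentialQHT.measuredRelEntropyToSet ρ.1 D).toReal - τ)))
        ρ D
        ((SequentialQHT.measuredRelEntropyFromSet D ρ.1 : EReal) - (τ : EReal))
        ((SequentialQHT.measuredRelEntropyToSet ρ.1 D : EReal) - (τ : EReal))) ∧
    ∃ τ : ℕ → ℝ,
      (∀ n, 0 < τ n ∧
        ENNReal.ofReal (τ n) < min (SequentialQHT.measuredRelEntropyToSet ρ.1 D)
          (SequentialQHT.measuredRelEntropyFromSet D ρ.1)) ∧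
      Tendsto τ atTop (𝓝 0) ∧
      SequentialQHT.Achieves
        (fun n : ℕ => SequentialQHT.mixtureSQPRT ρ.1 D m₀ m₁ hm₀ hm₁
          (n * ((SequentialQHT.measuredRelEntropyFromSet D ρ.1).toReal - τ n))
          (n * ((SequentialQHT.measuredRelEntropyToSet ρ.1 D).toReal - τ n)))
        ρ D
        (SequentialQHT.measuredRelEntropyFromSet D ρ.1 : EReal)
        (SequentialQHT.measuredRelEntropyToSet ρ.1 D : EReal) := by
  obtain ⟨L, hT⟩ :=
    SequentialQHT.exists_testSetting X hρ hD_state hD_compact hD_convex hD_interior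
  obtain ⟨σ₀, hσ₀, -⟩ := hD_interior
  obtain ⟨hf₀, hf₁, hG⟩ := SequentialQHT.goodSelections_of_isMaxOn hX hρ hD_state hD_compact
    ⟨σ₀, hσ₀⟩ hρD hm₀_max hm₁_max
  set E₀ := SequentialQHT.measuredRelEntropyToSet ρ.1 D
  set E₁ := SequentialQHT.measuredRelEntropyFromSet D ρ.1
  have e₀ : (E₀ : EReal) = (E₀.toReal : EReal) := (EReal.coe_ennreal_toReal hf₀).symm
  have e₁ : (E₁ : EReal) = (E₁.toReal : EReal) := (EReal.coe_ennreal_toReal hf₁).symm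
  refine ⟨fun τ hτ hτlt => ?_, ?_⟩
  · have h₀ := (ENNReal.ofReal_lt_iff_lt_toReal hτ.le hf₀).mp (hτlt.trans_le (min_le_left _ _))
    have h₁ := (ENNReal.ofReal_lt_iff_lt_toReal hτ.le hf₁).mp (hτlt.trans_le (min_le_right _ _))
    rw [e₀, e₁, ← EReal.coe_sub, ← EReal.coe_sub]
    exact hT.achieves_of_pos hm₀ hm₁ hG hτ h₀ h₁
  · obtain ⟨τ, hτ, hτ0, h⟩ := hT.exists_achieves hm₀ hm₁ hG
    rw [e₀, e₁]
    refine ⟨τ, fun n => ⟨(hτ n).1, lt_min ?_ ?_⟩, hτ0, h⟩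
    · exact (ENNReal.ofReal_lt_iff_lt_toReal (hτ n).1.le hf₀).mpr
        ((hτ n).2.trans_le (min_le_left _ _))
    · exact (ENNReal.ofReal_lt_iff_lt_toReal (hτ n).1.le hf₁).mpr
        ((hτ n).2.trans_le (min_le_right _ _))
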